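/- **Model.** Time is divided into slots $1,2,\dots$. The parties are a set $\mathcal H$ of honest parties and one adversary $\mathcal A$. Slot $t$ has a random finite set of leaders $\mathcal L_t\subseteq\mathcal H\cup\{\mathcal A\}$; $N_t$ is the number of honest leaders and $A_t=1$ if $\mathcal A\in\mathcal L_t$, $A_t=0$ otherwise. A block consists of a timestamp, a parent block with smaller timestamp, its proposer and some content; the genesis block has timestamp $0$ and no parent. A chain is a block together with all its ancestors. Every honest party $h$ holds one chain, $\mathcal C^h_i$ at the end of slot $i$, with $\mathcal C^h_0$ the genesis block. In each slot $i\ge 1$: (1) every honest leader appends to its chain one new block with timestamp $i$ and broadcasts the new chain; the message from $h$ to $h'$ sent in slot $i$ is assigned a random delay with values in $\{0,1,2,\dots\}\cup\{\infty\}$; (2) the adversary may create any set of blocks, each having an existing block as its parent and a timestamp $t\le i$ with $A_t=1$ that exceeds the parent's timestamp; (3) every honest party receives chains: an honest message sent in slot $t$ with finite delay $d$ must be received in one of the slots $t,\dots,t+d$ (the time within this range being up to the adversary; for $d=\infty$ the adversary may deliver it at any time or never), and in addition the adversary may deliver any existing chains; (4) an honest party that receives a chain strictly longer than its own adopts a longest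 chain received, ties being broken by the adversary; otherwise it keeps its chain. All delays are i.i.d., distributed as $\Delta$, and independent of the leader election. The adversary's choices may depend arbitrarily on all the randomness. One of the following holds: * (i.i.d. leader model) $\mathcal L_1,\mathcal L_2,\dots$ are i.i.d. (discrete) random sets, and $\Delta$ has non-decreasing failure rate: $s\mapsto\mathbb P(\Delta=s\mid\Delta\ge s)$ (read as $1$ where $\mathbb P(\Delta\ge s)=0$) is non-decreasing on $\{0,1,2,\dots\}$; or * (one-time leader model) the pairs $(N_t,A_t)$, $t\ge1$, are i.i.d., the honest leaders are drawn, in order and each only once, from a sequence $m_1,m_2,\dots$ of distinct honest parties, and the law of $\Delta$ on $\{0,1,2,\dots\}\cup\{\infty\}$ is arbitrary. Let $f=\mathbb P(N_1+A_1>0)$ and $\alpha=\mathbb P(N_1=1,\,A_1=0\mid N_1+A_1>0)$, let $G$ be geometric on $\{1,2,\dots\}$ with parameter $f$ and independent of $\Delta$, and suppose that $p=\alpha\,\mathbb P(\Delta<G)=(1+\epsilon)/2$ with $\epsilon>0$ ($\epsilon$-honest majority). **Properties.** Write $\mathcal C[i:j]$ for the blocks of the chain $\mathcal C$ with timestamps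 in $\{i,\dots,j\}$. For $\mathcal I\subseteq\mathcal H$, the $(s,k,\mathcal I)$-*settlement property* holds if $\mathcal C^{h_1}_{i_1}[1:s]=\mathcal C^{h_2}_{i_2}[1:s]$ for all $h_1,h_2\in\mathcal I$ and all $i_1,i_2$ with $s+k\le i_1\le i_2$. The $(\mu,s,k,\mathcal I)$-*intensive chain quality property* holds if for all $h\in\mathcal I$ and all $i\ge s+k$ the portion $\mathcal C^h_i[s+1:s+k]$ contains more than $kf\mu$ honestly mined blocks. **Theorem.** For every behavior of the adversary, every $\mathcal I\subseteq\mathcal H$ and all $s,k\in\mathbb N$, $$\mathbb P\big((s,k,\mathcal I)\text{-settlement is violated}\big)\le e^{-kf\epsilon^3/12}+3e^{-kf\epsilon^2/32}+|\mathcal I|\,\frac{2}{1-2^{-\epsilon/2}}\,e^{-kf\epsilon/16},$$ and for every $\mu$ with $0<\mu<\epsilon$, $$\mathbb P\big((\mu,s,k,\mathcal I)\text{-intensive chain quality is violated}\big)\le 4e^{-kf(\epsilon-\mu)^2/48}+|\mathcal I|\,\frac{2}{1-2^{-\epsilon/2}}\,e^{-kf(\epsilon-\mu)/8}.$$ -/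

import Mathlib

open MeasureTheory ProbabilityTheory
open scoped ENNReal

noncomputable section

namespace LongestChain

/-! ### Blocks and chains

Blocks are either the genesis block or extend a parent block; the proposer of a block is
`some h` for an honest party `h : H` and `none` for the adversary.  A block determines its
ancestry, so a chain is represented by its tip. -/

/-- Blocks with honest parties in `H` and block contents (transactions etc.) in `Payload`. -/
inductive Block (H Payload : Type*) where
  | genesis : Block H Payload
  | extend (parent : Block H Payload) (slot : ℕ) (proposer : Option H) (payload : Payload) :
      Block H Payload

variable {H Payload : Type*}

/-- The timestamp of a block. -/
def Block.slot : Block H Payload → ℕ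
  | .genesis => 0
  | .extend _ t _ _ => t

/-- The number of edges from the genesis block to the given block. -/
def Block.height : Block H Payload → ℕ
  | .genesis => 0
  | .extend b _ _ _ => b.height + 1

/-- Whether the block was mined by an honest party. -/
def Block.isHonest : Block H Payload → Bool
  | .extend _ _ (some _) _ => true
  | _ => false

/-- The blocks of the chain with the given tip, listed from the tip down to genesis. -/
def Block.toList : Block H Payload → List (Block H Payload)
  | .genesis => [.genesis]
  | .extend b t x d => .extend b t x d :: b.toList

/-- `C[i : j]`: the blocks of the chain with tip `C` whose timestamps lie in `{i, …, j}`. -/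
def Block.portion (C : Block H Payload) (i j : ℕ) : List (Block H Payload) :=
  C.toList.filter fun b => decide (i ≤ b.slot ∧ b.slot ≤ j)

/-! ### Executions

Slots are numbered `1, 2, …`; time `0` is the initial state, and the leader set and the delays
carrying the index `0` play no role.  `L t` is the set of leaders of slot `t`, a finite set of
parties in `Option H`, with `none` for the adversary.  `D t h h'` is the delay assigned to the
message sent by `h` to `h'` in slot `t` (only relevant if `h` leads slot `t`). -/

/-- The record of what happens in a run of the protocol. -/
structure Transcript (H Payload : Type*) where
  /-- the contents of the block made by an honest party in a slot that it leads -/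
  payload : ℕ → H → Payload
  /-- the new blocks that the adversary makes in a slot -/
  created : ℕ → Set (Block H Payload)
  /-- the chains delivered to an honest party in a slot -/
  received : ℕ → H → Set (Block H Payload)
  /-- the chain held by an honest party at the end of a slot -/
  chain : ℕ → H → Block H Payload

/-- The block that `h` makes if it is a leader of slot `t ≥ 1`: it extends the chain that `h`
holds at the end of the previous slot. -/
def Transcript.honestBlock (E : Transcript H Payload) (t : ℕ) (h : H) : Block H Payload :=
  .extend (E.chain (t - 1) h) t (some h) (E.payload t h)

/-- The set of all blocks made up to a given slot, including those the adversary keeps private. -/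
def Transcript.tree (E : Transcript H Payload) (L : ℕ → Finset (Option H)) :
    ℕ → Set (Block H Payload)
  | 0 => {.genesis}
  | i + 1 => E.tree L i ∪ {b | ∃ h, some h ∈ L (i + 1) ∧ b = E.honestBlock (i + 1) h} ∪
      E.created (i + 1)

open Classical in
/-- The chain of `h` in slot `t ≥ 1` before the deliveries of that slot: leaders have appended
their new block. -/
def Transcript.interim (E : Transcript H Payload) (L : ℕ → Finset (Option H)) (t : ℕ) (h : H) :
    Block H Payload :=
  if some h ∈ L t then E.honestBlock t h else E.chain (t - 1) h

/-- The transcript `E` is an execution of the longest-chain protocol with leader sets `L` and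
message delays `D`, for some behavior of the adversary. -/
structure IsExecution (L : ℕ → Finset (Option H)) (D : ℕ → H → H → ℕ∞)
    (E : Transcript H Payload) : Prop where
  /-- every honest party starts with the genesis block -/
  init : ∀ h, E.chain 0 h = .genesis
  /-- a block made by the adversary in slot `i + 1` extends an existing block, and its timestamp
  is later than that of its parent and belongs to a slot, up to the present one, which the
  adversary leads -/
  created_valid : ∀ i, ∀ b ∈ E.created (i + 1), ∃ parent ∈ E.tree L (i + 1), ∃ t x,
    b = .extend parent t none x ∧ none ∈ L t ∧ t ≤ i + 1 ∧ parent.slot < t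
  /-- only existing chains are delivered -/
  received_subset : ∀ i h, E.received (i + 1) h ⊆ E.tree L (i + 1)
  /-- a chain broadcast by an honest leader reaches every honest party at the latest when its
  delay has elapsed, possibly ahead of schedule; an infinite delay imposes nothing -/
  delivered : ∀ (t : ℕ) (h h' : H) (d : ℕ), some h ∈ L (t + 1) → D (t + 1) h h' = d →
    ∃ i, t + 1 ≤ i ∧ i ≤ t + 1 + d ∧ E.honestBlock (t + 1) h ∈ E.received i h'
  /-- an honest party keeps its chain unless it receives a strictly longer one, in which case it
  adopts one of the longest chains that it receives -/
  adopt : ∀ i h,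
    (E.chain (i + 1) h = E.interim L (i + 1) h ∧
      ∀ b ∈ E.received (i + 1) h, b.height ≤ (E.interim L (i + 1) h).height) ∨
    (E.chain (i + 1) h ∈ E.received (i + 1) h ∧
      (E.interim L (i + 1) h).height < (E.chain (i + 1) h).height ∧
      ∀ b ∈ E.received (i + 1) h, b.height ≤ (E.chain (i + 1) h).height)

/-! ### Security properties -/

/-- The `(s, k, I)`-settlement property. -/
def Settlement (E : Transcript H Payload) (s k : ℕ) (I : Set H) : Prop :=
  ∀ h₁ ∈ I, ∀ h₂ ∈ I, ∀ i₁ i₂ : ℕ, s + k ≤ i₁ → i₁ ≤ i₂ →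
    (E.chain i₁ h₁).portion 1 s = (E.chain i₂ h₂).portion 1 s

/-- The `(μ, s, k, I)`-intensive chain quality property, for mining rate `f`. -/
def IntensiveChainQuality (E : Transcript H Payload) (f μ : ℝ) (s k : ℕ) (I : Set H) : Prop :=
  ∀ h ∈ I, ∀ i : ℕ, s + k ≤ i →
    (k : ℝ) * f * μ < (((E.chain i h).portion (s + 1) (s + k)).countP Block.isHonest : ℝ)

/-! ### The random components -/

/-- The number `N` of honest leaders in a leader set. -/
def honestCount (S : Finset (Option H)) : ℕ := S.eraseNone.card

/-- The pair `(N, A)` of a leader set: the number of honest leaders, and whether the adversary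
is a leader. -/
def leaderTuple (S : Finset (Option H)) : ℕ × Prop := (honestCount S, none ∈ S)

variable {Ω : Type*} [MeasurableSpace Ω]

/-- The i.i.d. leader model: the leader sets of different slots are independent and identically
distributed.  They are discrete random variables (automatically so if `H` is countable). -/
structure IIDLeaders (P : Measure Ω) (L : ℕ → Ω → Finset (Option H)) : Prop where
  measurable : ∀ t, Measurable (L (t + 1))
  countable_range : ∀ t, (Set.range (L (t + 1))).Countable
  indep : iIndepFun (fun t => L (t + 1)) P
  ident : ∀ t, P.map (L (t + 1)) = P.map (L 1)

/-- The one-time leader model: the pairs `(N, A)` of different slots are independent and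
identically distributed, and the honest leaders are taken in order from the sequence
`m 0, m 1, …` of potential leaders, each being used once.  The honest parties outside the range
of `m` are observers. -/
structure OneTimeLeaders (P : Measure Ω) (m : ℕ ↪ H) (L : ℕ → Ω → Finset (Option H)) : Prop where
  measurable : ∀ t, Measurable fun ω => leaderTuple (L (t + 1) ω)
  indep : iIndepFun (fun t ω => leaderTuple (L (t + 1) ω)) P
  ident : ∀ t, P.map (fun ω => leaderTuple (L (t + 1) ω)) = P.map fun ω => leaderTuple (L 1 ω)
  leaders : ∀ t ω h, some h ∈ L (t + 1) ω ↔
    ∃ n, m n = h ∧ ∑ u ∈ Finset.range t, honestCount (L (u + 1) ω) ≤ n ∧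
      n < ∑ u ∈ Finset.range (t + 1), honestCount (L (u + 1) ω)

/-- The delays of all messages are independent with common law `ν`. -/
structure IIDDelays (P : Measure Ω) (D : ℕ → H → H → Ω → ℕ∞) (ν : Measure ℕ∞) : Prop where
  measurable : ∀ t h h', Measurable (D (t + 1) h h')
  indep : iIndepFun (fun x : ℕ × H × H => D (x.1 + 1) x.2.1 x.2.2) P
  law : ∀ t h h', P.map (D (t + 1) h h') = ν

/-- The leader election process is independent of the delays. -/
def LeadersIndepDelays (P : Measure Ω) (L : ℕ → Ω → Finset (Option H))
    (D : ℕ → H → H → Ω → ℕ∞) : Prop :=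
  IndepFun (fun ω (t : ℕ) => L (t + 1) ω)
    (fun ω (x : ℕ × H × H) => D (x.1 + 1) x.2.1 x.2.2 ω) P

open Classical in
/-- The failure rate function `s ↦ ℙ(Δ = s ∣ Δ ≥ s)` of a delay with law `ν`, equal to `1` where
`ℙ(Δ ≥ s) = 0`. -/
def failureRate (ν : Measure ℕ∞) (s : ℕ) : ℝ :=
  if ν {d | (s : ℕ∞) ≤ d} = 0 then 1 else ν.real {(s : ℕ∞)} / ν.real {d | (s : ℕ∞) ≤ d}

/-- `f`, the probability that a slot has at least one leader. -/
def miningRate (P : Measure Ω) [IsProbabilityMeasure P] (L : ℕ → Ω → Finset (Option H)) :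
    unitInterval :=
  ⟨P.real {ω | (L 1 ω).Nonempty}, measureReal_nonneg, measureReal_le_one⟩

/-- `α`, the conditional probability that a slot has exactly one honest leader and is not led by
the adversary, given that it has a leader. -/
def uniqueHonestProb (P : Measure Ω) (L : ℕ → Ω → Finset (Option H)) : ℝ :=
  (ProbabilityTheory.cond P {ω | (L 1 ω).Nonempty}).real
    {ω | honestCount (L 1 ω) = 1 ∧ none ∉ L 1 ω}

/-- `ℙ(Δ < G)` for independent `Δ` with law `ν` and `G` geometric on `{1, 2, …}` with
parameter `f`; Mathlib's geometric law is that of `G - 1`. -/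
def probDelayLtGeom (ν : Measure ℕ∞) (f : unitInterval) : ℝ :=
  (ν.prod (geometricMeasure f)).real {x : ℕ∞ × ℕ | x.1 < ((x.2 + 1 : ℕ) : ℕ∞)}

/-- The protocol has `ε`-honest majority: `ε > 0` and `p = α ℙ(Δ < G) = (1 + ε) / 2`. -/
def HonestMajority (P : Measure Ω) [IsProbabilityMeasure P] (L : ℕ → Ω → Finset (Option H))
    (ν : Measure ℕ∞) (ε : ℝ) : Prop :=
  0 < ε ∧ uniqueHonestProb P L * probDelayLtGeom ν (miningRate P L) = (1 + ε) / 2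

end LongestChain

end

noncomputable section

namespace LongestChain

/-! ### Structure of executions -/

section Deterministic

variable {H Payload : Type*}

/-! Call a slot special if its only leader is honest and has, before the slot, heard of the block of
the preceding special slot. Special blocks then have strictly increasing heights, and a special slot
carries a single block. All other non-empty slots are conceded to the adversary. What matters is the
walk that steps up at special slots, steps down at other non-empty slots and rests at empty ones.

Deterministic core (`chain_dichotomy`, `chain_window`). Follow a chain upwards from its last special
block at or before a slot `s`. Each later block that is not special uses up a non-special non-empty
slot, whereas the first special block beyond the window `(s, e]` must have gained at least as much
height as there were special slots. So a chain with few special blocks in the window forces a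
stretch around the window in which up-steps hardly outnumber down-steps, unless it has no special
block beyond the window. In the latter case it is short, and a party can hold it only while unaware
of many recent special blocks. For settlement the window is a single special slot that is a cut: the
walk is always lower before it than after it, so every relevant chain contains its block and hence
has the same past. For chain quality the window is `(s, s + k]`, and the walk climbs at a rate
exceeding what the few honest blocks could compensate.

Randomness. Types of non-empty slots are not independent: whether a leader has heard depends on the
gap since the last non-empty slot and on earlier failures of the same party to hear. If the delay is
new better than used, or if leaders are never reused, such failures do no harm, and a non-empty slot
is special with conditional probability at least `α * F (gap + 1)` (`LeaderLaw.wordLaw`). Averaged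
over the geometric waiting time for the next non-empty slot this becomes `α * φ gap`, which is at
least `p = α * φ 0`. Hence a potential that decreases on average for independent steps with
up-probability `p`, and that is no larger after an up-step than after a down-step, still decreases
once it is averaged over the step to come (`WordLaw.lintegral_pending_le`), which yields a Ville
inequality (`WordLaw.measure_exists_one_le`). The distance below the running maximum is dominated by
the geometric law that is stationary for the reflected walk (`WordLaw.lintegral_reach_le`).

Three estimates remain. The walk climbs at nearly the rate `ε` per non-empty slot, by an exponential
supermartingale with Hoeffding's bound (`WordLaw.measure_climb_le`). A cut appears early, because
up-steps from the running maximum are repeated trials, each undone with probability `(1 - ε) / (1 +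
ε)` in the comparison walk (`WordLaw.measure_cutFree_le`). Finally, the message of each special slot
to an observer has a fresh delay and is missing at the next non-empty slot with probability at most
`1 - φ 0 ≤ 1 / 2`, so missing `g` consecutive ones has probability at most `2⁻¹ ^ g`
(`LeaderLaw.measure_unaware_le`). A Chernoff bound turns `k` slots into about `k * f` non-empty
ones, and a union bound over the parties gives the theorem. -/

open Classical in
/-- The number of slots in `{1, …, t}` with a given property. -/
def countUpTo (p : ℕ → Prop) : ℕ → ℕ
  | 0 => 0
  | t + 1 => countUpTo p t + if p (t + 1) then 1 else 0

open Classical in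
/-- The last slot in `{1, …, t}` with a given property, and `0` if there is none. -/
def lastUpTo (p : ℕ → Prop) : ℕ → ℕ
  | 0 => 0
  | t + 1 => if p (t + 1) then t + 1 else lastUpTo p t

lemma countUpTo_mono (p : ℕ → Prop) : Monotone (countUpTo p) :=
  monotone_nat_of_le_succ fun _ => Nat.le_add_right _ _

lemma lastUpTo_le (p : ℕ → Prop) (t : ℕ) : lastUpTo p t ≤ t := by
  induction t with
  | zero => simp [lastUpTo]
  | succ t ih => rw [lastUpTo]; split_ifs <;> omega

lemma countUpTo_lastUpTo (p : ℕ → Prop) (t : ℕ) :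
    countUpTo p (lastUpTo p t) = countUpTo p t := by
  induction t with
  | zero => simp [lastUpTo]
  | succ t ih =>
    rw [lastUpTo]
    split_ifs with h
    · rfl
    · rw [ih, countUpTo, if_neg h, add_zero]

/-- If `c` has the property then it strictly increases the count. -/
lemma countUpTo_lt (p : ℕ → Prop) {a c : ℕ} (h : p c) (hac : a < c) :
    countUpTo p a < countUpTo p c := by
  obtain ⟨c, rfl⟩ : ∃ d, c = d + 1 := ⟨c - 1, by omega⟩
  rw [countUpTo, if_pos h]
  have := countUpTo_mono p (Nat.lt_succ_iff.mp hac)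
  omega

variable {L : ℕ → Finset (Option H)} {D : ℕ → H → H → ℕ∞} {E : Transcript H Payload}

lemma tree_mono (E : Transcript H Payload) (L : ℕ → Finset (Option H)) : Monotone (E.tree L) :=
  monotone_nat_of_le_succ fun i b hb => by
    rw [Transcript.tree]
    exact Or.inl (Or.inl hb)

lemma genesis_mem_tree (E : Transcript H Payload) (L : ℕ → Finset (Option H)) (i : ℕ) :
    Block.genesis ∈ E.tree L i :=
  tree_mono E L (Nat.zero_le i) (by simp [Transcript.tree])

lemma IsExecution.chain_mem_tree (hE : IsExecution L D E) (i : ℕ) (h : H) :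
    E.chain i h ∈ E.tree L i := by
  induction i with
  | zero => rw [hE.init h]; exact genesis_mem_tree E L 0
  | succ i ih =>
    rcases hE.adopt i h with ⟨h1, -⟩ | ⟨h1, -, -⟩
    · rw [h1, Transcript.interim]
      split_ifs with hL
      · rw [Transcript.tree]
        exact Or.inl (Or.inr ⟨h, hL, rfl⟩)
      · exact tree_mono E L (Nat.le_succ i) ih
    · exact hE.received_subset i h h1

lemma IsExecution.slot_le (hE : IsExecution L D E) (i : ℕ) :
    ∀ b ∈ E.tree L i, b.slot ≤ i := by
  induction i with
  | zero => intro b hb; simp [Transcript.tree] at hb; subst hb; simp [Block.slot]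
  | succ i ih =>
    intro b hb
    rw [Transcript.tree] at hb
    rcases hb with (hb | ⟨h, _, rfl⟩) | hb
    · exact (ih b hb).trans (Nat.le_succ i)
    · simp [Transcript.honestBlock, Block.slot]
    · obtain ⟨_, _, t, x, rfl, _, ht, _⟩ := hE.created_valid i b hb
      simpa [Block.slot] using ht

/-- Every block other than genesis extends an earlier block and belongs to one of the leaders of
its slot; an honest block is the one prescribed by the protocol. -/
lemma IsExecution.extend_mem_tree (hE : IsExecution L D E) (i : ℕ) :
    ∀ (b : Block H Payload) (t : ℕ) (x : Option H) (d : Payload),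
      Block.extend b t x d ∈ E.tree L i → b ∈ E.tree L i ∧ b.slot < t ∧ x ∈ L t ∧
        ∀ h, x = some h → Block.extend b t x d = E.honestBlock t h := by
  induction i with
  | zero => intro b t x d hb; simp [Transcript.tree] at hb
  | succ i ih =>
    intro b t x d hb
    have hb' := hb
    rw [Transcript.tree] at hb
    rcases hb with (hb | ⟨h, hL, hb⟩) | hb
    · obtain ⟨h1, h2⟩ := ih b t x d hb
      exact ⟨tree_mono E L (Nat.le_succ i) h1, h2⟩
    · have hb2 := hb
      simp only [Transcript.honestBlock, Block.extend.injEq, Nat.add_sub_cancel] at hb2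
      obtain ⟨rfl, rfl, rfl, rfl⟩ := hb2
      have hm := hE.chain_mem_tree i h
      refine ⟨tree_mono E L (Nat.le_succ i) hm, Nat.lt_succ_of_le (hE.slot_le i _ hm), hL, ?_⟩
      rintro h' hh
      simp only [Option.some.injEq] at hh
      subst hh
      exact hb
    · obtain ⟨par, hpar, t', x', he, hn, _, hlt⟩ := hE.created_valid i _ hb
      simp only [Block.extend.injEq] at he
      obtain ⟨rfl, rfl, rfl, rfl⟩ := he
      exact ⟨hpar, hlt, hn, by simp⟩

lemma IsExecution.height_interim (E : Transcript H Payload) (L : ℕ → Finset (Option H))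
    (i : ℕ) (h : H) : (E.chain i h).height ≤ (E.interim L (i + 1) h).height := by
  rw [Transcript.interim]
  split_ifs
  · simp [Transcript.honestBlock, Block.height]
  · simp

lemma IsExecution.height_mono (hE : IsExecution L D E) (h : H) :
    Monotone fun i => (E.chain i h).height :=
  monotone_nat_of_le_succ fun i => by
    have := IsExecution.height_interim E L i h
    rcases hE.adopt i h with ⟨h1, -⟩ | ⟨-, h1, -⟩
    · rw [h1]; exact this
    · omega

lemma IsExecution.height_le_of_received (hE : IsExecution L D E) {i j : ℕ} {h : H}
    {b : Block H Payload} (hb : b ∈ E.received (i + 1) h) (hij : i + 1 ≤ j) :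
    b.height ≤ (E.chain j h).height := by
  refine le_trans ?_ (hE.height_mono h hij)
  rcases hE.adopt i h with ⟨h1, h2⟩ | ⟨-, -, h2⟩
  · simp only [h1]; exact h2 b hb
  · exact h2 b hb

/-- A party that has heard of an honest block has a chain at least as long. -/
lemma IsExecution.height_le_of_delivered (hE : IsExecution L D E) {v i d : ℕ} {h h' : H}
    (hv : 1 ≤ v) (hL : some h ∈ L v) (hd : D v h h' = d) (hi : v + d ≤ i) :
    (E.honestBlock v h).height ≤ (E.chain i h').height := by
  obtain ⟨v, rfl⟩ : ∃ w, v = w + 1 := ⟨v - 1, by omega⟩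
  obtain ⟨j, hj1, hj2, hr⟩ := hE.delivered v h h' d hL hd
  obtain ⟨j, rfl⟩ : ∃ w, j = w + 1 := ⟨j - 1, by omega⟩
  exact hE.height_le_of_received hr (hj2.trans hi)

/-- `sp t = some h` singles out slots `t` whose only leader is the honest party `h`, in such a way
that `h` has heard of the block of the preceding special slot. -/
structure IsSpecial (L : ℕ → Finset (Option H)) (D : ℕ → H → H → ℕ∞) (sp : ℕ → Option H) :
    Prop where
  zero : sp 0 = none
  leader : ∀ t h, sp t = some h → L t = {some h}
  heard : ∀ t h hv, sp (t + 1) = some h → sp (lastUpTo (fun t => (sp t).isSome) t) = some hv →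
    ∃ d : ℕ, D (lastUpTo (fun t => (sp t).isSome) t) hv h = d ∧
      lastUpTo (fun t => (sp t).isSome) t + d ≤ t

/-- The number of special slots up to `t`. -/
def numSpecial (sp : ℕ → Option H) : ℕ → ℕ := countUpTo fun t => (sp t).isSome

/-- The number of non-empty slots up to `t` that are not special. -/
def numOther (L : ℕ → Finset (Option H)) (sp : ℕ → Option H) : ℕ → ℕ :=
  countUpTo fun t => (L t).Nonempty ∧ sp t = none

/-- The height of the block of a special slot; `0` for other slots. -/
def specialHeight (E : Transcript H Payload) (sp : ℕ → Option H) (t : ℕ) : ℕ :=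
  match sp t with
  | none => 0
  | some h => (E.honestBlock t h).height

/-- The number of blocks of special slots in `{s + 1, …, e}` on a chain. -/
def specialOn (sp : ℕ → Option H) (s e : ℕ) (C : Block H Payload) : ℕ :=
  C.toList.countP fun b => decide (s < b.slot ∧ b.slot ≤ e ∧ (sp b.slot).isSome)

variable {sp : ℕ → Option H}

lemma IsSpecial.pos (hsp : IsSpecial L D sp) {t : ℕ} {h : H} (ht : sp t = some h) : 1 ≤ t := by
  rcases Nat.eq_zero_or_pos t with rfl | h0
  · rw [hsp.zero] at ht; simp at ht
  · exact h0

/-- The leader of a special slot has heard of the previous special block, so its own block is at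
least one higher. Slot `0` is admitted as a base, with the height of genesis. -/
lemma specialHeight_le_last (hE : IsExecution L D E) (hsp : IsSpecial L D sp) (t : ℕ) :
    ∀ a ≤ t, a = 0 ∨ (sp a).isSome → specialHeight E sp a + numSpecial sp t ≤
      specialHeight E sp (lastUpTo (fun t => (sp t).isSome) t) + numSpecial sp a := by
  induction t with
  | zero => intro a ha _; obtain rfl : a = 0 := by omega
            simp [lastUpTo]
  | succ t ih =>
    intro a ha hg
    rcases Nat.lt_or_ge t a with hlt | hle
    · obtain rfl : a = t + 1 := by omega
      have : (sp (t + 1)).isSome := hg.resolve_left (by omega)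
      simp [lastUpTo, this]
    · have := ih a hle hg
      simp only [numSpecial, countUpTo, lastUpTo] at this ⊢
      split_ifs with h1
      · suffices specialHeight E sp (lastUpTo (fun t => (sp t).isSome) t) + 1 ≤
            specialHeight E sp (t + 1) by omega
        obtain ⟨h, hh⟩ := Option.isSome_iff_exists.mp h1
        rw [specialHeight, specialHeight, hh]
        simp only [Transcript.honestBlock, Nat.add_sub_cancel, Block.height]
        refine Nat.succ_le_succ ?_
        cases hl : sp (lastUpTo (fun t => (sp t).isSome) t) with
        | none => simp
        | some hv =>
          obtain ⟨d, hd, hle'⟩ := hsp.heard t h hv hh hl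
          exact hE.height_le_of_delivered (hsp.pos hl) (by simp [hsp.leader _ _ hl]) hd hle'
      · simpa using this

lemma specialHeight_le (hE : IsExecution L D E) (hsp : IsSpecial L D sp) {a b : ℕ} (hab : a ≤ b)
    (ha : a = 0 ∨ (sp a).isSome) (hb : (sp b).isSome) :
    specialHeight E sp a + numSpecial sp b ≤ specialHeight E sp b + numSpecial sp a := by
  have := specialHeight_le_last hE hsp b a hab ha
  have hl : lastUpTo (fun t => (sp t).isSome) b = b := by
    obtain ⟨h, hh⟩ := Option.isSome_iff_exists.mp hb
    obtain ⟨c, rfl⟩ : ∃ c, b = c + 1 := ⟨b - 1, by have := hsp.pos hh; omega⟩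
    simp [lastUpTo, hb]
  rwa [hl] at this

/-- Neither the adversary nor a second honest party leads a special slot, and its leader makes one
block there; the slot thus determines the block, whoever's chain it lies on. -/
lemma special_block_eq (hE : IsExecution L D E) (hsp : IsSpecial L D sp) {i t : ℕ} {h : H}
    {b : Block H Payload} (hb : b ∈ E.tree L i) (ht : sp b.slot = some h) (hbt : b.slot = t) :
    b = E.honestBlock t h := by
  subst hbt
  cases b with
  | genesis => simp [Block.slot, hsp.zero] at ht
  | extend b t x d =>
    obtain ⟨-, -, hx, hx'⟩ := hE.extend_mem_tree i b t x d hb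
    simp only [Block.slot] at ht ⊢
    rw [hsp.leader t h ht, Finset.mem_singleton] at hx
    exact hx' h hx

/-- The count behind both security properties: a chain that contains few special blocks of a window
forces a long stretch around the window in which special slots hardly outnumber the others, or
else it is short. -/
lemma chain_dichotomy (hE : IsExecution L D E) (hsp : IsSpecial L D sp) (s e i : ℕ) :
    ∀ C ∈ E.tree L i,
      (∃ a ≤ s, a ≤ C.slot ∧ (a = 0 ∨ (sp a).isSome) ∧
        C.height + numOther L sp a ≤
          specialHeight E sp a + numOther L sp C.slot + specialOn sp s e C) ∨
      ∃ a ≤ s, ∃ b, e ≤ b ∧ b < C.slot ∧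
        numSpecial sp b + numOther L sp a ≤
          numSpecial sp a + numOther L sp b + specialOn sp s e C := by
  intro C
  induction C with
  | genesis =>
    intro _
    exact Or.inl ⟨0, Nat.zero_le _, Nat.zero_le _, Or.inl rfl, by
      simp only [Block.height, Block.slot]; omega⟩
  | extend B t x d ih =>
    intro hC
    obtain ⟨hB, hlt, hx, -⟩ := hE.extend_mem_tree i B t x d hC
    have hslot : (Block.extend B t x d).slot = t := rfl
    have hY : specialOn sp s e (Block.extend B t x d) = specialOn sp s e B +
        if (s < t ∧ t ≤ e ∧ (sp t).isSome) then 1 else 0 := by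
      rw [specialOn, Block.toList, List.countP_cons]
      simp only [hslot, decide_eq_true_eq]
      rfl
    have hheight : (Block.extend B t x d).height = B.height + 1 := rfl
    rw [hslot, hheight, hY]
    rcases ih hB with ⟨a, has, hat, hga, hle⟩ | ⟨a, has, b, heb, hbt, hle⟩
    · have hmono : numOther L sp B.slot ≤ numOther L sp t := countUpTo_mono _ hlt.le
      cases hspt : sp t with
      | none =>
        -- The new block lies in a non-empty slot that is not special, and this slot pays for its
        -- unit of height.
        have : numOther L sp B.slot < numOther L sp t := countUpTo_lt _ ⟨⟨x, hx⟩, hspt⟩ hlt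
        exact Or.inl ⟨a, has, by omega, hga, by omega⟩
      | some h =>
        rcases Nat.lt_or_ge s t with hst | hts
        · rcases Nat.lt_or_ge e t with het | hte
          -- This is the first special block of the chain beyond the window. Its height exceeds that
          -- of the base `a` by at least the number of special slots in `(a, t]`, and the rest of
          -- the chain had to supply that height. The stretch ends at `t - 1` because the block
          -- itself accounts for one special slot.
          · refine Or.inr ⟨a, has, t - 1, by omega, by omega, ?_⟩
            have h1 := specialHeight_le hE hsp (a := a) (b := t) (by omega) hga (by simp [hspt])
            have h2 : specialHeight E sp t = B.height + 1 := by
              rw [specialHeight, hspt]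
              simp only
              rw [← special_block_eq hE hsp (t := t) hC hspt rfl, hheight]
            have h3 : numOther L sp B.slot ≤ numOther L sp (t - 1) :=
              countUpTo_mono _ (by omega)
            have h4 : numSpecial sp (t - 1) < numSpecial sp t :=
              countUpTo_lt _ (by simp [hspt]) (by omega)
            omega
          · refine Or.inl ⟨a, has, by omega, hga, ?_⟩
            rw [if_pos ⟨hst, hte, rfl⟩]
            omega
        -- A special block not beyond `s` becomes the new base, and the accounting restarts.
        · refine Or.inl ⟨t, hts, le_rfl, Or.inr (by simp [hspt]), ?_⟩
          have h2 : specialHeight E sp t = B.height + 1 := by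
            rw [specialHeight, hspt]
            simp only
            rw [← special_block_eq hE hsp (t := t) hC hspt rfl, hheight]
          omega
    · exact Or.inr ⟨a, has, b, heb, by omega, by omega⟩

/-- The chain held by a party that has heard of all but the last `u` special blocks. -/
lemma chain_window (hE : IsExecution L D E) (hsp : IsSpecial L D sp) {s e i : ℕ}
    (hsi : s ≤ i) (h : H) {v : ℕ} (hvi : v ≤ i) (hv : v = 0 ∨ (sp v).isSome)
    (hheard : specialHeight E sp v ≤ (E.chain i h).height) :
    ∃ a ≤ s, (∃ b, e ≤ b ∧ b ≤ i ∧ numSpecial sp b + numOther L sp a ≤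
        numSpecial sp a + numOther L sp b + specialOn sp s e (E.chain i h)) ∨
      numSpecial sp v + numOther L sp a ≤
        numSpecial sp a + numOther L sp i + specialOn sp s e (E.chain i h) := by
  have hC := hE.chain_mem_tree i h
  have hsl := hE.slot_le i _ hC
  rcases chain_dichotomy hE hsp s e i _ hC with ⟨a, has, -, hga, hle⟩ | ⟨a, has, b, heb, hbt, hle⟩
  · refine ⟨a, has, Or.inr ?_⟩
    have hmono : numOther L sp (E.chain i h).slot ≤ numOther L sp i := countUpTo_mono _ hsl
    -- If the block heard of is older than the base, heights are irrelevant and monotonicity of the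
    -- counts suffices.
    rcases Nat.lt_or_ge v a with hva | hav
    · have h1 : numSpecial sp v ≤ numSpecial sp a := countUpTo_mono _ hva.le
      have h2 : numOther L sp a ≤ numOther L sp i := countUpTo_mono _ (by omega)
      omega
    · rcases hv with rfl | hv
      · obtain rfl : a = 0 := by omega
        have h2 : numOther L sp 0 ≤ numOther L sp i := countUpTo_mono _ (by omega)
        omega
      · have := specialHeight_le hE hsp hav hga hv
        omega
  · exact ⟨a, has, Or.inl ⟨b, heb, by omega, hle⟩⟩

/-! ### Portions of chains -/

lemma mem_toList_tree (hE : IsExecution L D E) (i : ℕ) :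
    ∀ C ∈ E.tree L i, ∀ b ∈ C.toList, b ∈ E.tree L i ∧ b.slot ≤ C.slot := by
  intro C
  induction C with
  | genesis => intro hC b hb; simp [Block.toList] at hb; subst hb; exact ⟨hC, le_rfl⟩
  | extend B t x d ih =>
    intro hC b hb
    obtain ⟨hB, hlt, -, -⟩ := hE.extend_mem_tree i B t x d hC
    rw [Block.toList, List.mem_cons] at hb
    rcases hb with rfl | hb
    · exact ⟨hC, le_rfl⟩
    · obtain ⟨h1, h2⟩ := ih hB b hb
      exact ⟨h1, by simp only [Block.slot] at *; omega⟩

/-- The early portion of a chain is determined by any later block on it. -/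
lemma portion_eq_of_mem (hE : IsExecution L D E) (i s : ℕ) {b : Block H Payload} (hs : s < b.slot) :
    ∀ C ∈ E.tree L i, b ∈ C.toList → C.portion 1 s = b.portion 1 s := by
  intro C
  induction C with
  | genesis => intro hC hb; simp [Block.toList] at hb; subst hb; rfl
  | extend B t x d ih =>
    intro hC hb
    obtain ⟨hB, hlt, -, -⟩ := hE.extend_mem_tree i B t x d hC
    have hb2 := hb
    rw [Block.toList, List.mem_cons] at hb
    rcases hb with rfl | hb
    · rfl
    · have h2 := (mem_toList_tree hE i B hB b hb).2
      rw [← ih hB hb]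
      have : ¬ (1 ≤ t ∧ t ≤ s) := by omega
      simp [Block.portion, Block.toList, Block.slot, this]

/-- The window here consists of the single slot `c`, so a special block in it could only be the
block in question. -/
lemma specialOn_eq_zero (hE : IsExecution L D E) (hsp : IsSpecial L D sp) {i c : ℕ} {h : H}
    (hc : sp c = some h) {C : Block H Payload} (hC : C ∈ E.tree L i)
    (hmem : E.honestBlock c h ∉ C.toList) : specialOn sp (c - 1) c C = 0 := by
  rw [specialOn, List.countP_eq_zero]
  intro b hb
  simp only [decide_eq_true_eq, not_and]
  intro h1 h2 h3
  have hbc : b.slot = c := by omega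
  apply hmem
  rw [← special_block_eq hE hsp (mem_toList_tree hE i C hC b hb).1 (by rw [hbc]; exact hc) hbc]
  exact hb

/-- Special blocks are honest. This is the only place where chain quality loses the distinction
between special and honest blocks. -/
lemma specialOn_le_countP (hE : IsExecution L D E) (hsp : IsSpecial L D sp) {i s k : ℕ}
    {C : Block H Payload} (hC : C ∈ E.tree L i) :
    specialOn sp s (s + k) C ≤ (C.portion (s + 1) (s + k)).countP Block.isHonest := by
  rw [specialOn, Block.portion, List.countP_filter]
  refine List.countP_mono_left fun b hb h1 => ?_
  simp only [decide_eq_true_eq] at h1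
  obtain ⟨h, hh⟩ := Option.isSome_iff_exists.mp h1.2.2
  have hb' : b.isHonest = true := by
    rw [special_block_eq hE hsp (mem_toList_tree hE i C hC b hb).1 hh rfl]; rfl
  rw [hb', Bool.true_and]
  exact decide_eq_true (by omega)

end Deterministic

end LongestChain

end

noncomputable section

namespace LongestChain

/-! ### Words of slot types

A word lists the types of the slots so far, the most recent one first: `none` for a slot without
leader, `some true` for a special slot, `some false` for any other slot. -/

/-- The number of slots since the last non-empty one. -/
def gap : List (Option Bool) → ℕ
  | [] => 0
  | none :: w => gap w + 1
  | some _ :: _ => 0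

/-- The largest amount by which an earlier value of the walk (`+1` for special slots, `-1` for
other non-empty slots) exceeds the present one. -/
def reach : List (Option Bool) → ℕ
  | [] => 0
  | none :: w => reach w
  | some true :: w => reach w - 1
  | some false :: w => reach w + 1

lemma gap_le_length (w : List (Option Bool)) : gap w ≤ w.length := by
  induction w with
  | nil => simp [gap]
  | cons l w ih => rcases l with _ | b <;> simp [gap, ih]

/-- The state of an automaton that reads the non-empty slots after slot `s`. -/
def runFrom {X : Type*} (up down : X → X) (s : ℕ) (init : List (Option Bool) → X) :
    List (Option Bool) → X
  | [] => init []
  | l :: w => if w.length < s then init (l :: w) else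
      match l with
      | none => runFrom up down s init w
      | some true => up (runFrom up down s init w)
      | some false => down (runFrom up down s init w)

section Run

variable {X : Type*} (up down : X → X) (s : ℕ) (init : List (Option Bool) → X)

lemma runFrom_of_length_le {w : List (Option Bool)} (h : w.length ≤ s) :
    runFrom up down s init w = init w := by
  cases w with
  | nil => rfl
  | cons l w => rcases l with _ | _ | _ <;> rw [runFrom, if_pos (by simpa using h)]

lemma runFrom_none {w : List (Option Bool)} (h : s ≤ w.length) :
    runFrom up down s init (none :: w) = runFrom up down s init w := by
  rw [runFrom, if_neg (by omega)]

lemma runFrom_true {w : List (Option Bool)} (h : s ≤ w.length) :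
    runFrom up down s init (some true :: w) = up (runFrom up down s init w) := by
  rw [runFrom, if_neg (by omega)]

lemma runFrom_false {w : List (Option Bool)} (h : s ≤ w.length) :
    runFrom up down s init (some false :: w) = down (runFrom up down s init w) := by
  rw [runFrom, if_neg (by omega)]

end Run

/-- The parameters of a word: `f` is the probability that a slot is non-empty, `α` that of a
unique honest leader given that the slot is non-empty, and `F g = ℙ(Δ < g)`. -/
structure Rates where
  /-- probability of a non-empty slot -/
  f : ℝ
  /-- probability of a unique honest leader in a non-empty slot -/
  α : ℝ
  /-- distribution function of the delay -/
  F : ℕ → ℝ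
  f_pos : 0 < f
  f_le : f ≤ 1
  α_nonneg : 0 ≤ α
  α_le : α ≤ 1
  F_mono : Monotone F
  F_nonneg : ∀ g, 0 ≤ F g
  F_le : ∀ g, F g ≤ 1

/-! ### Averages of the chance of hearing over geometric gaps -/

namespace Rates

variable (r : Rates)

/-- `ℙ(Δ < g + G)` for geometric `G`. -/
def φ (g : ℕ) : ℝ := ∑' m, r.f * (1 - r.f) ^ m * r.F (g + 1 + m)

/-- A lower bound for the probability that the next non-empty slot is special. -/
def p : ℝ := r.α * r.φ 0

lemma hasSum_weights : HasSum (fun m => r.f * (1 - r.f) ^ m) 1 := by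
  have h := (hasSum_geometric_of_lt_one (r := 1 - r.f) (by linarith [r.f_le])
    (by linarith [r.f_pos])).mul_left r.f
  have h2 : r.f * (1 - (1 - r.f))⁻¹ = 1 := by
    rw [sub_sub_cancel, mul_inv_cancel₀ r.f_pos.ne']
  rwa [h2] at h

lemma weight_nonneg (m : ℕ) : 0 ≤ r.f * (1 - r.f) ^ m :=
  mul_nonneg r.f_pos.le (pow_nonneg (by linarith [r.f_le]) m)

lemma summable_φ (g : ℕ) : Summable fun m => r.f * (1 - r.f) ^ m * r.F (g + 1 + m) :=
  Summable.of_nonneg_of_le (fun m => mul_nonneg (r.weight_nonneg m) (r.F_nonneg _))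
    (fun m => mul_le_of_le_one_right (r.weight_nonneg m) (r.F_le _)) r.hasSum_weights.summable

lemma φ_nonneg (g : ℕ) : 0 ≤ r.φ g :=
  tsum_nonneg fun m => mul_nonneg (r.weight_nonneg m) (r.F_nonneg _)

lemma φ_le_one (g : ℕ) : r.φ g ≤ 1 := by
  rw [← r.hasSum_weights.tsum_eq]
  exact (r.summable_φ g).tsum_le_tsum
    (fun m => mul_le_of_le_one_right (r.weight_nonneg m) (r.F_le _)) r.hasSum_weights.summable

lemma φ_mono : Monotone r.φ := fun g g' h =>
  (r.summable_φ g).tsum_le_tsum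
    (fun m => mul_le_mul_of_nonneg_left (r.F_mono (by omega)) (r.weight_nonneg m)) (r.summable_φ g')

/-- Condition on whether the coming slot is non-empty: either the waiting ends at `g + 1`, or the
gap grows by one and the geometric waiting time starts afresh. -/
lemma φ_succ (g : ℕ) : r.φ g = r.f * r.F (g + 1) + (1 - r.f) * r.φ (g + 1) := by
  rw [φ, (r.summable_φ g).tsum_eq_zero_add, φ, ← tsum_mul_left]
  simp only [pow_zero, mul_one, add_zero]
  congr 1
  refine tsum_congr fun m => ?_
  rw [show g + 1 + (m + 1) = g + 1 + 1 + m by ring, pow_succ]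
  ring

lemma p_nonneg : 0 ≤ r.p := mul_nonneg r.α_nonneg (r.φ_nonneg 0)

lemma p_le_one : r.p ≤ 1 := mul_le_one₀ r.α_le (r.φ_nonneg 0) (r.φ_le_one 0)

lemma αφ_le_one (g : ℕ) : r.α * r.φ g ≤ 1 := mul_le_one₀ r.α_le (r.φ_nonneg g) (r.φ_le_one g)

lemma αφ_nonneg (g : ℕ) : 0 ≤ r.α * r.φ g := mul_nonneg r.α_nonneg (r.φ_nonneg g)

lemma p_le_αφ (g : ℕ) : r.p ≤ r.α * r.φ g :=
  mul_le_mul_of_nonneg_left (r.φ_mono (Nat.zero_le g)) r.α_nonneg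

/-- The lower bound for the probability that a non-empty slot after the word `w` is special. -/
def a (w : List (Option Bool)) : ℝ :=
  if gap w = w.length then r.α else r.α * r.F (gap w + 1)

lemma a_nonneg (w : List (Option Bool)) : 0 ≤ r.a w := by
  rw [a]; split_ifs
  · exact r.α_nonneg
  · exact mul_nonneg r.α_nonneg (r.F_nonneg _)

lemma a_le_one (w : List (Option Bool)) : r.a w ≤ 1 := by
  rw [a]; split_ifs
  · exact r.α_le
  · exact mul_le_one₀ r.α_le (r.F_nonneg _) (r.F_le _)

lemma αF_le_a (w : List (Option Bool)) : r.α * r.F (gap w + 1) ≤ r.a w := by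
  rw [a]; split_ifs
  · exact mul_le_of_le_one_right r.α_nonneg (r.F_le _)
  · exact le_rfl

/-- The probability that a word of length `t` has gap `γ`. -/
def gapWeight (t γ : ℕ) : ℝ := if γ < t then r.f * (1 - r.f) ^ γ else (1 - r.f) ^ t

lemma gapWeight_nonneg (t γ : ℕ) : 0 ≤ r.gapWeight t γ := by
  rw [gapWeight]; split_ifs
  · exact r.weight_nonneg γ
  · exact pow_nonneg (by linarith [r.f_le]) t

lemma sum_gapWeight (t : ℕ) : ∑ γ ∈ Finset.range (t + 1), r.gapWeight t γ = 1 := by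
  have h : ∀ t, ∑ γ ∈ Finset.range t, r.f * (1 - r.f) ^ γ = 1 - (1 - r.f) ^ t := by
    intro t
    induction t with
    | zero => simp
    | succ t ih => rw [Finset.sum_range_succ, ih, pow_succ]; ring
  have h2 : ∀ γ ∈ Finset.range t, r.gapWeight t γ = r.f * (1 - r.f) ^ γ := fun γ hγ => by
    rw [gapWeight, if_pos (Finset.mem_range.mp hγ)]
  rw [Finset.sum_range_succ, Finset.sum_congr rfl h2, h, gapWeight, if_neg (lt_irrefl t)]
  ring

/-- Unrolling `φ_succ` from `φ 0` produces the same terms up to a remainder `(1 - r.f) ^ t * r.φ t`.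
That remainder is at most the weight of the words without any leader, and after such a word the
chance of a special slot is the full `α`, as nothing needs to be heard. -/
lemma p_le_sum_gapWeight (t : ℕ) :
    r.p ≤ ∑ γ ∈ Finset.range (t + 1),
      r.gapWeight t γ * (if γ = t then r.α else r.α * r.F (γ + 1)) := by
  have h : ∀ t, r.φ 0 = ∑ γ ∈ Finset.range t, r.f * (1 - r.f) ^ γ * r.F (γ + 1) +
      (1 - r.f) ^ t * r.φ t := by
    intro t
    induction t with
    | zero => simp
    | succ t ih => rw [ih, r.φ_succ t, Finset.sum_range_succ, pow_succ]; ring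
  have h2 : ∀ γ ∈ Finset.range t,
      r.gapWeight t γ * (if γ = t then r.α else r.α * r.F (γ + 1)) =
        r.α * (r.f * (1 - r.f) ^ γ * r.F (γ + 1)) := fun γ hγ => by
    rw [Finset.mem_range] at hγ
    rw [gapWeight, if_pos hγ, if_neg hγ.ne]; ring
  rw [Finset.sum_range_succ, Finset.sum_congr rfl h2, ← Finset.mul_sum, gapWeight,
    if_neg (lt_irrefl t), if_pos rfl, p, h t, mul_add]
  have h1 : (1 - r.f) ^ t * r.φ t ≤ (1 - r.f) ^ t :=
    mul_le_of_le_one_right (pow_nonneg (by linarith [r.f_le]) t) (r.φ_le_one t)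
  have := mul_le_mul_of_nonneg_left h1 r.α_nonneg
  linarith

end Rates

variable {Ω : Type*} [MeasurableSpace Ω]

/-- The random word `W t` of slot types up to slot `t` has the rates `r`. -/
structure WordLaw (P : Measure Ω) (x : ℕ → Ω → Option Bool) (W : ℕ → Ω → List (Option Bool))
    (r : Rates) : Prop where
  zero : ∀ ω, W 0 ω = []
  succ : ∀ t ω, W (t + 1) ω = x t ω :: W t ω
  meas : ∀ t w, MeasurableSet {ω | W t ω = w}
  empty : ∀ t w, P {ω | W (t + 1) ω = none :: w} = ENNReal.ofReal (1 - r.f) * P {ω | W t ω = w}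
  special : ∀ t w, w.length = t → ENNReal.ofReal (r.f * r.a w) * P {ω | W t ω = w} ≤
    P {ω | W (t + 1) ω = some true :: w}

/-- Expectation of a function of a random variable with countably many values. -/
lemma lintegral_eq_tsum_fibers {ι : Type*} [Countable ι] (P : Measure Ω) (Z : Ω → ι)
    (hZ : ∀ i, MeasurableSet {ω | Z ω = i}) (g : ι → ℝ≥0∞) :
    ∫⁻ ω, g (Z ω) ∂P = ∑' i, g i * P {ω | Z ω = i} := by
  let _ : MeasurableSpace ι := ⊤
  have hm : Measurable Z := measurable_to_countable' fun i => hZ i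
  rw [← lintegral_map (f := g) (by fun_prop) hm, lintegral_countable']
  refine tsum_congr fun i => ?_
  rw [Measure.map_apply hm (measurableSet_singleton i)]
  rfl

/-- Shifting weight from the smaller to the larger value increases an average. This is how lower
bounds on the chance of an up-step enter all the comparisons. -/
lemma ENNReal_convex_le {a p : ℝ} (hp : 0 ≤ p) (hpa : p ≤ a) (ha : a ≤ 1) {x y : ℝ≥0∞}
    (hxy : x ≤ y) : ENNReal.ofReal a * x + ENNReal.ofReal (1 - a) * y ≤
      ENNReal.ofReal p * x + ENNReal.ofReal (1 - p) * y := by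
  have h1 : ENNReal.ofReal a = ENNReal.ofReal p + ENNReal.ofReal (a - p) := by
    rw [← ENNReal.ofReal_add hp (by linarith)]; congr 1; ring
  have h2 : ENNReal.ofReal (1 - p) = ENNReal.ofReal (a - p) + ENNReal.ofReal (1 - a) := by
    rw [← ENNReal.ofReal_add (by linarith) (by linarith)]; congr 1; ring
  rw [h1, h2, add_mul, add_mul, add_assoc]
  gcongr

/-! ### One-step comparison with a walk of prescribed up-probabilities -/

namespace WordLaw

variable {P : Measure Ω} {x : ℕ → Ω → Option Bool}
  {W : ℕ → Ω → List (Option Bool)} {r : Rates}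

lemma length (hW : WordLaw P x W r) (t : ℕ) (ω : Ω) : (W t ω).length = t := by
  induction t with
  | zero => simp [hW.zero]
  | succ t ih => simp [hW.succ, ih]

lemma measure_split (hW : WordLaw P x W r) (t : ℕ) (w : List (Option Bool)) :
    P {ω | W (t + 1) ω = none :: w} + P {ω | W (t + 1) ω = some true :: w} +
      P {ω | W (t + 1) ω = some false :: w} = P {ω | W t ω = w} := by
  rw [← measure_union _ (hW.meas _ _), ← measure_union _ (hW.meas _ _)]
  · congr 1
    ext ω
    simp only [Set.mem_union, Set.mem_ofPred_eq, hW.succ, List.cons.injEq]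
    rcases x t ω with _ | _ | _ <;> simp
  · rw [Set.disjoint_left]
    rintro ω (h | h) h' <;> simp only [Set.mem_ofPred_eq] at h h' <;> rw [h] at h' <;> simp at h'
  · rw [Set.disjoint_left]
    rintro ω h h'; simp only [Set.mem_ofPred_eq] at h h'; rw [h] at h'; simp at h'

lemma lintegral_eq (hW : WordLaw P x W r) (t : ℕ) (g : List (Option Bool) → ℝ≥0∞) :
    ∫⁻ ω, g (W t ω) ∂P = ∑' w, g w * P {ω | W t ω = w} :=
  lintegral_eq_tsum_fibers P (W t) (hW.meas t) g

/-- One step of a decreasing functional of the word. -/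
lemma lintegral_succ_le [IsProbabilityMeasure P] (hW : WordLaw P x W r) (t : ℕ)
    (Ψ' Ψ : List (Option Bool) → ℝ≥0∞)
    (hmono : ∀ w, w.length = t → Ψ' (some true :: w) ≤ Ψ' (some false :: w))
    (hstep : ∀ w, w.length = t → ENNReal.ofReal (1 - r.f) * Ψ' (none :: w) +
      ENNReal.ofReal r.f * (ENNReal.ofReal (r.a w) * Ψ' (some true :: w) +
        ENNReal.ofReal (1 - r.a w) * Ψ' (some false :: w)) ≤ Ψ w) :
    ∫⁻ ω, Ψ' (W (t + 1) ω) ∂P ≤ ∫⁻ ω, Ψ (W t ω) ∂P := by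
  have hset : ∀ (l : Option Bool) w, {ω | (W t ω, x t ω) = (w, l)} =
      {ω | W (t + 1) ω = l :: w} := by
    intro l w; ext ω; simp [hW.succ, and_comm]
  have h1 : ∫⁻ ω, Ψ' (W (t + 1) ω) ∂P =
      ∑' i : List (Option Bool) × Option Bool, Ψ' (i.2 :: i.1) *
        P {ω | W (t + 1) ω = i.2 :: i.1} := by
    rw [← tsum_congr fun i : List (Option Bool) × Option Bool => by rw [← hset i.2 i.1],
      ← lintegral_eq_tsum_fibers P (fun ω => (W t ω, x t ω)) (fun i => by
        rw [hset]; exact hW.meas _ _) (fun i => Ψ' (i.2 :: i.1))]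
    simp only [hW.succ]
  rw [h1, ENNReal.tsum_prod', hW.lintegral_eq]
  refine ENNReal.tsum_le_tsum fun w => ?_
  rw [tsum_fintype]
  by_cases hlen : w.length = t
  swap
  · have hz : ∀ l, P {ω | W (t + 1) ω = l :: w} = 0 := by
      intro l
      convert measure_empty (μ := P)
      rw [Set.eq_empty_iff_forall_notMem]
      rintro ω hω
      apply hlen
      have := hW.length (t + 1) ω
      simp only [Set.mem_ofPred_eq] at hω
      rw [hω] at this
      simpa using this
    simp [hz]
  have hsum : ∑ l : Option Bool, Ψ' (l :: w) * P {ω | W (t + 1) ω = l :: w} =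
      Ψ' (none :: w) * P {ω | W (t + 1) ω = none :: w} +
      (Ψ' (some true :: w) * P {ω | W (t + 1) ω = some true :: w} +
      Ψ' (some false :: w) * P {ω | W (t + 1) ω = some false :: w}) := by
    rw [Fintype.sum_option, Fintype.sum_bool]
  rw [hsum]
  have hs := hW.measure_split t w
  have hE := hW.empty t w
  have hS := hW.special t w hlen
  set m := P {ω | W t ω = w}
  set m0 := P {ω | W (t + 1) ω = none :: w}
  set m1 := P {ω | W (t + 1) ω = some true :: w}
  set m2 := P {ω | W (t + 1) ω = some false :: w}
  have hmtop : m ≠ ⊤ := measure_ne_top P _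
  -- The excess `e` of the chance of a special slot over its lower bound is moved to the non-special
  -- outcome, where the functional is at least as large.
  obtain ⟨e, he⟩ := exists_add_of_le hS
  have ha0 := r.a_nonneg w
  have ha1 := r.a_le_one w
  have hf0 := r.f_pos.le
  have hf1 := r.f_le
  have hm2 : e + m2 = ENNReal.ofReal (r.f * (1 - r.a w)) * m := by
    have h1 : ENNReal.ofReal (1 - r.f) * m + ENNReal.ofReal (r.f * r.a w) * m + (e + m2) =
        ENNReal.ofReal (1 - r.f) * m + ENNReal.ofReal (r.f * r.a w) * m +
          ENNReal.ofReal (r.f * (1 - r.a w)) * m := by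
      rw [← add_mul, ← add_mul, ← ENNReal.ofReal_add (by linarith) (by positivity),
        ← ENNReal.ofReal_add (by nlinarith) (by nlinarith),
        show 1 - r.f + r.f * r.a w + r.f * (1 - r.a w) = 1 by ring, ENNReal.ofReal_one, one_mul,
        show 1 - r.f + r.f * r.a w = (1 - r.f) + (r.f * r.a w) by rfl,
        ENNReal.ofReal_add (by linarith) (by positivity), add_mul, ← hE]
      rw [he] at hs
      refine Eq.trans ?_ hs
      ring
    exact (ENNReal.add_right_inj (by finiteness)).mp h1
  calc Ψ' (none :: w) * m0 + (Ψ' (some true :: w) * m1 + Ψ' (some false :: w) * m2)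
      ≤ Ψ' (none :: w) * m0 + (Ψ' (some true :: w) * (ENNReal.ofReal (r.f * r.a w) * m) +
        Ψ' (some false :: w) * (e + m2)) := by
        rw [he, mul_add, mul_add, add_assoc]
        gcongr
        exact hmono w hlen
    _ = (ENNReal.ofReal (1 - r.f) * Ψ' (none :: w) +
      ENNReal.ofReal r.f * (ENNReal.ofReal (r.a w) * Ψ' (some true :: w) +
        ENNReal.ofReal (1 - r.a w) * Ψ' (some false :: w))) * m := by
        rw [hm2, hE, ENNReal.ofReal_mul hf0, ENNReal.ofReal_mul hf0]; ring
    _ ≤ Ψ w * m := by gcongr; exact hstep w hlen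

end WordLaw

end LongestChain

end

noncomputable section

namespace LongestChain

variable {Ω : Type*} [MeasurableSpace Ω]

lemma ENNReal_convex_comp {f a b : ℝ} (hf0 : 0 ≤ f) (hf1 : f ≤ 1) (ha0 : 0 ≤ a) (ha1 : a ≤ 1)
    (hb0 : 0 ≤ b) (hb1 : b ≤ 1) (x y : ℝ≥0∞) :
    ENNReal.ofReal (1 - f) * (ENNReal.ofReal a * x + ENNReal.ofReal (1 - a) * y) +
      ENNReal.ofReal f * (ENNReal.ofReal b * x + ENNReal.ofReal (1 - b) * y) =
    ENNReal.ofReal ((1 - f) * a + f * b) * x +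
      ENNReal.ofReal (1 - ((1 - f) * a + f * b)) * y := by
  have hf : 0 ≤ 1 - f := by linarith
  rw [show 1 - ((1 - f) * a + f * b) = (1 - f) * (1 - a) + f * (1 - b) by ring,
    ENNReal.ofReal_add (by positivity) (by positivity),
    ENNReal.ofReal_add (mul_nonneg hf (by linarith)) (mul_nonneg hf0 (by linarith)),
    ENNReal.ofReal_mul hf, ENNReal.ofReal_mul hf, ENNReal.ofReal_mul hf0, ENNReal.ofReal_mul hf0]
  ring

/-- The potential averaged over the type of the next non-empty slot. -/
def pending {X : Type*} (r : Rates) (up down : X → X) (Ψ : X → ℝ≥0∞) (g : ℕ) (y : X) : ℝ≥0∞ :=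
  ENNReal.ofReal (r.α * r.φ g) * Ψ (up y) + ENNReal.ofReal (1 - r.α * r.φ g) * Ψ (down y)

namespace WordLaw

variable {P : Measure Ω} {x : ℕ → Ω → Option Bool}
  {W : ℕ → Ω → List (Option Bool)} {r : Rates}

lemma measurable_comp (hW : WordLaw P x W r) {β : Type*} [MeasurableSpace β] (t : ℕ)
    (g : List (Option Bool) → β) : Measurable fun ω => g (W t ω) := by
  intro A _
  have : (fun ω => g (W t ω)) ⁻¹' A = ⋃ w ∈ g ⁻¹' A, {ω | W t ω = w} := by ext ω; simp
  rw [this]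
  exact MeasurableSet.biUnion (Set.to_countable _) fun w _ => hW.meas _ _

variable [IsProbabilityMeasure P]

/-! ### Potentials of automata driven by the non-empty slots -/

section Automata

variable {X : Type*} {up down : X → X} {s : ℕ} {init : List (Option Bool) → X} {Ψ : X → ℝ≥0∞}

/-- A potential that decreases on average along the non-empty slots, when each of them is special
with probability `p`, decreases on average along all slots, once the step to come is averaged
over the length of the present gap. -/
lemma lintegral_pending_le (hW : WordLaw P x W r) (hmono : ∀ y, Ψ (up y) ≤ Ψ (down y))
    (hstep : ∀ y, ENNReal.ofReal r.p * Ψ (up y) + ENNReal.ofReal (1 - r.p) * Ψ (down y) ≤ Ψ y)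
    (k : ℕ) :
    ∫⁻ ω, pending r up down Ψ (gap (W (s + k) ω)) (runFrom up down s init (W (s + k) ω)) ∂P ≤
      ∫⁻ ω, Ψ (init (W s ω)) ∂P := by
  -- Whatever the gap, the next step is special with averaged chance at least `p`, so averaging over
  -- it does not increase the potential.
  have hpend : ∀ g y, pending r up down Ψ g y ≤ Ψ y := fun g y =>
    (ENNReal_convex_le r.p_nonneg (r.p_le_αφ _) (r.αφ_le_one _) (hmono _)).trans (hstep _)
  induction k with
  | zero =>
    refine lintegral_mono fun ω => ?_
    rw [add_zero, runFrom_of_length_le _ _ _ _ (hW.length s ω).le]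
    exact hpend _ _
  | succ k ih =>
    -- After an empty slot the pending average is kept with a longer gap. After a non-empty slot the
    -- step has been taken and the plain potential is used, which dominates the pending average at
    -- gap `0`.
    refine le_trans (lintegral_mono fun ω => ?_) ((hW.lintegral_succ_le (s + k)
      (fun w => match w with
        | none :: w => pending r up down Ψ (gap w + 1) (runFrom up down s init w)
        | w => Ψ (runFrom up down s init w))
      (fun w => pending r up down Ψ (gap w) (runFrom up down s init w)) ?_ ?_).trans ih)
    · have hlen := hW.length (s + k) ω
      rw [← add_assoc, hW.succ]
      rcases hx : x (s + k) ω with _ | _ | _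
      · simp only [gap]
        rw [runFrom_none _ _ _ _ (by omega)]
      · exact hpend _ _
      · exact hpend _ _
    · intro w hw
      simp only
      rw [runFrom_true _ _ _ _ (by omega), runFrom_false _ _ _ _ (by omega)]
      exact hmono _
    · intro w hw
      simp only
      rw [runFrom_true _ _ _ _ (by omega), runFrom_false _ _ _ _ (by omega), pending,
        ENNReal_convex_comp r.f_pos.le r.f_le (r.αφ_nonneg _) (r.αφ_le_one _) (r.a_nonneg w)
          (r.a_le_one w)]
      refine ENNReal_convex_le (r.αφ_nonneg _) ?_ ?_ (hmono _)
      · rw [r.φ_succ]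
        have := mul_le_mul_of_nonneg_left (r.αF_le_a w) r.f_pos.le
        linarith
      · have h1 := mul_le_mul_of_nonneg_left (r.αφ_le_one (gap w + 1))
          (by linarith [r.f_le] : 0 ≤ 1 - r.f)
        have h2 := mul_le_mul_of_nonneg_left (r.a_le_one w) r.f_pos.le
        linarith

/-- The probability that the automaton is ever found in a set of states that it cannot leave. -/
lemma measure_exists_bad_le (hW : WordLaw P x W r) (hmono : ∀ y, Ψ (up y) ≤ Ψ (down y))
    (hstep : ∀ y, ENNReal.ofReal r.p * Ψ (up y) + ENNReal.ofReal (1 - r.p) * Ψ (down y) ≤ Ψ y)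
    (bad : Set X) (hup : ∀ y ∈ bad, up y ∈ bad) (hdown : ∀ y ∈ bad, down y ∈ bad)
    (hbad : ∀ y ∈ bad, 1 ≤ Ψ y) :
    P {ω | ∃ t, s ≤ t ∧ runFrom up down s init (W t ω) ∈ bad} ≤ ∫⁻ ω, Ψ (init (W s ω)) ∂P := by
  have hmonoset : Monotone fun k => {ω | runFrom up down s init (W (s + k) ω) ∈ bad} := by
    refine monotone_nat_of_le_succ fun k ω hω => ?_
    have hlen := hW.length (s + k) ω
    simp only [Set.mem_ofPred_eq] at hω ⊢
    rw [← add_assoc, hW.succ]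
    rcases hx : x (s + k) ω with _ | _ | _
    · rwa [runFrom_none _ _ _ _ (by omega)]
    · rw [runFrom_false _ _ _ _ (by omega)]; exact hdown _ hω
    · rw [runFrom_true _ _ _ _ (by omega)]; exact hup _ hω
  have hset : {ω | ∃ t, s ≤ t ∧ runFrom up down s init (W t ω) ∈ bad} =
      ⋃ k, {ω | runFrom up down s init (W (s + k) ω) ∈ bad} := by
    ext ω
    simp only [Set.mem_ofPred_eq, Set.mem_iUnion]
    constructor
    · rintro ⟨t, ht, h⟩
      exact ⟨t - s, by rwa [Nat.add_sub_cancel' ht]⟩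
    · rintro ⟨k, h⟩
      exact ⟨s + k, by omega, h⟩
  rw [hset, hmonoset.measure_iUnion]
  refine iSup_le fun k => le_trans ?_ (hW.lintegral_pending_le (init := init) hmono hstep k)
  have hm : MeasurableSet {ω | runFrom up down s init (W (s + k) ω) ∈ bad} := by
    let _ : MeasurableSpace X := ⊤
    exact hW.measurable_comp (s + k) (runFrom up down s init) trivial
  rw [← lintegral_indicator_one hm]
  refine lintegral_mono fun ω => ?_
  by_cases h : ω ∈ {ω | runFrom up down s init (W (s + k) ω) ∈ bad}
  · rw [Set.indicator_of_mem h, Pi.one_apply, pending]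
    simp only [Set.mem_ofPred_eq] at h
    -- Bad states stay bad after either step, so the average over the next step is still at least
    -- `1`.
    calc (1 : ℝ≥0∞) = ENNReal.ofReal (r.α * r.φ (gap (W (s + k) ω))) * 1 +
          ENNReal.ofReal (1 - r.α * r.φ (gap (W (s + k) ω))) * 1 := by
          rw [mul_one, mul_one, ← ENNReal.ofReal_add (r.αφ_nonneg _)
            (by linarith [r.αφ_le_one (gap (W (s + k) ω))])]
          simp
      _ ≤ _ := by
          gcongr
          · exact hbad _ (hup _ h)
          · exact hbad _ (hdown _ h)
  · rw [Set.indicator_of_notMem h]; exact zero_le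

end Automata

/-! ### The reach at a given slot -/

/-- The geometric law with ratio `β`, as an expectation operator. -/
def geomMean (β : ℝ) (g : ℕ → ℝ≥0∞) : ℝ≥0∞ := ∑' n, ENNReal.ofReal ((1 - β) * β ^ n) * g n

lemma geomMean_one {β : ℝ} (h0 : 0 ≤ β) (h1 : β < 1) (c : ℝ≥0∞) : geomMean β (fun _ => c) = c := by
  rw [geomMean, ENNReal.tsum_mul_right, ← ENNReal.ofReal_tsum_of_nonneg
    (fun n => mul_nonneg (by linarith) (pow_nonneg h0 n))
    ((summable_geometric_of_lt_one h0 h1).mul_left _), tsum_mul_left, tsum_geometric_of_lt_one h0 h1,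
    mul_inv_cancel₀ (by linarith), ENNReal.ofReal_one, one_mul]

lemma geomMean_mono {β : ℝ} {g g' : ℕ → ℝ≥0∞} (h : ∀ n, g n ≤ g' n) :
    geomMean β g ≤ geomMean β g' :=
  ENNReal.tsum_le_tsum fun n => by gcongr; exact h n

lemma geomMean_add {β : ℝ} (c d : ℝ≥0∞) (g g' : ℕ → ℝ≥0∞) :
    geomMean β (fun n => c * g n + d * g' n) = c * geomMean β g + d * geomMean β g' := by
  rw [geomMean, geomMean, geomMean, ← ENNReal.tsum_mul_left, ← ENNReal.tsum_mul_left,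
    ← ENNReal.tsum_add]
  refine tsum_congr fun n => ?_
  ring

/-- The geometric law is stationary for the reflected walk. -/
lemma geomMean_step {β p : ℝ} (h0 : 0 ≤ β) (h1 : β < 1) (hp : 0 ≤ p) (hp1 : p ≤ 1)
    (hβ : 1 - p = β * p) (g : ℕ → ℝ≥0∞) :
    geomMean β (fun n => ENNReal.ofReal p * g (n - 1) + ENNReal.ofReal (1 - p) * g (n + 1)) =
      geomMean β g := by
  rw [geomMean_add (g := fun n => g (n - 1)) (g' := fun n => g (n + 1))]
  have hb : (0 : ℝ) ≤ 1 - β := by linarith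
  -- Truncated subtraction sends both `0` and `1` to `0`, as the reflection requires. The term of
  -- index `0` is split off, and together with the down-steps it will complete a series over all
  -- indices.
  have e1 : ENNReal.ofReal p * geomMean β (fun n => g (n - 1)) =
      ENNReal.ofReal (p * (1 - β)) * g 0 +
        ∑' n, ENNReal.ofReal ((1 - p) * ((1 - β) * β ^ n)) * g n := by
    rw [geomMean, tsum_eq_zero_add' ENNReal.summable, mul_add, ← ENNReal.tsum_mul_left]
    congr 1
    · rw [pow_zero, mul_one, ENNReal.ofReal_mul hp, mul_assoc]
    · refine tsum_congr fun n => ?_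
      rw [← mul_assoc, ← ENNReal.ofReal_mul hp, Nat.add_sub_cancel, hβ]
      congr 2
      ring
  have e2 : ENNReal.ofReal (1 - p) * geomMean β (fun n => g (n + 1)) =
      ∑' n, ENNReal.ofReal (p * ((1 - β) * β ^ (n + 1))) * g (n + 1) := by
    rw [geomMean, ← ENNReal.tsum_mul_left]
    refine tsum_congr fun n => ?_
    rw [← mul_assoc, ← ENNReal.ofReal_mul (by linarith), hβ]
    congr 2
    ring
  rw [e1, e2, add_right_comm]
  have e3 : ENNReal.ofReal (p * (1 - β)) * g 0 +
      ∑' n, ENNReal.ofReal (p * ((1 - β) * β ^ (n + 1))) * g (n + 1) =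
      ∑' n, ENNReal.ofReal (p * ((1 - β) * β ^ n)) * g n := by
    rw [eq_comm, tsum_eq_zero_add' ENNReal.summable]
    simp
  rw [e3, ← ENNReal.tsum_add, geomMean]
  refine tsum_congr fun n => ?_
  rw [← add_mul, ← ENNReal.ofReal_add (by positivity)
    (mul_nonneg (by linarith) (by positivity))]
  congr 2
  ring

/-- The gap is carried along because the chance of a special slot depends on it. An empty slot
lengthens the gap and leaves the reach alone. A non-empty slot collects all previous gaps, over
which the chance of an up-step averages to at least `p`, and for `p` the geometric law is
stationary. So the bound keeps the product form of gap weight and geometric mean. -/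
lemma lintegral_reach_gap_le (hW : WordLaw P x W r) {β : ℝ} (h0 : 0 ≤ β) (h1 : β < 1)
    (hβ : 1 - r.p = β * r.p) (t : ℕ) : ∀ (g : ℕ → ℝ≥0∞), Monotone g → ∀ γ ≤ t,
    ∫⁻ ω, (if gap (W t ω) = γ then g (reach (W t ω)) else 0) ∂P ≤
      ENNReal.ofReal (r.gapWeight t γ) * geomMean β g := by
  have hg0 : ∀ g : ℕ → ℝ≥0∞, Monotone g → g 0 ≤ geomMean β g := fun g hg => by
    rw [← geomMean_one h0 h1 (g 0)]
    exact geomMean_mono fun n => hg (Nat.zero_le n)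
  have hf : 0 ≤ 1 - r.f := by linarith [r.f_le]
  induction t with
  | zero =>
    intro g hg γ hγ
    obtain rfl : γ = 0 := by omega
    simp [hW.zero, gap, reach, Rates.gapWeight, hg0 g hg]
  | succ t ih =>
    intro g hg γ hγ
    rcases γ with _ | γ
    · have hmono1 : Monotone fun n => g (n - 1) := fun a b h => hg (by omega)
      have hmono2 : Monotone fun n => g (n + 1) := fun a b h => hg (by omega)
      have hG : geomMean β (fun n => g (n - 1)) ≤ geomMean β (fun n => g (n + 1)) :=
        geomMean_mono fun n => hg (by omega)
      let a : ℕ → ℝ := fun γ => if γ = t then r.α else r.α * r.F (γ + 1)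
      have ha0 : ∀ γ, 0 ≤ a γ := fun γ => by
        simp only [a]; split_ifs
        · exact r.α_nonneg
        · exact mul_nonneg r.α_nonneg (r.F_nonneg _)
      have ha1 : ∀ γ, a γ ≤ 1 := fun γ => by
        simp only [a]; split_ifs
        · exact r.α_le
        · exact mul_le_one₀ r.α_le (r.F_nonneg _) (r.F_le _)
      -- Gap `0` means that the last slot was non-empty. The sum runs over the gap before it, each
      -- term to be bounded by the induction hypothesis for a shifted function of the reach.
      refine (hW.lintegral_succ_le t (fun w => if gap w = 0 then g (reach w) else 0)
        (fun w => ∑ γ ∈ Finset.range (t + 1), ENNReal.ofReal r.f *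
          (if gap w = γ then (ENNReal.ofReal (a γ) * g (reach w - 1) +
            ENNReal.ofReal (1 - a γ) * g (reach w + 1)) else 0)) ?_ ?_).trans ?_
      · intro w hw
        simp only [gap, reach, if_true]
        exact hg (by omega)
      · intro w hw
        have hle := gap_le_length w
        rw [Finset.sum_eq_single (gap w)]
        · simp only [gap, reach, if_true, Nat.add_eq_zero_iff, one_ne_zero, and_false, if_false,
            mul_zero, zero_add]
          have : r.a w = a (gap w) := by simp only [Rates.a, a, hw]
          rw [this]
        · intro b _ hb
          rw [if_neg (Ne.symm hb), mul_zero]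
        · intro h
          simp only [Finset.mem_range, not_lt] at h
          omega
      · rw [lintegral_finsetSum' _ fun γ _ => (hW.measurable_comp t fun w =>
          ENNReal.ofReal r.f * (if gap w = γ then (ENNReal.ofReal (a γ) * g (reach w - 1) +
            ENNReal.ofReal (1 - a γ) * g (reach w + 1)) else 0)).aemeasurable]
        have hterm : ∀ γ ∈ Finset.range (t + 1),
            ∫⁻ ω, ENNReal.ofReal r.f * (if gap (W t ω) = γ then
              (ENNReal.ofReal (a γ) * g (reach (W t ω) - 1) +
                ENNReal.ofReal (1 - a γ) * g (reach (W t ω) + 1)) else 0) ∂P ≤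
            ENNReal.ofReal r.f * (ENNReal.ofReal (r.gapWeight t γ * a γ) *
                geomMean β (fun n => g (n - 1)) +
              ENNReal.ofReal (r.gapWeight t γ * (1 - a γ)) * geomMean β (fun n => g (n + 1))) := by
          intro γ hγ
          rw [lintegral_const_mul' _ _ ENNReal.ofReal_ne_top]
          gcongr
          rw [ENNReal.ofReal_mul (r.gapWeight_nonneg t γ), ENNReal.ofReal_mul (r.gapWeight_nonneg t γ),
            mul_assoc, mul_assoc, ← mul_add, ← geomMean_add]
          exact ih _ (fun b c h => by
            gcongr
            · exact hg (by omega)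
            · exact hg (by omega)) γ (by simpa [Nat.lt_succ_iff] using hγ)
        refine (Finset.sum_le_sum hterm).trans ?_
        rw [← Finset.mul_sum, Finset.sum_add_distrib, ← Finset.sum_mul, ← Finset.sum_mul,
          ← ENNReal.ofReal_sum_of_nonneg fun γ _ => mul_nonneg (r.gapWeight_nonneg t γ) (ha0 γ),
          ← ENNReal.ofReal_sum_of_nonneg fun γ _ => mul_nonneg (r.gapWeight_nonneg t γ)
            (by linarith [ha1 γ])]
        have hsum : ∑ γ ∈ Finset.range (t + 1), r.gapWeight t γ * (1 - a γ) =
            1 - ∑ γ ∈ Finset.range (t + 1), r.gapWeight t γ * a γ := by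
          simp only [mul_sub, mul_one, Finset.sum_sub_distrib, r.sum_gapWeight t]
        have hle1 : ∑ γ ∈ Finset.range (t + 1), r.gapWeight t γ * a γ ≤ 1 := by
          rw [← r.sum_gapWeight t]
          exact Finset.sum_le_sum fun γ _ =>
            mul_le_of_le_one_right (r.gapWeight_nonneg t γ) (ha1 γ)
        rw [hsum, show r.gapWeight (t + 1) 0 = r.f by simp [Rates.gapWeight]]
        gcongr
        -- Lowering the averaged up-probability to exactly `p` increases the bound, and then
        -- stationarity applies.
        refine (ENNReal_convex_le r.p_nonneg (r.p_le_sum_gapWeight t) hle1 hG).trans ?_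
        rw [← geomMean_add, geomMean_step h0 h1 r.p_nonneg r.p_le_one hβ]
    · refine (hW.lintegral_succ_le t (fun w => if gap w = γ + 1 then g (reach w) else 0)
        (fun w => ENNReal.ofReal (1 - r.f) * if gap w = γ then g (reach w) else 0) ?_ ?_).trans ?_
      · intro w _
        simp [gap]
      · intro w _
        simp [gap, reach]
      · rw [lintegral_const_mul' _ _ ENNReal.ofReal_ne_top]
        have : r.gapWeight (t + 1) (γ + 1) = (1 - r.f) * r.gapWeight t γ := by
          simp only [Rates.gapWeight, Nat.add_lt_add_iff_right]
          split_ifs <;> ring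
        rw [this, ENNReal.ofReal_mul hf, mul_assoc]
        gcongr
        exact ih g hg γ (by omega)

/-- The reach at a given slot is stochastically dominated by a geometric law. -/
lemma lintegral_reach_le (hW : WordLaw P x W r) {β : ℝ} (h0 : 0 ≤ β) (h1 : β < 1)
    (hβ : 1 - r.p = β * r.p) (t : ℕ) (g : ℕ → ℝ≥0∞) (hg : Monotone g) :
    ∫⁻ ω, g (reach (W t ω)) ∂P ≤ geomMean β g := by
  have h : ∀ ω, g (reach (W t ω)) =
      ∑ γ ∈ Finset.range (t + 1), if gap (W t ω) = γ then g (reach (W t ω)) else 0 := by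
    intro ω
    have := gap_le_length (W t ω)
    rw [hW.length] at this
    rw [Finset.sum_ite_eq, if_pos (Finset.mem_range.mpr (by omega))]
  rw [lintegral_congr h, lintegral_finsetSum' _ fun γ _ => (hW.measurable_comp t fun w =>
      if gap w = γ then g (reach w) else 0).aemeasurable]
  refine (Finset.sum_le_sum fun γ hγ => hW.lintegral_reach_gap_le h0 h1 hβ t g hg γ
    (by simpa [Nat.lt_succ_iff] using hγ)).trans ?_
  rw [← Finset.sum_mul, ← ENNReal.ofReal_sum_of_nonneg fun γ _ => r.gapWeight_nonneg t γ,
    r.sum_gapWeight, ENNReal.ofReal_one, one_mul]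

/-! ### The number of non-empty slots -/

/-- The number of non-empty slots after slot `s`. -/
def numAfter (s : ℕ) : List (Option Bool) → ℕ := runFrom Nat.succ Nat.succ s fun _ => 0

lemma lintegral_numAfter_le (hW : WordLaw P x W r) (s k : ℕ) {ρ : ℝ} (hρ : 0 ≤ ρ) :
    ∫⁻ ω, ENNReal.ofReal (ρ ^ numAfter s (W (s + k) ω)) ∂P ≤
      ENNReal.ofReal ((1 - r.f + r.f * ρ) ^ k) := by
  have hf : 0 ≤ 1 - r.f := by linarith [r.f_le]
  have hf0 := r.f_pos.le
  induction k with
  | zero =>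
    rw [add_zero, pow_zero]
    refine (lintegral_mono (g := fun _ => ENNReal.ofReal 1) fun ω => ?_).trans (by simp)
    rw [numAfter, runFrom_of_length_le _ _ _ _ (hW.length s ω).le, pow_zero]
  | succ k ih =>
    refine (hW.lintegral_succ_le (s + k) (fun w => ENNReal.ofReal (ρ ^ numAfter s w))
      (fun w => ENNReal.ofReal (1 - r.f + r.f * ρ) * ENNReal.ofReal (ρ ^ numAfter s w)) ?_ ?_).trans ?_
    · intro w hw
      simp only [numAfter]
      rw [runFrom_true _ _ _ _ (by omega), runFrom_false _ _ _ _ (by omega)]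
    · intro w hw
      simp only [numAfter]
      rw [runFrom_true _ _ _ _ (by omega), runFrom_false _ _ _ _ (by omega),
        runFrom_none _ _ _ _ (by omega), ← add_mul, ← ENNReal.ofReal_add (r.a_nonneg w)
          (by linarith [r.a_le_one w]), add_sub_cancel, ENNReal.ofReal_one, one_mul,
        ENNReal.ofReal_add hf (by positivity), ENNReal.ofReal_mul hf0, Nat.succ_eq_add_one, pow_succ,
        ENNReal.ofReal_mul (by positivity), add_mul]
      apply le_of_eq
      ring
    · rw [lintegral_const_mul' _ _ ENNReal.ofReal_ne_top, pow_succ, mul_comm,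
        ENNReal.ofReal_mul (by positivity)]
      gcongr

/-- Chernoff bound for the number of non-empty slots in a window. -/
lemma measure_numAfter_lt_le (hW : WordLaw P x W r) (s k : ℕ) {δ : ℝ} (hδ : 0 ≤ δ) :
    P {ω | (numAfter s (W (s + k) ω) : ℝ) < (1 - δ) * (k * r.f)} ≤
      ENNReal.ofReal (Real.exp (-(k * r.f * δ ^ 2 / 2))) := by
  have hf0 := r.f_pos.le
  -- From `exp δ ≥ 1 + δ + δ ^ 2 / 2` and `(1 + δ ^ 2 / 2) ^ 2 - δ ^ 2 = 1 + δ ^ 4 / 4 ≥ 1`.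
  have hexp : Real.exp (-δ) ≤ 1 - δ + δ ^ 2 / 2 := by
    have := Real.quadratic_le_exp_of_nonneg hδ
    have h3 : 0 < 1 + δ + δ ^ 2 / 2 := by positivity
    rw [Real.exp_neg]
    refine (inv_anti₀ h3 this).trans ?_
    rw [inv_le_iff_one_le_mul₀ h3]
    nlinarith [sq_nonneg (δ ^ 2)]
  have h := mul_meas_ge_le_lintegral₀ (μ := P)
    (hW.measurable_comp (s + k) fun w =>
      ENNReal.ofReal (Real.exp (-δ) ^ numAfter s w)).aemeasurable
    (ENNReal.ofReal (Real.exp (-(δ * ((1 - δ) * (k * r.f))))))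
  have h2 := h.trans (hW.lintegral_numAfter_le s k (Real.exp_pos (-δ)).le)
  have hpos : 0 < Real.exp (-(δ * ((1 - δ) * (k * r.f)))) := Real.exp_pos _
  rw [mul_comm, ← ENNReal.le_div_iff_mul_le (Or.inl (by simpa using hpos))
    (Or.inl ENNReal.ofReal_ne_top), ← ENNReal.ofReal_div_of_pos hpos] at h2
  refine (measure_mono fun ω hω => ?_).trans (h2.trans (ENNReal.ofReal_le_ofReal ?_))
  · simp only [Set.mem_ofPred_eq] at hω ⊢
    refine ENNReal.ofReal_le_ofReal ?_
    rw [← Real.exp_nat_mul, Real.exp_le_exp]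
    nlinarith
  · rw [div_le_iff₀ hpos, ← Real.exp_add]
    have h4 : 1 - r.f + r.f * Real.exp (-δ) ≤ Real.exp (r.f * (-δ + δ ^ 2 / 2)) := by
      have := Real.add_one_le_exp (r.f * (-δ + δ ^ 2 / 2))
      nlinarith
    refine (pow_le_pow_left₀ (by have := r.f_le; have := Real.exp_pos (-δ); nlinarith) h4 k).trans ?_
    rw [← Real.exp_nat_mul, Real.exp_le_exp]
    apply le_of_eq
    ring

end WordLaw

end LongestChain

end

noncomputable section

namespace LongestChain

variable {Ω : Type*} [MeasurableSpace Ω]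

/-! ### Elementary inequalities for the biased walk -/

/-- Hoeffding's lemma for a biased sign. -/
lemma biased_exp_le {ε : ℝ} (h0 : 0 ≤ ε) (h1 : ε ≤ 1) (θ : ℝ) :
    (1 + ε) / 2 * Real.exp (-θ) + (1 - (1 + ε) / 2) * Real.exp θ ≤
      Real.exp (θ ^ 2 / 2 - ε * θ) := by
  have hp : 0 ≤ (1 + ε) / 2 := by linarith
  have hq : 0 ≤ (1 - ε) / 2 := by linarith
  -- The law of the negated step, supported on an interval of length `2`; Hoeffding's lemma then
  -- gives variance proxy `1`.
  let μ : Measure ℝ := ENNReal.ofReal ((1 + ε) / 2) • Measure.dirac (-1) +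
    ENNReal.ofReal ((1 - ε) / 2) • Measure.dirac 1
  have hμ : IsProbabilityMeasure μ := ⟨by
    simp only [μ, Measure.coe_add, Measure.coe_smul, Pi.add_apply, Pi.smul_apply, smul_eq_mul,
      measure_univ, mul_one]
    rw [← ENNReal.ofReal_add hp hq, show (1 + ε) / 2 + (1 - ε) / 2 = 1 by ring, ENNReal.ofReal_one]⟩
  have hexpect : ∀ g : ℝ → ℝ, ∫ x, g x ∂μ = (1 + ε) / 2 * g (-1) + (1 - ε) / 2 * g 1 := by
    intro g
    rw [integral_add_measure ((integrable_dirac (by simp)).smul_measure ENNReal.ofReal_ne_top)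
      ((integrable_dirac (by simp)).smul_measure ENNReal.ofReal_ne_top),
      integral_smul_measure, integral_smul_measure, integral_dirac, integral_dirac,
      ENNReal.toReal_ofReal hp, ENNReal.toReal_ofReal hq, smul_eq_mul, smul_eq_mul]
  have hb : ∀ᵐ x ∂μ, x ∈ Set.Icc (-1 : ℝ) 1 := by
    rw [ae_iff]
    simp only [μ, Measure.coe_add, Measure.coe_smul, Pi.add_apply, Pi.smul_apply]
    rw [Measure.dirac_apply, Measure.dirac_apply]
    norm_num
  have h := (hasSubgaussianMGF_of_mem_Icc (X := fun x : ℝ => x) aemeasurable_id hb).mgf_le θ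
  rw [mgf, hexpect, hexpect] at h
  have e1 : Real.exp (θ * (-1 - ((1 + ε) / 2 * -1 + (1 - ε) / 2 * 1))) =
      Real.exp (-θ) * Real.exp (ε * θ) := by rw [← Real.exp_add]; congr 1; ring
  have e2 : Real.exp (θ * (1 - ((1 + ε) / 2 * -1 + (1 - ε) / 2 * 1))) =
      Real.exp θ * Real.exp (ε * θ) := by rw [← Real.exp_add]; congr 1; ring
  have e3 : (((‖(1 : ℝ) - -1‖₊ / 2) ^ 2 : NNReal) : ℝ) * θ ^ 2 / 2 = θ ^ 2 / 2 := by
    have : ((‖(1 : ℝ) - -1‖₊ : NNReal) : ℝ) = 2 := by norm_num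
    push_cast
    rw [show ‖(1 : ℝ) - -1‖ = 2 by norm_num]
    ring
  rw [e1, e2, e3] at h
  rw [Real.exp_sub, le_div_iff₀ (Real.exp_pos _)]
  calc _ = _ := by ring
    _ ≤ _ := h

/-- The parameter of the geometric law of the reach. -/
def reachRatio (ε : ℝ) : ℝ := (1 - ε) / (1 + ε)

lemma reachRatio_nonneg {ε : ℝ} (h0 : 0 < ε) (h1 : ε ≤ 1) : 0 ≤ reachRatio ε :=
  div_nonneg (by linarith) (by linarith)

lemma reachRatio_lt_one {ε : ℝ} (h0 : 0 < ε) : reachRatio ε < 1 := by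
  rw [reachRatio, div_lt_one (by linarith)]; linarith

lemma reachRatio_mul {ε : ℝ} (h0 : 0 < ε) : 1 - (1 + ε) / 2 = reachRatio ε * ((1 + ε) / 2) := by
  rw [reachRatio]
  have : 1 + ε ≠ 0 := by linarith
  field_simp
  ring

lemma reachRatio_le_exp {ε : ℝ} (h0 : 0 < ε) (h1 : ε ≤ 1) : reachRatio ε ≤ Real.exp (-(2 * ε)) := by
  rcases h1.eq_or_lt with rfl | h1
  · simp [reachRatio, Real.exp_nonneg]
  -- The first term of the odd power series of `log ((1 + ε) / (1 - ε)) / 2` gives the bound `2 * ε`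
  -- on the logarithm.
  · have h := Real.sum_range_le_log_div h0.le h1 1
    simp only [Finset.range_one, Finset.sum_singleton, mul_zero, zero_add, pow_one, Nat.cast_zero,
      div_one] at h
    have hpos : 0 < (1 + ε) / (1 - ε) := div_pos (by linarith) (by linarith)
    have h2 : Real.exp (2 * ε) ≤ (1 + ε) / (1 - ε) := by
      rw [← Real.le_log_iff_exp_le hpos]; linarith
    rw [Real.exp_neg, reachRatio, ← inv_div]
    exact inv_anti₀ (Real.exp_pos _) h2

lemma reachRatio_mul_exp_lt_one {ε θ : ℝ} (h0 : 0 < ε) (h1 : ε ≤ 1) (hθ : θ < 2 * ε) :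
    reachRatio ε * Real.exp θ < 1 := by
  calc _ ≤ Real.exp (-(2 * ε)) * Real.exp θ := by gcongr; exact reachRatio_le_exp h0 h1
    _ = Real.exp (θ - 2 * ε) := by rw [← Real.exp_add]; congr 1; ring
    _ < 1 := by rw [Real.exp_lt_one_iff]; linarith

/-- The exponential moment of the reach. -/
lemma geomMean_exp_le {ε θ : ℝ} (h0 : 0 < ε) (h1 : ε ≤ 1) (hθ : θ ≤ ε / 2) :
    WordLaw.geomMean (reachRatio ε) (fun n => ENNReal.ofReal (Real.exp (θ * n))) ≤
      ENNReal.ofReal (4 / 3) := by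
  have hb0 := reachRatio_nonneg h0 h1
  have hb1 := reachRatio_lt_one h0
  set β := reachRatio ε
  have hx : β * Real.exp θ < 1 := reachRatio_mul_exp_lt_one h0 h1 (by linarith)
  have hx0 : 0 ≤ β * Real.exp θ := by positivity
  have e : ∀ n : ℕ, ENNReal.ofReal ((1 - β) * β ^ n) * ENNReal.ofReal (Real.exp (θ * n)) =
      ENNReal.ofReal ((1 - β) * (β * Real.exp θ) ^ n) := by
    intro n
    rw [← ENNReal.ofReal_mul (mul_nonneg (by linarith) (by positivity)), mul_pow, mul_comm θ,
      Real.exp_nat_mul]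
    congr 1; ring
  rw [WordLaw.geomMean, tsum_congr e, ← ENNReal.ofReal_tsum_of_nonneg
    (fun n => mul_nonneg (by linarith) (by positivity))
    ((summable_geometric_of_lt_one hx0 hx).mul_left _), tsum_mul_left, tsum_geometric_of_lt_one hx0 hx]
  apply ENNReal.ofReal_le_ofReal
  rw [← div_eq_mul_inv, div_le_div_iff₀ (by linarith) (by norm_num)]
  have hy0 := Real.exp_pos (-(ε / 2))
  have hle : Real.exp θ ≤ Real.exp (ε / 2) := Real.exp_le_exp.mpr hθ
  -- With `y = exp (-(ε / 2))`, the claim `β * (4 * exp θ - 3) ≤ 1` reduces to `4 * y ^ 3 - 3 * y ^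
  -- 4 ≤ 1`, and `y = 1` is a double root of the difference.
  have hβ4 : β ≤ Real.exp (-(ε / 2)) ^ 4 := by
    rw [← Real.exp_nat_mul]; convert reachRatio_le_exp h0 h1 using 2; push_cast; ring
  have hxy : Real.exp (ε / 2) * Real.exp (-(ε / 2)) = 1 := by rw [← Real.exp_add]; simp
  have hx1 : 1 ≤ Real.exp (ε / 2) := Real.one_le_exp (by linarith)
  set y := Real.exp (-(ε / 2))
  set X := Real.exp (ε / 2)
  have h3 : β * (4 * Real.exp θ - 3) ≤ 1 := by
    calc β * (4 * Real.exp θ - 3) ≤ β * (4 * X - 3) := by gcongr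
      _ ≤ y ^ 4 * (4 * X - 3) := by gcongr; linarith
      _ = 4 * y ^ 3 * (X * y) - 3 * y ^ 4 := by ring
      _ = 1 - (1 - y) ^ 2 * (1 + 2 * y + 3 * y ^ 2) := by rw [hxy]; ring
      _ ≤ 1 := by
        have : 0 ≤ (1 - y) ^ 2 * (1 + 2 * y + 3 * y ^ 2) := by positivity
        linarith
  linarith

namespace WordLaw

variable {P : Measure Ω} [IsProbabilityMeasure P] {x : ℕ → Ω → Option Bool}
  {W : ℕ → Ω → List (Option Bool)} {r : Rates}

open Classical in
/-- Ville's inequality for potentials of automata. -/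
lemma measure_exists_one_le {X : Type*} {up down : X → X} {s : ℕ} {init : List (Option Bool) → X}
    {Ψ : X → ℝ≥0∞} (hW : WordLaw P x W r) (hmono : ∀ y, Ψ (up y) ≤ Ψ (down y))
    (hstep : ∀ y, ENNReal.ofReal r.p * Ψ (up y) + ENNReal.ofReal (1 - r.p) * Ψ (down y) ≤ Ψ y) :
    P {ω | ∃ t, s ≤ t ∧ 1 ≤ Ψ (runFrom up down s init (W t ω))} ≤
      ∫⁻ ω, Ψ (init (W s ω)) ∂P := by
  -- A flag remembers that the potential has once reached `1`, and the potential is then frozen at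
  -- `1`. Reaching level `1` thus becomes an absorbing set of states. Capping the potential at `1`
  -- preserves monotonicity.
  let up' : X × Prop → X × Prop := fun z => (up z.1, z.2 ∨ 1 ≤ Ψ (up z.1))
  let down' : X × Prop → X × Prop := fun z => (down z.1, z.2 ∨ 1 ≤ Ψ (down z.1))
  let init' : List (Option Bool) → X × Prop := fun w => (init w, 1 ≤ Ψ (init w))
  let Ψ' : X × Prop → ℝ≥0∞ := fun z => if z.2 then 1 else min 1 (Ψ z.1)
  have hrun : ∀ w, (runFrom up' down' s init' w).1 = runFrom up down s init w ∧
      (1 ≤ Ψ (runFrom up down s init w) → (runFrom up' down' s init' w).2) := by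
    intro w
    induction w with
    | nil => exact ⟨rfl, fun h => h⟩
    | cons l w ih =>
      rcases Nat.lt_or_ge w.length s with hl | hl
      · rw [runFrom_of_length_le _ _ _ _ (by simpa using hl),
          runFrom_of_length_le _ _ _ _ (by simpa using hl)]
        exact ⟨rfl, fun h => h⟩
      · rcases l with _ | _ | _
        · rw [runFrom_none _ _ _ _ hl, runFrom_none _ _ _ _ hl]; exact ih
        · rw [runFrom_false _ _ _ _ hl, runFrom_false _ _ _ _ hl, ← ih.1]
          exact ⟨rfl, fun h => Or.inr h⟩
        · rw [runFrom_true _ _ _ _ hl, runFrom_true _ _ _ _ hl, ← ih.1]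
          exact ⟨rfl, fun h => Or.inr h⟩
  have hle1 : ∀ z, Ψ' z ≤ 1 := fun z => by
    simp only [Ψ']; split_ifs
    · exact le_rfl
    · exact min_le_left _ _
  have hpq : ENNReal.ofReal r.p + ENNReal.ofReal (1 - r.p) = 1 := by
    rw [← ENNReal.ofReal_add r.p_nonneg (by linarith [r.p_le_one])]; simp
  refine (measure_mono ?_).trans ((hW.measure_exists_bad_le (up := up') (down := down')
    (init := init') (Ψ := Ψ') (s := s) ?_ ?_ {z | z.2} ?_ ?_ ?_).trans
    (lintegral_mono fun ω => ?_))
  · rintro ω ⟨t, ht, h⟩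
    exact ⟨t, ht, (hrun _).2 h⟩
  · rintro ⟨y, b⟩
    simp only [Ψ', up', down']
    by_cases hb : b
    · simp [hb]
    · by_cases h2 : 1 ≤ Ψ (down y)
      · rw [if_pos (Or.inr h2 : b ∨ 1 ≤ Ψ (down y))]
        split_ifs
        · exact le_rfl
        · exact min_le_left _ _
      · have h3 : ¬ 1 ≤ Ψ (up y) := fun h => h2 (h.trans (hmono y))
        rw [if_neg (by tauto), if_neg (by tauto)]
        exact min_le_min_left _ (hmono y)
  · rintro ⟨y, b⟩
    have h1 : ENNReal.ofReal r.p * Ψ' (up' (y, b)) + ENNReal.ofReal (1 - r.p) * Ψ' (down' (y, b)) ≤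
        1 := by
      calc _ ≤ ENNReal.ofReal r.p * 1 + ENNReal.ofReal (1 - r.p) * 1 := by
            gcongr <;> exact hle1 _
        _ = 1 := by rw [mul_one, mul_one, hpq]
    by_cases hb : b
    · refine h1.trans ?_
      simp [Ψ', hb]
    · have h2 : Ψ' (y, b) = min 1 (Ψ y) := by simp [Ψ', hb]
      rw [h2]
      refine le_min h1 (le_trans ?_ (hstep y))
      gcongr
      · simp only [Ψ', up']
        split_ifs with h
        · exact h.resolve_left hb
        · exact min_le_right _ _
      · simp only [Ψ', down']
        split_ifs with h
        · exact h.resolve_left hb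
        · exact min_le_right _ _
  · intro z hz; exact Or.inl hz
  · intro z hz; exact Or.inl hz
  · intro z hz
    have hz' : z.2 := hz
    simp [Ψ', hz']
  · simp only [Ψ', init']
    split_ifs with h
    · exact h
    · exact min_le_right _ _

/-! ### The climb of the walk -/

/-- The state `(j, d, y)` after `j` non-empty slots: `d` is the reach after the first `min j m` of
them, `y` is the displacement of the walk since then. -/
def climbUp (m : ℕ) (z : ℕ × ℕ × ℤ) : ℕ × ℕ × ℤ :=
  if z.1 < m then (z.1 + 1, z.2.1 - 1, 0) else (z.1 + 1, z.2.1, z.2.2 + 1)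

/-- See `climbUp`. -/
def climbDown (m : ℕ) (z : ℕ × ℕ × ℤ) : ℕ × ℕ × ℤ :=
  if z.1 < m then (z.1 + 1, z.2.1 + 1, 0) else (z.1 + 1, z.2.1, z.2.2 - 1)

/-- One step of the reflected walk, acting on functions. -/
def reflectStep (p : ℝ) (g : ℕ → ℝ≥0∞) (n : ℕ) : ℝ≥0∞ :=
  ENNReal.ofReal p * g (n - 1) + ENNReal.ofReal (1 - p) * g (n + 1)

lemma monotone_reflectStep_iterate (p : ℝ) {g : ℕ → ℝ≥0∞} (hg : Monotone g) (k : ℕ) :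
    Monotone ((reflectStep p)^[k] g) := by
  induction k with
  | zero => exact hg
  | succ k ih =>
    rw [Function.iterate_succ_apply']
    intro a b hab
    simp only [reflectStep]
    gcongr
    · exact ih (by omega)
    · exact ih (by omega)

lemma geomMean_reflectStep_iterate {β p : ℝ} (h0 : 0 ≤ β) (h1 : β < 1) (hp : 0 ≤ p) (hp1 : p ≤ 1)
    (hβ : 1 - p = β * p) (g : ℕ → ℝ≥0∞) (k : ℕ) :
    geomMean β ((reflectStep p)^[k] g) = geomMean β g := by
  induction k with
  | zero => rfl
  | succ k ih =>
    rw [Function.iterate_succ_apply', ← ih]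
    exact geomMean_step h0 h1 hp hp1 hβ _

/-- The potential for the climb of the walk at rate `ε - θ`, from index `m` on, checked from
index `n` on. -/
def climbPotential (p ε θ : ℝ) (m n : ℕ) (z : ℕ × ℕ × ℤ) : ℝ≥0∞ :=
  if z.1 < m then ENNReal.ofReal (Real.exp (-(θ ^ 2 / 2 * (n - m)))) *
    ((reflectStep p)^[m - z.1] fun d => ENNReal.ofReal (Real.exp (θ * d))) z.2.1
  else ENNReal.ofReal (Real.exp (θ * (z.2.1 - z.2.2 + (ε - θ) * (z.1 - m)) -
    θ ^ 2 / 2 * ((n - z.1 : ℕ) : ℝ)))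

lemma exp_mono_nat {θ : ℝ} (hθ : 0 ≤ θ) :
    Monotone fun d : ℕ => ENNReal.ofReal (Real.exp (θ * d)) := fun a b hab => by
  apply ENNReal.ofReal_le_ofReal
  apply Real.exp_le_exp.mpr
  have : (a : ℝ) ≤ b := by exact_mod_cast hab
  gcongr

lemma climbPotential_mono {p ε θ : ℝ} (hθ : 0 ≤ θ) {m n : ℕ} (z : ℕ × ℕ × ℤ) :
    climbPotential p ε θ m n (climbUp m z) ≤ climbPotential p ε θ m n (climbDown m z) := by
  obtain ⟨j, d, y⟩ := z
  simp only [climbUp, climbDown]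
  by_cases hj : j < m
  · rw [if_pos hj, if_pos hj]
    simp only [climbPotential]
    by_cases hj' : j + 1 < m
    · rw [if_pos hj', if_pos hj']
      gcongr
      exact monotone_reflectStep_iterate p (exp_mono_nat hθ) _ (by omega)
    · rw [if_neg hj', if_neg hj']
      apply ENNReal.ofReal_le_ofReal
      apply Real.exp_le_exp.mpr
      have : ((d - 1 : ℕ) : ℝ) ≤ ((d + 1 : ℕ) : ℝ) := by exact_mod_cast (by omega)
      gcongr
  · rw [if_neg hj, if_neg hj]
    simp only [climbPotential]
    rw [if_neg (by omega), if_neg (by omega)]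
    apply ENNReal.ofReal_le_ofReal
    apply Real.exp_le_exp.mpr
    push_cast
    gcongr
    linarith

/-- Before index `m` the potential is a conditional expectation for the reflected walk, so equality
holds. Afterwards a step contributes `θ ^ 2 / 2 - ε * θ` in the exponent by Hoeffding and the drift
contributes `θ * (ε - θ)`, in total `-θ ^ 2 / 2`. The compensator uses this up exactly until index
`n`, and beyond `n` it is pure surplus. -/
lemma climbPotential_step {p ε θ : ℝ} (h0 : 0 ≤ ε) (h1 : ε ≤ 1) (hp : p = (1 + ε) / 2) {m n : ℕ}
    (hmn : m ≤ n) (z : ℕ × ℕ × ℤ) :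
    ENNReal.ofReal p * climbPotential p ε θ m n (climbUp m z) +
      ENNReal.ofReal (1 - p) * climbPotential p ε θ m n (climbDown m z) ≤
        climbPotential p ε θ m n z := by
  obtain ⟨j, d, y⟩ := z
  simp only [climbUp, climbDown]
  by_cases hj : j < m
  · rw [if_pos hj, if_pos hj]
    -- At `j + 1 = m` the two branches of the potential agree, since the displacement is still `0`.
    have key : ∀ d', climbPotential p ε θ m n (j + 1, d', 0) =
        ENNReal.ofReal (Real.exp (-(θ ^ 2 / 2 * (n - m)))) *
          ((reflectStep p)^[m - (j + 1)] fun d => ENNReal.ofReal (Real.exp (θ * d))) d' := by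
      intro d'
      simp only [climbPotential]
      by_cases hj' : j + 1 < m
      · rw [if_pos hj']
      · obtain rfl : m = j + 1 := by omega
        rw [if_neg hj', Nat.sub_self, Function.iterate_zero_apply,
          ← ENNReal.ofReal_mul (Real.exp_nonneg _), ← Real.exp_add, Nat.cast_sub hmn]
        congr 2
        push_cast
        ring
    rw [key, key]
    simp only [climbPotential]
    rw [if_pos hj, show m - j = m - (j + 1) + 1 by omega, Function.iterate_succ_apply']
    simp only [reflectStep]
    apply le_of_eq
    ring
  · rw [if_neg hj, if_neg hj]
    simp only [climbPotential]
    rw [if_neg (by omega), if_neg (by omega), if_neg hj, ← ENNReal.ofReal_mul (by linarith),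
      ← ENNReal.ofReal_mul (by linarith), ← ENNReal.ofReal_add
        (mul_nonneg (by linarith) (Real.exp_nonneg _)) (mul_nonneg (by linarith) (Real.exp_nonneg _))]
    apply ENNReal.ofReal_le_ofReal
    have hsub : ((n - j : ℕ) : ℝ) ≤ ((n - (j + 1) : ℕ) : ℝ) + 1 := by
      exact_mod_cast (by omega : n - j ≤ n - (j + 1) + 1)
    have hb := biased_exp_le h0 h1 θ
    set c : ℝ := ((n - (j + 1) : ℕ) : ℝ)
    set B := θ * (d - y + (ε - θ) * (j - m)) - θ ^ 2 / 2 * c + θ * (ε - θ)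
    have e1 : Real.exp (θ * (d - ((y + 1 : ℤ) : ℝ) + (ε - θ) * (((j + 1 : ℕ) : ℝ) - m)) -
        θ ^ 2 / 2 * c) = Real.exp B * Real.exp (-θ) := by
      rw [← Real.exp_add]; congr 1; push_cast; ring
    have e2 : Real.exp (θ * (d - ((y - 1 : ℤ) : ℝ) + (ε - θ) * (((j + 1 : ℕ) : ℝ) - m)) -
        θ ^ 2 / 2 * c) = Real.exp B * Real.exp θ := by
      rw [← Real.exp_add]; congr 1; push_cast; ring
    rw [e1, e2]
    calc _ = Real.exp B * (p * Real.exp (-θ) + (1 - p) * Real.exp θ) := by ring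
      _ ≤ Real.exp B * Real.exp (θ ^ 2 / 2 - ε * θ) := by
        gcongr; rw [hp]; exact hb
      _ = Real.exp (B + (θ ^ 2 / 2 - ε * θ)) := by rw [← Real.exp_add]
      _ ≤ _ := by
        apply Real.exp_le_exp.mpr
        have := mul_le_mul_of_nonneg_left hsub (by positivity : 0 ≤ θ ^ 2 / 2)
        simp only [B]
        nlinarith

/-- The state of the climb automaton after slot `s`. -/
def climbState (m s : ℕ) : List (Option Bool) → ℕ × ℕ × ℤ :=
  runFrom (climbUp m) (climbDown m) s fun w => (0, reach w, 0)

/-- From index `n` on, the walk exceeds all its values up to index `m` by the amount it should,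
except with small probability. -/
lemma measure_climb_le (hW : WordLaw P x W r) {ε θ : ℝ} (h0 : 0 < ε) (h1 : ε ≤ 1)
    (hp : r.p = (1 + ε) / 2) (hθ : 0 < θ) (hθ2 : θ ≤ ε / 2) {m n : ℕ} (hmn : m ≤ n) (s : ℕ) :
    P {ω | ∃ t, s ≤ t ∧ m ≤ (climbState m s (W t ω)).1 ∧ n ≤ (climbState m s (W t ω)).1 ∧
      0 ≤ ((climbState m s (W t ω)).2.1 : ℝ) - (climbState m s (W t ω)).2.2 +
        (ε - θ) * ((climbState m s (W t ω)).1 - m)} ≤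
      ENNReal.ofReal (4 / 3 * Real.exp (-(θ ^ 2 / 2 * (n - m)))) := by
  refine (measure_mono ?_).trans ((hW.measure_exists_one_le (s := s)
    (init := fun w => (0, reach w, 0)) (climbPotential_mono (p := r.p) (ε := ε) hθ.le)
    (climbPotential_step h0.le h1 hp hmn)).trans ?_)
  · rintro ω ⟨t, ht, hm, hn, h⟩
    refine ⟨t, ht, ?_⟩
    change 1 ≤ climbPotential r.p ε θ m n (climbState m s (W t ω))
    rw [climbPotential, if_neg (by omega), Nat.sub_eq_zero_of_le hn]
    rw [← ENNReal.ofReal_one]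
    apply ENNReal.ofReal_le_ofReal
    apply Real.one_le_exp
    simp only [Nat.cast_zero, mul_zero, sub_zero]
    exact mul_nonneg hθ.le h
  · have hpot : ∀ ω, climbPotential r.p ε θ m n (0, reach (W s ω), 0) =
        ENNReal.ofReal (Real.exp (-(θ ^ 2 / 2 * (n - m)))) *
          ((reflectStep r.p)^[m] fun d => ENNReal.ofReal (Real.exp (θ * d))) (reach (W s ω)) := by
      intro ω
      simp only [climbPotential]
      by_cases hm : 0 < m
      · rw [if_pos hm, Nat.sub_zero]
      · obtain rfl : m = 0 := by omega
        rw [if_neg hm, Nat.sub_zero, Function.iterate_zero_apply, ← ENNReal.ofReal_mul (Real.exp_nonneg _),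
          ← Real.exp_add]
        congr 2
        push_cast
        ring
    have hβ0 := reachRatio_nonneg h0 h1
    have hβ1 := reachRatio_lt_one h0
    have hβ : 1 - r.p = reachRatio ε * r.p := by rw [hp]; exact reachRatio_mul h0
    rw [lintegral_congr hpot, lintegral_const_mul' _ _ ENNReal.ofReal_ne_top, mul_comm (4 / 3 : ℝ),
      ENNReal.ofReal_mul (Real.exp_nonneg _)]
    gcongr
    -- The reach at slot `s` is dominated by the stationary law, so the `m` reflected steps that
    -- follow do not change the bound on its exponential moment.
    refine (hW.lintegral_reach_le hβ0 hβ1 hβ s _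
      (monotone_reflectStep_iterate r.p (exp_mono_nat hθ.le) m)).trans ?_
    rw [geomMean_reflectStep_iterate hβ0 hβ1 r.p_nonneg r.p_le_one hβ]
    exact geomMean_exp_le h0 h1 hθ2

end WordLaw

end LongestChain

end

noncomputable section

namespace LongestChain

variable {Ω : Type*} [MeasurableSpace Ω]

/-! ### Cuts of the walk

A cut is an up-step that starts at a running maximum and to whose starting level the walk never
returns.  Here `R` is the initial reach, and a list of steps has the most recent one first. -/

/-- The reach after the steps `w`, starting from reach `R`. -/
def reachFrom (R : ℕ) : List Bool → ℕ
  | [] => R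
  | true :: w => reachFrom R w - 1
  | false :: w => reachFrom R w + 1

/-- The height of the walk above the starting level of step number `c` if this step is a cut so
far, and `0` otherwise. -/
def cutHeight (R c : ℕ) : List Bool → ℕ
  | [] => 0
  | b :: w =>
    if w.length = c then if b = true ∧ reachFrom R w = 0 then 1 else 0
    else if cutHeight R c w = 0 then 0
    else if b = true then cutHeight R c w + 1 else cutHeight R c w - 1

lemma reachFrom_antitone {R : ℕ} {w w' : List Bool} (h : List.Forall₂ (· ≤ ·) w w') :
    reachFrom R w' ≤ reachFrom R w := by
  induction h with
  | nil => exact le_rfl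
  | @cons b b' w w' hb _ ih =>
    rcases b with _ | _ <;> rcases b' with _ | _ <;> simp only [reachFrom]
    · omega
    · omega
    · exact absurd hb (by decide)
    · omega

/-- Turning down-steps into up-steps lowers the reach, so a step that starts at a running maximum
still does, and raises the walk after it, so it returns later if ever. -/
lemma cutHeight_monotone {R c : ℕ} {w w' : List Bool} (h : List.Forall₂ (· ≤ ·) w w') :
    cutHeight R c w ≤ cutHeight R c w' := by
  induction h with
  | nil => exact le_rfl
  | @cons b b' w w' hb hw ih =>
    have hr := reachFrom_antitone (R := R) hw
    have hl := hw.length_eq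
    have hbt : b = true → b' = true := by
      rintro rfl
      rcases b' with _ | _
      · exact absurd hb (by decide)
      · rfl
    have hbt' : b' ≠ true → b ≠ true := fun h h' => h (hbt h')
    simp only [cutHeight, ← hl]
    by_cases hc : w.length = c
    · simp only [if_pos hc]
      by_cases h1 : b = true ∧ reachFrom R w = 0
      · rw [if_pos h1, if_pos ⟨hbt h1.1, by omega⟩]
      · rw [if_neg h1]; exact Nat.zero_le _
    · simp only [if_neg hc]
      by_cases h1 : cutHeight R c w = 0
      · rw [if_pos h1]; exact Nat.zero_le _
      · rw [if_neg h1, if_neg (show cutHeight R c w' ≠ 0 by omega)]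
        by_cases h2 : b' = true
        · rw [if_pos h2]; split_ifs <;> omega
        · rw [if_neg h2, if_neg (hbt' h2)]; omega

/-- None of the first `n` steps is a cut. -/
def CutFree (n : ℕ) (z : ℕ × List Bool) : Prop :=
  n ≤ z.2.length ∧ ∀ c < n, cutHeight z.1 c z.2 = 0

lemma CutFree.cons {n R : ℕ} {w : List Bool} (h : CutFree n (R, w)) (b : Bool) :
    CutFree n (R, b :: w) := by
  refine ⟨h.1.trans (Nat.le_succ _), fun c hc => ?_⟩
  have hl : n ≤ w.length := h.1
  simp only [cutHeight]
  rw [if_neg (by omega), if_pos (h.2 c hc)]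

lemma CutFree.antitone {n R : ℕ} {w w' : List Bool} (hw : List.Forall₂ (· ≤ ·) w w')
    (h : CutFree n (R, w')) : CutFree n (R, w) :=
  ⟨by simpa [hw.length_eq] using h.1, fun c hc =>
    Nat.le_zero.mp ((cutHeight_monotone hw).trans (h.2 c hc).le)⟩

open Classical in
/-- The probability that the steps continuing `z` by `k` independent steps are cut-free. -/
def cutFreeProb (p : ℝ) (n : ℕ) : ℕ → ℕ × List Bool → ℝ≥0∞
  | 0, z => if CutFree n z then 1 else 0
  | k + 1, z => ENNReal.ofReal p * cutFreeProb p n k (z.1, true :: z.2) +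
      ENNReal.ofReal (1 - p) * cutFreeProb p n k (z.1, false :: z.2)

/-- The comparison with independent steps needs a potential monotone in the step taken. This
abstract probability is monotone because cut-freeness is; the explicit potential constructed below
is needed only to bound its value. -/
lemma cutFreeProb_antitone {p : ℝ} {n R : ℕ} (k : ℕ) : ∀ {w w' : List Bool},
    List.Forall₂ (· ≤ ·) w w' → cutFreeProb p n k (R, w') ≤ cutFreeProb p n k (R, w) := by
  induction k with
  | zero =>
    intro w w' h
    simp only [cutFreeProb]
    by_cases h' : CutFree n (R, w')
    · rw [if_pos h', if_pos (h'.antitone h)]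
    · rw [if_neg h']; exact zero_le
  | succ k ih =>
    intro w w' h
    simp only [cutFreeProb]
    gcongr
    · exact ih (h.cons le_rfl)
    · exact ih (h.cons le_rfl)

lemma ofReal_add_one_sub {p : ℝ} (h0 : 0 ≤ p) (h1 : p ≤ 1) :
    ENNReal.ofReal p + ENNReal.ofReal (1 - p) = 1 := by
  rw [← ENNReal.ofReal_add h0 (by linarith)]; simp

lemma monotone_cutFreeProb {p : ℝ} (h0 : 0 ≤ p) (h1 : p ≤ 1) (n : ℕ) :
    Monotone fun k => cutFreeProb p n k := by
  refine monotone_nat_of_le_succ fun k => ?_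
  induction k with
  | zero =>
    rintro ⟨R, w⟩
    simp only [cutFreeProb]
    by_cases h : CutFree n (R, w)
    · rw [if_pos h, if_pos (h.cons true), if_pos (h.cons false), mul_one, mul_one,
        ofReal_add_one_sub h0 h1]
    · rw [if_neg h]; exact zero_le
  | succ k ih =>
    intro z
    rw [cutFreeProb, cutFreeProb]
    gcongr
    · exact ih _
    · exact ih _

/-- The probability that some continuation of `z` is cut-free. -/
def cutFreeLimit (p : ℝ) (n : ℕ) (z : ℕ × List Bool) : ℝ≥0∞ := ⨆ k, cutFreeProb p n k z

/-- The recursion defining `cutFreeProb` passes to the supremum, as the probabilities increase with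
the number of further steps: a cut-free list stays cut-free. -/
lemma cutFreeLimit_step {p : ℝ} (h0 : 0 ≤ p) (h1 : p ≤ 1) (n : ℕ) (z : ℕ × List Bool) :
    ENNReal.ofReal p * cutFreeLimit p n (z.1, true :: z.2) +
      ENNReal.ofReal (1 - p) * cutFreeLimit p n (z.1, false :: z.2) ≤ cutFreeLimit p n z := by
  simp only [cutFreeLimit, ENNReal.mul_iSup]
  rw [ENNReal.iSup_add_iSup_of_monotone]
  · exact iSup_le fun k => le_iSup_of_le (k + 1) (by rw [cutFreeProb])
  · intro k l h
    dsimp only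
    gcongr
    exact monotone_cutFreeProb h0 h1 n h _
  · intro k l h
    dsimp only
    gcongr
    exact monotone_cutFreeProb h0 h1 n h _

/-! ### A potential for cut-free walks -/

/-- The parameters of the potential for cut-free walks: step probabilities `p` and `q = β p`, a
base `x` with `x³ β < 1`, the decay `κ` and the cost `4 / 3` of a trial. -/
structure CutRates (p q β x κ A : ℝ) : Prop where
  p_nonneg : 0 ≤ p
  q_nonneg : 0 ≤ q
  add_eq : p + q = 1
  q_eq : q = β * p
  β_nonneg : 0 ≤ β
  β_le : β ≤ 1
  one_le : 1 ≤ x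
  κ_eq : κ = p / x + q * x
  A_nonneg : 0 ≤ A
  A_eq : A * (1 - β * x ^ 3) = β * x ^ 3 * (1 - 1 / x)
  cost : q * x ^ 2 * (1 + A) + 4 / 3 * (q * x) ≤ 4 / 3 * κ

/-- With `x = exp (ε / 3)` one has `β * x ^ 6 ≤ 1`, hence `β * x ^ 3 < 1`, while Hoeffding's bound
for `κ` has exponent `ε ^ 2 / 18 - ε ^ 2 / 3 = -5 * ε ^ 2 / 18`. The constant `A` solves the
boundary condition at reach `0` and is at most `1 / 3`, and that is what makes a cost of `4 / 3` per
trial enough. -/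
lemma cutRates {ε : ℝ} (h0 : 0 < ε) (h1 : ε ≤ 1) :
    ∃ κ A, CutRates ((1 + ε) / 2) (1 - (1 + ε) / 2) (reachRatio ε) (Real.exp (ε / 3)) κ A ∧
      κ ≤ Real.exp (-(5 * ε ^ 2 / 18)) := by
  have hb0 := reachRatio_nonneg h0 h1
  have hb1 := reachRatio_lt_one h0
  have hβ := reachRatio_mul h0
  set β := reachRatio ε
  set x := Real.exp (ε / 3)
  have hx1 : 1 ≤ x := Real.one_le_exp (by linarith)
  have hx0 : 0 < x := by linarith
  have hx3 : x ^ 3 = Real.exp ε := by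
    rw [← Real.exp_nat_mul]; congr 1; push_cast; ring
  have hbx : β * x ^ 3 < 1 := by
    rw [hx3]; exact reachRatio_mul_exp_lt_one h0 h1 (by linarith)
  have hbx' : β * x ^ 3 * x ^ 3 ≤ 1 := by
    rw [hx3, mul_assoc, ← Real.exp_add]
    calc _ ≤ Real.exp (-(2 * ε)) * Real.exp (ε + ε) := by gcongr; exact reachRatio_le_exp h0 h1
      _ = 1 := by rw [← Real.exp_add]; simp [two_mul]
  have hq3 : (1 - (1 + ε) / 2) * x ^ 3 ≤ 1 / 2 := by
    have : 1 - ε ≤ Real.exp (-ε) := by linarith [Real.add_one_le_exp (-ε)]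
    rw [hx3]
    calc _ = (1 - ε) * Real.exp ε / 2 := by ring
      _ ≤ Real.exp (-ε) * Real.exp ε / 2 := by gcongr
      _ = 1 / 2 := by rw [← Real.exp_add]; simp
  have hinv : 1 / x ≤ 1 := by rw [div_le_one hx0]; exact hx1
  have hA0 : 0 ≤ β * x ^ 3 * (1 - 1 / x) / (1 - β * x ^ 3) :=
    div_nonneg (mul_nonneg (by positivity) (by linarith)) (by linarith)
  set A := β * x ^ 3 * (1 - 1 / x) / (1 - β * x ^ 3) with hA
  have hA3 : A ≤ 1 / 3 := by
    rw [hA, div_le_iff₀ (by linarith)]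
    set b := β * x ^ 3
    have hb0' : 0 ≤ b := by positivity
    have e1 : b * (1 - 1 / x) * x ≤ (1 - b) * x / 3 := by
      have : b * (1 - 1 / x) * x = b * (x - 1) := by field_simp
      rw [this]
      -- `b x³ ≤ 1` and `4 x - 3 ≤ x⁴`
      have h4 : 4 * x - 3 ≤ x * x ^ 3 := by nlinarith [sq_nonneg (x - 1), sq_nonneg (x ^ 2 - 1), sq_nonneg x]
      have := mul_le_mul_of_nonneg_left h4 hb0'
      nlinarith
    have e2 := le_of_mul_le_mul_right (by linarith : b * (1 - 1 / x) * x ≤ (1 / 3 * (1 - b)) * x) hx0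
    exact e2
  have hq0 : 0 ≤ 1 - (1 + ε) / 2 := by linarith
  refine ⟨(1 + ε) / 2 / x + (1 - (1 + ε) / 2) * x, A, ⟨by linarith, hq0, by ring, hβ, hb0, hb1.le,
    hx1, rfl, hA0, ?_, ?_⟩, ?_⟩
  · rw [hA, div_mul_cancel₀ _ (by linarith)]
  -- Since `κ ≥ 1 / x`, it suffices that `q * x ^ 3 * (1 + A) + 4 / 3 * (q * x ^ 2) ≤ 4 / 3`. The
  -- bounds `q * x ^ 3 ≤ 1 / 2` and `A ≤ 1 / 3` give exactly this.
  · set q := 1 - (1 + ε) / 2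
    have hp : (1 + ε) / 2 = 1 - q := by simp only [q]; ring
    rw [hp]
    have hk : 1 / x ≤ (1 - q) / x + q * x := by
      have : (1 - q) / x + q * x = 1 / x + q * (x - 1 / x) := by ring
      rw [this]
      have : 0 ≤ q * (x - 1 / x) := mul_nonneg hq0 (by linarith)
      linarith
    refine le_trans ?_ (mul_le_mul_of_nonneg_left hk (by norm_num))
    have e : q * x ^ 2 * (1 + A) + 4 / 3 * (q * x) =
        (q * x ^ 3 * (1 + A) + 4 / 3 * (q * x ^ 2)) * (1 / x) := by field_simp
    rw [e]
    refine mul_le_mul_of_nonneg_right ?_ (by positivity)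
    have h2 : q * x ^ 2 ≤ q * x ^ 3 := by
      refine mul_le_mul_of_nonneg_left ?_ hq0
      exact pow_le_pow_right₀ hx1 (by norm_num)
    have h3 : q * x ^ 3 * A ≤ 1 / 2 * (1 / 3) := mul_le_mul hq3 hA3 hA0 (by norm_num)
    nlinarith
  · have := biased_exp_le h0.le h1 (ε / 3)
    calc _ = (1 + ε) / 2 * Real.exp (-(ε / 3)) + (1 - (1 + ε) / 2) * Real.exp (ε / 3) := by
          rw [Real.exp_neg, div_eq_mul_inv]
      _ ≤ _ := this
      _ = _ := by congr 1; ring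

/-- The state `(d, y, i, j)` of a search for cuts among the first `n` steps: `d` is the reach, `y`
is the height above the start of the current trial (`0` if there is none), `i` is the number of
trials that failed and `j` the number of steps. -/
def trialUp (n : ℕ) : ℕ × ℕ × ℕ × ℕ → ℕ × ℕ × ℕ × ℕ := fun (d, y, i, j) =>
  if y = 0 then if d = 0 ∧ j < n then (0, 1, i, j + 1) else (d - 1, 0, i, j + 1)
  else (d - 1, y + 1, i, j + 1)

/-- See `trialUp`. -/
def trialDown : ℕ × ℕ × ℕ × ℕ → ℕ × ℕ × ℕ × ℕ := fun (d, y, i, j) =>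
  (d + 1, y - 1, if y = 1 then i + 1 else i, j + 1)

lemma trialUp_start {n i j : ℕ} (h : j < n) : trialUp n (0, 0, i, j) = (0, 1, i, j + 1) := by
  simp [trialUp, h]

lemma trialUp_climb (n d i j : ℕ) : trialUp n (d + 1, 0, i, j) = (d, 0, i, j + 1) := by
  simp [trialUp]

lemma trialUp_trial (n d y i j : ℕ) :
    trialUp n (d, y + 1, i, j) = (d - 1, y + 1 + 1, i, j + 1) := by
  simp [trialUp]

lemma trialDown_zero (d i j : ℕ) : trialDown (d, 0, i, j) = (d + 1, 0, i, j + 1) := by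
  simp [trialDown]

lemma trialDown_one (d i j : ℕ) : trialDown (d, 1, i, j) = (d + 1, 0, i + 1, j + 1) := by
  simp [trialDown]

lemma trialDown_trial (d y i j : ℕ) :
    trialDown (d, y + 1 + 1, i, j) = (d + 1, y + 1, i, j + 1) := by
  simp [trialDown]

/-- The state of the search for cuts. -/
def trialState (n R : ℕ) : List Bool → ℕ × ℕ × ℕ × ℕ
  | [] => (R, 0, 0, 0)
  | true :: w => trialUp n (trialState n R w)
  | false :: w => trialDown (trialState n R w)

/-- A trial in progress is a cut so far: it began with an up-step at reach `0` among the first `n`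
steps, and the walk has not returned to its starting level. Cut-free lists are therefore never in a
trial. -/
lemma trialState_spec (n R : ℕ) (w : List Bool) :
    (trialState n R w).1 = reachFrom R w ∧ (trialState n R w).2.2.2 = w.length ∧
      ((trialState n R w).2.1 ≠ 0 → ∃ c < n, c < w.length ∧
        cutHeight R c w = (trialState n R w).2.1) := by
  induction w with
  | nil => exact ⟨rfl, rfl, fun h => absurd rfl h⟩
  | cons b w ih =>
    rcases hz : trialState n R w with ⟨d, y, i, j⟩
    rw [hz] at ih
    obtain ⟨hd, hj, hy⟩ := ih
    simp only at hd hj hy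
    rcases b with _ | _
    · simp only [trialState, hz, trialDown, reachFrom, List.length_cons]
      refine ⟨by omega, by omega, fun h => ?_⟩
      obtain ⟨c, hcn, hcl, hc⟩ := hy (by omega)
      refine ⟨c, hcn, by omega, ?_⟩
      simp only [cutHeight]
      rw [if_neg (by omega), if_neg (by omega), if_neg (by decide), hc]
    · simp only [trialState, hz, trialUp, reachFrom, List.length_cons]
      split_ifs with h1 h2
      · refine ⟨by simp only; omega, by simp only; omega, fun _ => ⟨w.length, by omega, by omega, ?_⟩⟩
        simp only [cutHeight]
        rw [if_pos trivial, if_pos ⟨trivial, by omega⟩]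
      · exact ⟨by simp only; omega, by simp only; omega, fun h => absurd rfl h⟩
      · refine ⟨by simp only; omega, by simp only; omega, fun _ => ?_⟩
        obtain ⟨c, hcn, hcl, hc⟩ := hy h1
        refine ⟨c, hcn, by omega, ?_⟩
        simp only [cutHeight]
        rw [if_neg (by omega), if_neg (by omega), if_pos trivial, hc]

/-- The potential of the search before its `n`-th step; at most `m` trials are taken into
account. -/
def trialBound (β x κ A : ℝ) (m n : ℕ) : ℕ × ℕ × ℕ × ℕ → ℝ := fun (d, y, i, j) =>
  if m ≤ i then 1
  else if y = 0 then β ^ (m - i) + κ ^ (n - j) * (4 / 3) ^ (m - i) * x ^ d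
  else β ^ (m - i - 1 + y) + κ ^ (n - j) * (4 / 3) ^ (m - i - 1) *
    ((β * x ^ 2) ^ y * (x ^ d + A * (β * x ^ 3) ^ d))

/-- The potential of the search. -/
def trialPotential (β x κ A : ℝ) (m n : ℕ) : ℕ × ℕ × ℕ × ℕ → ℝ := fun z =>
  if n ≤ z.2.2.2 then β ^ z.2.1 else trialBound β x κ A m n z

section Trial

variable {p q β x κ A : ℝ} {m n : ℕ}

lemma CutRates.κ_nonneg (hr : CutRates p q β x κ A) : 0 ≤ κ := by
  have := hr.one_le
  have := hr.p_nonneg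
  have := hr.q_nonneg
  rw [hr.κ_eq]; positivity

/-- At step `n` the search stops opening trials and only the fate of the current one matters; from
height `y` it fails with probability `β ^ y`, which the second summand of the bound dominates. -/
lemma trialPotential_le_bound (hr : CutRates p q β x κ A) {z : ℕ × ℕ × ℕ × ℕ}
    (hz : z.2.2.2 ≤ n) : trialPotential β x κ A m n z ≤ trialBound β x κ A m n z := by
  obtain ⟨d, y, i, j⟩ := z
  simp only at hz
  simp only [trialPotential]
  split_ifs with h
  swap
  · exact le_rfl
  obtain rfl : n = j := by omega
  have hx := hr.one_le
  have hA := hr.A_nonneg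
  have hβ := hr.β_nonneg
  simp only [trialBound, Nat.sub_self, pow_zero, one_mul]
  split_ifs with h1 h2
  · exact pow_le_one₀ hβ hr.β_le
  · rw [h2, pow_zero]
    have e1 : (1 : ℝ) ≤ (4 / 3) ^ (m - i) := one_le_pow₀ (by norm_num)
    have e2 : (1 : ℝ) ≤ x ^ d := one_le_pow₀ hx
    have e3 : 0 ≤ β ^ (m - i) := by positivity
    nlinarith
  · have e1 : (1 : ℝ) ≤ (4 / 3) ^ (m - i - 1) := one_le_pow₀ (by norm_num)
    have e2 : (1 : ℝ) ≤ x ^ d := one_le_pow₀ hx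
    have e3 : 0 ≤ β ^ (m - i - 1 + y) := by positivity
    have e4 : β ^ y ≤ (β * x ^ 2) ^ y :=
      pow_le_pow_left₀ hβ (le_mul_of_one_le_right hβ (one_le_pow₀ hx)) y
    have e5 : 0 ≤ A * (β * x ^ 3) ^ d := by positivity
    calc β ^ y ≤ (β * x ^ 2) ^ y := e4
      _ ≤ (β * x ^ 2) ^ y * (x ^ d + A * (β * x ^ 3) ^ d) :=
        le_mul_of_one_le_right (by positivity) (by linarith)
      _ ≤ (4 / 3) ^ (m - i - 1) * ((β * x ^ 2) ^ y * (x ^ d + A * (β * x ^ 3) ^ d)) :=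
        le_mul_of_one_le_left (by positivity) e1
      _ ≤ _ := by linarith

/-- The exponential factor of a trial is harmonic up to the decay. -/
lemma trial_harmonic (hr : CutRates p q β x κ A) (d y : ℕ) :
    p * ((β * x ^ 2) ^ (y + 1 + 1) * (x ^ (d - 1) + A * (β * x ^ 3) ^ (d - 1))) +
      q * ((β * x ^ 2) ^ y * (x ^ (d + 1) + A * (β * x ^ 3) ^ (d + 1))) =
    κ * ((β * x ^ 2) ^ (y + 1) * (x ^ d + A * (β * x ^ 3) ^ d)) := by
  have hx : x ≠ 0 := by have := hr.one_le; positivity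
  have hA := hr.A_eq
  rw [hr.κ_eq, hr.q_eq]
  rcases d with _ | d
  -- At reach `0` an up-step does not lower the reach, and neither exponential is harmonic alone;
  -- `A` was chosen so that their combination is.
  · have e : A = β * x ^ 3 * (1 - 1 / x) + A * (β * x ^ 3) := by linarith
    have e2 : x * A = β * x ^ 3 * (x - 1) + x * A * (β * x ^ 3) := by
      calc x * A = x * (β * x ^ 3 * (1 - 1 / x) + A * (β * x ^ 3)) := by rw [← e]
        _ = _ := by field_simp
    simp only [Nat.zero_sub, pow_zero, mul_one, zero_add, pow_one]
    have e3 : p / x + β * p * x = p * (1 + β * x ^ 2) / x := by field_simp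
    rw [e3]
    have : p * ((β * x ^ 2) ^ (y + 1 + 1) * (1 + A)) + β * p * ((β * x ^ 2) ^ y * (x + A * (β * x ^ 3)))
        = p * (β * x ^ 2) ^ y * β * (x * (x * (β * x ^ 2) * (1 + A)) + x * (1 + A * (β * x ^ 2))) := by
      ring
    rw [this, div_mul_eq_mul_div, eq_div_iff hx]
    have : p * (1 + β * x ^ 2) * ((β * x ^ 2) ^ (y + 1) * (1 + A)) =
      p * (β * x ^ 2) ^ y * β * (x ^ 2 * (1 + β * x ^ 2) * (1 + A)) := by ring
    rw [this, mul_assoc]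
    congr 1
    linear_combination -x * e2
  · rw [Nat.add_sub_cancel]
    field_simp
    ring

lemma trialBound_of_le {z : ℕ × ℕ × ℕ × ℕ} (h : m ≤ z.2.2.1) : trialBound β x κ A m n z = 1 := by
  simp only [trialBound]
  rw [if_pos h]

/-- The bound adds two ways of finding no cut. Powers of `β` stand for the failure of all `m`
trials; they are harmonic since `β` is the chance of ever descending one level. The terms with `κ`
stand for running out of steps first; they are harmonic up to the factor `κ` per step during a climb
and during a trial, and the start of a trial is covered by `hr.cost`. -/
lemma trialBound_step (hr : CutRates p q β x κ A) {z : ℕ × ℕ × ℕ × ℕ} (hz : z.2.2.2 < n) :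
    p * trialBound β x κ A m n (trialUp n z) + q * trialBound β x κ A m n (trialDown z) ≤
      trialBound β x κ A m n z := by
  obtain ⟨d, y, i, j⟩ := z
  simp only at hz
  have hx : x ≠ 0 := by have := hr.one_le; positivity
  have hx1 := hr.one_le
  have hp := hr.p_nonneg
  have hq := hr.q_nonneg
  have hA := hr.A_nonneg
  have hβ := hr.β_nonneg
  have hκ := hr.κ_nonneg
  have hn : n - j = n - (j + 1) + 1 := by omega
  by_cases hi : m ≤ i
  · rw [trialBound_of_le (by simp only [trialUp]; split_ifs <;> exact hi),
      trialBound_of_le (by simp only [trialDown]; split_ifs <;> omega), trialBound_of_le hi]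
    linarith [hr.add_eq]
  obtain ⟨M, hM⟩ : ∃ M, m - i = M + 1 := ⟨m - i - 1, by omega⟩
  set C := κ ^ (n - (j + 1)) * (4 / 3 : ℝ) ^ M with hC
  have hC0 : 0 ≤ C := by positivity
  rcases y with _ | y
  · have hdown : trialBound β x κ A m n (trialDown (d, 0, i, j)) =
        β ^ (M + 1) + C * (4 / 3) * x ^ (d + 1) := by
      rw [trialDown_zero]
      simp only [trialBound]
      rw [if_neg hi, if_pos trivial, hM, hC]
      ring
    have hself : trialBound β x κ A m n (d, 0, i, j) = β ^ (M + 1) + κ * (C * (4 / 3)) * x ^ d := by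
      simp only [trialBound]
      rw [if_neg hi, if_pos trivial, hM, hn, hC]
      ring
    rw [hdown, hself]
    rcases d with _ | d
    · have hup : trialBound β x κ A m n (trialUp n (0, 0, i, j)) =
          β ^ (M + 1) + C * (β * x ^ 2 * (1 + A)) := by
        rw [trialUp_start hz]
        simp only [trialBound]
        rw [if_neg hi, if_neg one_ne_zero, hM, Nat.add_sub_cancel, hC]
        ring
      rw [hup]
      have h1 := mul_le_mul_of_nonneg_left hr.cost hC0
      have h2 : p * (β * x ^ 2 * (1 + A)) = q * x ^ 2 * (1 + A) := by rw [hr.q_eq]; ring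
      have h3 : p * β ^ (M + 1) + q * β ^ (M + 1) = β ^ (M + 1) := by rw [← add_mul, hr.add_eq, one_mul]
      calc _ = (p * β ^ (M + 1) + q * β ^ (M + 1)) + C * (p * (β * x ^ 2 * (1 + A)) + 4 / 3 * (q * x)) := by
            ring
        _ ≤ β ^ (M + 1) + C * (4 / 3 * κ) := by rw [h2, h3]; linarith
        _ = _ := by ring
    · have hup : trialBound β x κ A m n (trialUp n (d + 1, 0, i, j)) =
          β ^ (M + 1) + C * (4 / 3) * x ^ d := by
        rw [trialUp_climb]
        simp only [trialBound]
        rw [if_neg hi, if_pos trivial, hM, hC]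
        ring
      rw [hup]
      apply le_of_eq
      have h3 : p * β ^ (M + 1) + q * β ^ (M + 1) = β ^ (M + 1) := by rw [← add_mul, hr.add_eq, one_mul]
      have h4 : p * x ^ d + q * x ^ (d + 1 + 1) = κ * x ^ (d + 1) := by
        rw [hr.κ_eq]; field_simp; ring
      linear_combination h3 + C * (4 / 3) * h4
  · have hup : trialBound β x κ A m n (trialUp n (d, y + 1, i, j)) = β ^ (M + (y + 1 + 1)) +
        C * ((β * x ^ 2) ^ (y + 1 + 1) * (x ^ (d - 1) + A * (β * x ^ 3) ^ (d - 1))) := by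
      rw [trialUp_trial]
      simp only [trialBound]
      rw [if_neg hi, if_neg (by omega), hM, Nat.add_sub_cancel, hC]
    have hself : trialBound β x κ A m n (d, y + 1, i, j) = β ^ (M + (y + 1)) +
        κ * C * ((β * x ^ 2) ^ (y + 1) * (x ^ d + A * (β * x ^ 3) ^ d)) := by
      simp only [trialBound]
      rw [if_neg hi, if_neg (by omega), hM, Nat.add_sub_cancel, hC, hn]
      ring
    have hdown : trialBound β x κ A m n (trialDown (d, y + 1, i, j)) ≤ β ^ (M + y) +
        C * ((β * x ^ 2) ^ y * (x ^ (d + 1) + A * (β * x ^ 3) ^ (d + 1))) := by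
      rcases y with _ | y
      · rw [zero_add, trialDown_one]
        simp only [trialBound, if_true, pow_zero, one_mul, add_zero]
        have h5 : 0 ≤ A * (β * x ^ 3) ^ (d + 1) := by positivity
        split_ifs with h6
        -- The last of the `m` counted trials has failed, and the bound takes the value `1`. In the
        -- other case the trial also fails, and the term with `A` is simply dropped.
        · obtain rfl : M = 0 := by omega
          have : 0 ≤ C * (x ^ (d + 1) + A * (β * x ^ 3) ^ (d + 1)) := by positivity
          rw [pow_zero]; linarith
        · rw [show m - (i + 1) = M by omega, ← hC]
          have := mul_nonneg hC0 h5
          linarith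
      · rw [trialDown_trial]
        simp only [trialBound]
        rw [if_neg hi, if_neg (by omega), hM, Nat.add_sub_cancel, hC]
    rw [hup, hself]
    have h7 := trial_harmonic hr d y
    have h8 : p * β ^ (M + (y + 1 + 1)) + q * β ^ (M + y) = β ^ (M + (y + 1)) := by
      have : p = 1 - q := by linarith [hr.add_eq]
      have h9 : q = β * (1 - q) := by rw [← this]; exact hr.q_eq
      rw [this]
      linear_combination β ^ (M + y) * (1 - β) * h9
    calc _ ≤ p * (β ^ (M + (y + 1 + 1)) +
          C * ((β * x ^ 2) ^ (y + 1 + 1) * (x ^ (d - 1) + A * (β * x ^ 3) ^ (d - 1)))) +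
          q * (β ^ (M + y) + C * ((β * x ^ 2) ^ y * (x ^ (d + 1) + A * (β * x ^ 3) ^ (d + 1)))) := by
          gcongr
      _ = _ := by linear_combination h8 + C * h7

lemma trialPotential_step (hr : CutRates p q β x κ A) (z : ℕ × ℕ × ℕ × ℕ) :
    p * trialPotential β x κ A m n (trialUp n z) + q * trialPotential β x κ A m n (trialDown z) ≤
      trialPotential β x κ A m n z := by
  have hup : (trialUp n z).2.2.2 = z.2.2.2 + 1 := by
    obtain ⟨d, y, i, j⟩ := z
    simp only [trialUp]; split_ifs <;> rfl
  have hdown : (trialDown z).2.2.2 = z.2.2.2 + 1 := rfl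
  by_cases hz : z.2.2.2 < n
  · calc _ ≤ p * trialBound β x κ A m n (trialUp n z) + q * trialBound β x κ A m n (trialDown z) := by
          have := hr.p_nonneg
          have := hr.q_nonneg
          gcongr <;> exact trialPotential_le_bound hr (by omega)
      _ ≤ _ := trialBound_step hr hz
      _ = _ := by rw [trialPotential, if_neg (by omega)]
  · simp only [trialPotential]
    rw [if_pos (by omega), if_pos (by omega), if_pos (by omega)]
    obtain ⟨d, y, i, j⟩ := z
    simp only at hz
    rcases y with _ | y
    · have : (trialUp n (d, 0, i, j)).2.1 = 0 := by
        simp only [trialUp]; rw [if_pos trivial, if_neg (by omega)]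
      rw [this]
      simp only [trialDown, pow_zero, Nat.zero_sub]
      linarith [hr.add_eq]
    · have : (trialUp n (d, y + 1, i, j)).2.1 = y + 1 + 1 := by
        simp only [trialUp]; rw [if_neg (by omega)]
      rw [this]
      simp only [trialDown, Nat.add_sub_cancel]
      have : p = 1 - q := by linarith [hr.add_eq]
      have h9 : q = β * (1 - q) := by rw [← this]; exact hr.q_eq
      rw [this]
      apply le_of_eq
      linear_combination β ^ y * (1 - β) * h9

lemma trialPotential_nonneg (hr : CutRates p q β x κ A) (z : ℕ × ℕ × ℕ × ℕ) :
    0 ≤ trialPotential β x κ A m n z := by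
  have := hr.β_nonneg
  have := hr.A_nonneg
  have := hr.one_le
  have := hr.κ_nonneg
  obtain ⟨d, y, i, j⟩ := z
  simp only [trialPotential, trialBound]
  split_ifs <;> positivity

/-- The trial potential decreases on average under independent steps and is at least `1` on cut-free
lists, where no trial is in progress. The number `m` of counted trials is free. -/
lemma cutFreeProb_le (hr : CutRates p q β x κ A) (k R : ℕ) (w : List Bool) :
    cutFreeProb p n k (R, w) ≤
      ENNReal.ofReal (trialPotential β x κ A m n (trialState n R w)) := by
  induction k generalizing w with
  | zero =>
    simp only [cutFreeProb]
    split_ifs with h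
    swap
    · exact zero_le
    obtain ⟨-, h2, h3⟩ := trialState_spec n R w
    have hy : (trialState n R w).2.1 = 0 := by
      by_contra hy
      obtain ⟨c, hc, -, h4⟩ := h3 hy
      have := h.2 c hc
      simp only at this
      omega
    rw [trialPotential, if_pos (by rw [h2]; exact h.1), hy]
    simp
  | succ k ih =>
    rw [cutFreeProb]
    have hq : 1 - p = q := by linarith [hr.add_eq]
    calc _ ≤ ENNReal.ofReal p * ENNReal.ofReal (trialPotential β x κ A m n (trialState n R (true :: w))) +
          ENNReal.ofReal (1 - p) *
            ENNReal.ofReal (trialPotential β x κ A m n (trialState n R (false :: w))) := by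
          gcongr <;> exact ih _
      _ ≤ _ := by
          rw [hq, ← ENNReal.ofReal_mul hr.p_nonneg, ← ENNReal.ofReal_mul hr.q_nonneg,
            ← ENNReal.ofReal_add (mul_nonneg hr.p_nonneg (trialPotential_nonneg hr _))
              (mul_nonneg hr.q_nonneg (trialPotential_nonneg hr _))]
          exact ENNReal.ofReal_le_ofReal (trialPotential_step hr _)

end Trial

/-- The steps of the walk after slot `s`, together with the reach at slot `s`. -/
def stepsAfter (s : ℕ) : List (Option Bool) → ℕ × List Bool :=
  runFrom (fun z => (z.1, true :: z.2)) (fun z => (z.1, false :: z.2)) s fun w => (reach w, [])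

namespace WordLaw

variable {P : Measure Ω} [IsProbabilityMeasure P] {x : ℕ → Ω → Option Bool}
  {W : ℕ → Ω → List (Option Bool)} {r : Rates}

/-- The probability that no cut occurs among the first `n` steps after slot `s`. -/
lemma measure_cutFree_le (hW : WordLaw P x W r) {ε : ℝ} (h0 : 0 < ε) (h1 : ε ≤ 1)
    (hp : r.p = (1 + ε) / 2) (s : ℕ) {m n : ℕ} (hm : 0 < m) (hn : 0 < n) :
    P {ω | ∃ t, s ≤ t ∧ CutFree n (stepsAfter s (W t ω))} ≤
      ENNReal.ofReal (reachRatio ε ^ m +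
        4 / 3 * (Real.exp (-(5 * ε ^ 2 / 18)) ^ n * (4 / 3) ^ m)) := by
  obtain ⟨κ, A, hr, hκ⟩ := cutRates h0 h1
  have hκ0 := hr.κ_nonneg
  have hβ0 := reachRatio_nonneg h0 h1
  have hβ1 := reachRatio_lt_one h0
  have hβ : 1 - r.p = reachRatio ε * r.p := by rw [hp]; exact reachRatio_mul h0
  refine (measure_mono ?_).trans ((hW.measure_exists_one_le (s := s)
    (up := fun z : ℕ × List Bool => (z.1, true :: z.2)) (down := fun z => (z.1, false :: z.2))
    (init := fun w => (reach w, [])) (Ψ := cutFreeLimit r.p n) ?_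
    (cutFreeLimit_step r.p_nonneg r.p_le_one n)).trans ?_)
  · rintro ω ⟨t, ht, h⟩
    refine ⟨t, ht, le_iSup_of_le 0 ?_⟩
    rw [cutFreeProb]
    exact (if_pos h).ge
  · rintro ⟨R, w⟩
    exact iSup_mono fun k => cutFreeProb_antitone k
      (List.Forall₂.cons (by decide) (List.forall₂_refl _))
  · have hle : ∀ ω, cutFreeLimit r.p n (reach (W s ω), []) ≤
        ENNReal.ofReal (reachRatio ε ^ m) + ENNReal.ofReal (κ ^ n * (4 / 3) ^ m) *
          ENNReal.ofReal (Real.exp (ε / 3 * reach (W s ω))) := by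
      intro ω
      refine iSup_le fun k => ?_
      rw [hp]
      refine (cutFreeProb_le (m := m) hr k _ _).trans (le_of_eq ?_)
      simp only [trialState, trialPotential, trialBound]
      rw [if_neg (by omega), if_neg (by omega), if_pos trivial, Nat.sub_zero, Nat.sub_zero,
        ENNReal.ofReal_add (by positivity) (by positivity), ENNReal.ofReal_mul (by positivity),
        ← Real.exp_nat_mul, mul_comm (ε / 3)]
    refine (lintegral_mono hle).trans ?_
    rw [lintegral_add_left measurable_const, lintegral_const_mul' _ _ ENNReal.ofReal_ne_top,
      lintegral_const, measure_univ, mul_one,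
      ENNReal.ofReal_add (by positivity) (by positivity)]
    gcongr
    have := (hW.lintegral_reach_le hβ0 hβ1 hβ s _ (exp_mono_nat (by linarith : 0 ≤ ε / 3))).trans
      (geomMean_exp_le h0 h1 (by linarith))
    have hle : κ ^ n * (4 / 3) ^ m ≤ Real.exp (-(5 * ε ^ 2 / 18)) ^ n * (4 / 3) ^ m := by gcongr
    rw [mul_comm (4 / 3 : ℝ),
      ENNReal.ofReal_mul (p := _ * _) (by positivity)]
    exact mul_le_mul' (ENNReal.ofReal_le_ofReal hle) this

end WordLaw

end LongestChain

end

noncomputable section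

namespace LongestChain

/-! ### The walk along a sequence of slot types -/

/-- The word of the first `t` slot types of a sequence. -/
def wordOf (x : ℕ → Option Bool) : ℕ → List (Option Bool)
  | 0 => []
  | t + 1 => x t :: wordOf x t

lemma length_wordOf (x : ℕ → Option Bool) (t : ℕ) : (wordOf x t).length = t := by
  induction t with
  | zero => rfl
  | succ t ih => simp [wordOf, ih]

/-- The position of the walk with a step `+1` for special slots and `-1` for other non-empty
slots. -/
def walk : List (Option Bool) → ℤ
  | [] => 0
  | none :: w => walk w
  | some true :: w => walk w + 1
  | some false :: w => walk w - 1

section Run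

variable {X : Type*} {up down : X → X} {s : ℕ} {init : List (Option Bool) → X}
  {x : ℕ → Option Bool} {t : ℕ}

lemma runFrom_wordOf_none (hst : s ≤ t) (h : x t = none) :
    runFrom up down s init (wordOf x (t + 1)) = runFrom up down s init (wordOf x t) := by
  rw [wordOf, h, runFrom_none _ _ _ _ (by rwa [length_wordOf])]

lemma runFrom_wordOf_true (hst : s ≤ t) (h : x t = some true) :
    runFrom up down s init (wordOf x (t + 1)) = up (runFrom up down s init (wordOf x t)) := by
  rw [wordOf, h, runFrom_true _ _ _ _ (by rwa [length_wordOf])]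

lemma runFrom_wordOf_false (hst : s ≤ t) (h : x t = some false) :
    runFrom up down s init (wordOf x (t + 1)) = down (runFrom up down s init (wordOf x t)) := by
  rw [wordOf, h, runFrom_false _ _ _ _ (by rwa [length_wordOf])]

lemma runFrom_wordOf_of_le (hst : t ≤ s) :
    runFrom up down s init (wordOf x t) = init (wordOf x t) :=
  runFrom_of_length_le _ _ _ _ (by rwa [length_wordOf])

end Run

open WordLaw (numAfter climbState climbUp climbDown)

variable {x : ℕ → Option Bool} {s t : ℕ}

lemma numAfter_of_le (hst : t ≤ s) : numAfter s (wordOf x t) = 0 := runFrom_wordOf_of_le hst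

lemma numAfter_succ_none (h : x t = none) :
    numAfter s (wordOf x (t + 1)) = numAfter s (wordOf x t) := by
  rcases Nat.lt_or_ge t s with hst | hst
  · rw [numAfter_of_le hst, numAfter_of_le hst.le]
  · exact runFrom_wordOf_none hst h

lemma numAfter_succ_some (hst : s ≤ t) {b : Bool} (h : x t = some b) :
    numAfter s (wordOf x (t + 1)) = numAfter s (wordOf x t) + 1 := by
  rcases b with _ | _
  · exact runFrom_wordOf_false hst h
  · exact runFrom_wordOf_true hst h

lemma numAfter_le_succ (t : ℕ) :
    numAfter s (wordOf x t) ≤ numAfter s (wordOf x (t + 1)) := by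
  rcases h : x t with _ | b
  · exact (numAfter_succ_none h).ge
  · rcases Nat.lt_or_ge t s with hst | hst
    · rw [numAfter_of_le hst.le]; exact Nat.zero_le _
    · rw [numAfter_succ_some hst h]; exact Nat.le_succ _

lemma numAfter_mono : Monotone fun t => numAfter s (wordOf x t) :=
  monotone_nat_of_le_succ numAfter_le_succ

lemma walk_le_add_reach {a : ℕ} (h : a ≤ t) :
    walk (wordOf x a) ≤ walk (wordOf x t) + reach (wordOf x t) := by
  induction t, h using Nat.le_induction with
  | base => omega
  | succ t h ih =>
    rcases hx : x t with _ | _ | _ <;> simp only [wordOf, hx, walk, reach] <;> push_cast <;> omega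

/-- The climb automaton compares the walk with its values up to index `m`. -/
lemma climbState_spec (m : ℕ) (hst : s ≤ t) :
    (climbState m s (wordOf x t)).1 = numAfter s (wordOf x t) ∧
    (numAfter s (wordOf x t) ≤ m → (climbState m s (wordOf x t)).2.1 = reach (wordOf x t) ∧
      (climbState m s (wordOf x t)).2.2 = 0) ∧
    ∀ a ≤ t, numAfter s (wordOf x a) ≤ m → walk (wordOf x a) ≤ walk (wordOf x t) +
      (climbState m s (wordOf x t)).2.1 - (climbState m s (wordOf x t)).2.2 := by
  induction t, hst using Nat.le_induction with
  | base =>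
    rw [climbState, runFrom_wordOf_of_le le_rfl, numAfter_of_le le_rfl]
    refine ⟨rfl, fun _ => ⟨rfl, rfl⟩, fun a ha _ => ?_⟩
    have := walk_le_add_reach (x := x) ha
    simpa using this
  | succ t hst ih =>
    obtain ⟨h1, h2, h3⟩ := ih
    rcases hx : x t with _ | b
    · have e : climbState m s (wordOf x (t + 1)) = climbState m s (wordOf x t) :=
        runFrom_wordOf_none hst hx
      have e2 : walk (wordOf x (t + 1)) = walk (wordOf x t) := by rw [wordOf, hx, walk]
      rw [e, e2, numAfter_succ_none hx]
      refine ⟨h1, fun h => ?_, fun a ha ham => ?_⟩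
      · rw [wordOf, hx, reach]; exact h2 h
      · rcases Nat.lt_or_ge t a with hta | hta
        · obtain rfl : a = t + 1 := by omega
          rw [e2]
          rw [numAfter_succ_none hx] at ham
          exact h3 t le_rfl ham
        · exact h3 a hta ham
    · have hn := numAfter_succ_some hst hx
      rcases hz : climbState m s (wordOf x t) with ⟨j, d, y⟩
      rw [hz] at h1 h2 h3
      simp only at h1 h2 h3
      -- Up to index `m` the second component follows the reach; from then on it is frozen, and only
      -- the displacement moves.
      have e : climbState m s (wordOf x (t + 1)) = if j < m then
          (j + 1, reach (wordOf x (t + 1)), 0) else (j + 1, d, y + if b then 1 else -1) := by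
        rcases b with _ | _
        · have : climbState m s (wordOf x (t + 1)) = climbDown m (climbState m s (wordOf x t)) :=
            runFrom_wordOf_false hst hx
          rw [this, hz, climbDown]
          simp only
          split_ifs with hj
          · rw [wordOf, hx, reach, (h2 (by omega)).1]
          · simp at *
          · rfl
        · have : climbState m s (wordOf x (t + 1)) = climbUp m (climbState m s (wordOf x t)) :=
            runFrom_wordOf_true hst hx
          rw [this, hz, climbUp]
          simp only
          split_ifs with hj
          · rw [wordOf, hx, reach, (h2 (by omega)).1]
          · rfl
      have hw : walk (wordOf x (t + 1)) = walk (wordOf x t) + if b then 1 else -1 := by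
        rcases b with _ | _ <;> simp [wordOf, hx, walk, sub_eq_add_neg]
      rw [e, hn]
      by_cases hj : j < m
      · rw [if_pos hj]
        refine ⟨by simp only; omega, fun _ => ⟨rfl, rfl⟩, fun a ha _ => ?_⟩
        have := walk_le_add_reach (x := x) ha
        simpa using this
      · rw [if_neg hj]
        refine ⟨by simp only; omega, fun h => by omega, fun a ha ham => ?_⟩
        have hta : a ≤ t := by
          by_contra hta
          obtain rfl : a = t + 1 := by omega
          omega
        have := h3 a hta ham
        rw [hw]
        simp only
        omega

lemma stepsAfter_spec (hst : s ≤ t) :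
    (stepsAfter s (wordOf x t)).2.length = numAfter s (wordOf x t) ∧
      reachFrom (stepsAfter s (wordOf x t)).1 (stepsAfter s (wordOf x t)).2 =
        reach (wordOf x t) ∧ (stepsAfter s (wordOf x t)).1 = reach (wordOf x s) := by
  induction t, hst using Nat.le_induction with
  | base =>
    rw [stepsAfter, runFrom_wordOf_of_le le_rfl, numAfter_of_le le_rfl]
    exact ⟨rfl, rfl, rfl⟩
  | succ t hst ih =>
    obtain ⟨h1, h2, h3⟩ := ih
    rcases hx : x t with _ | _ | _
    · rw [stepsAfter, runFrom_wordOf_none hst hx, numAfter_succ_none hx, wordOf, hx, reach]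
      exact ⟨h1, h2, h3⟩
    · rw [stepsAfter, runFrom_wordOf_false hst hx, numAfter_succ_some hst hx, wordOf, hx, reach]
      rw [stepsAfter] at h1 h2 h3
      simp only [List.length_cons, reachFrom]
      exact ⟨by omega, by omega, h3⟩
    · rw [stepsAfter, runFrom_wordOf_true hst hx, numAfter_succ_some hst hx, wordOf, hx, reach]
      rw [stepsAfter] at h1 h2 h3
      simp only [List.length_cons, reachFrom]
      exact ⟨by omega, by omega, h3⟩

/-- A cut found by the automaton is a special slot that separates the walk. -/
lemma exists_cut_slot {c : ℕ} (hst : s ≤ t)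
    (h : 0 < cutHeight (stepsAfter s (wordOf x t)).1 c (stepsAfter s (wordOf x t)).2) :
    ∃ u, s ≤ u ∧ u < t ∧ x u = some true ∧ numAfter s (wordOf x u) = c ∧ reach (wordOf x u) = 0 ∧
      (∀ b, u < b → b ≤ t → walk (wordOf x u) < walk (wordOf x b)) ∧
      walk (wordOf x t) = walk (wordOf x u) +
        cutHeight (stepsAfter s (wordOf x t)).1 c (stepsAfter s (wordOf x t)).2 := by
  induction t, hst using Nat.le_induction with
  | base =>
    rw [stepsAfter, runFrom_wordOf_of_le le_rfl] at h
    simp [cutHeight] at h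
  | succ t hst ih =>
    obtain ⟨g1, g2, g3⟩ := stepsAfter_spec (x := x) hst
    -- As long as the cut height stays positive, the new position lies strictly above the starting
    -- level, so the separation extends by one slot.
    have extend : ∀ {z : ℤ}, 0 < z → (∃ u, s ≤ u ∧ u < t ∧ x u = some true ∧
        numAfter s (wordOf x u) = c ∧ reach (wordOf x u) = 0 ∧
        (∀ b, u < b → b ≤ t → walk (wordOf x u) < walk (wordOf x b)) ∧
        walk (wordOf x (t + 1)) = walk (wordOf x u) + z) →
        ∃ u, s ≤ u ∧ u < t + 1 ∧ x u = some true ∧ numAfter s (wordOf x u) = c ∧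
          reach (wordOf x u) = 0 ∧
          (∀ b, u < b → b ≤ t + 1 → walk (wordOf x u) < walk (wordOf x b)) ∧
          walk (wordOf x (t + 1)) = walk (wordOf x u) + z := by
      rintro z hz ⟨u, hu1, hu2, hu3, hu4, hu5, hu6, hu7⟩
      refine ⟨u, hu1, by omega, hu3, hu4, hu5, fun b hb hbt => ?_, hu7⟩
      rcases Nat.lt_or_ge t b with h1 | h1
      · obtain rfl : b = t + 1 := by omega
        omega
      · exact hu6 b hb h1
    rcases hx : x t with _ | b
    · have e : stepsAfter s (wordOf x (t + 1)) = stepsAfter s (wordOf x t) :=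
        runFrom_wordOf_none hst hx
      rw [e] at h ⊢
      refine extend (by exact_mod_cast h) ?_
      rw [show walk (wordOf x (t + 1)) = walk (wordOf x t) by rw [wordOf, hx, walk]]
      exact ih h
    · have e : stepsAfter s (wordOf x (t + 1)) =
          ((stepsAfter s (wordOf x t)).1, b :: (stepsAfter s (wordOf x t)).2) := by
        rcases b with _ | _
        · exact runFrom_wordOf_false hst hx
        · exact runFrom_wordOf_true hst hx
      have hw : walk (wordOf x (t + 1)) = walk (wordOf x t) + if b then 1 else -1 := by
        rcases b with _ | _ <;> simp [wordOf, hx, walk, sub_eq_add_neg]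
      rw [e] at h ⊢
      set R := (stepsAfter s (wordOf x t)).1
      set w := (stepsAfter s (wordOf x t)).2
      by_cases hc : w.length = c
      · by_cases hb : b = true ∧ reachFrom R w = 0
        · have hval : cutHeight R c (b :: w) = 1 := by rw [cutHeight, if_pos hc, if_pos hb]
          rw [hval]
          refine ⟨t, hst, by omega, by rw [hx, hb.1], by omega, by omega, fun b' h1 h2 => ?_, ?_⟩
          · obtain rfl : b' = t + 1 := by omega
            rw [hw, hb.1]; simp
          · rw [hw, hb.1]; simp
        · rw [cutHeight, if_pos hc, if_neg hb] at h
          omega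
      · by_cases h0 : cutHeight R c w = 0
        · rw [cutHeight, if_neg hc, if_pos h0] at h
          omega
        · have hval : (cutHeight R c (b :: w) : ℤ) = cutHeight R c w + if b then 1 else -1 := by
            rw [cutHeight, if_neg hc, if_neg h0]
            rcases b with _ | _ <;> (simp; try omega)
          refine extend (by exact_mod_cast h) ?_
          obtain ⟨u, hu1, hu2, hu3, hu4, hu5, hu6, hu7⟩ := ih (by omega)
          exact ⟨u, hu1, hu2, hu3, hu4, hu5, hu6, by rw [hw, hval, hu7]; ring⟩

/-- If the walk is not cut-free, then it has a cut. -/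
lemma exists_cut {n : ℕ} (hst : s ≤ t) (hn : n ≤ numAfter s (wordOf x t))
    (h : ¬ CutFree n (stepsAfter s (wordOf x t))) :
    ∃ u, s ≤ u ∧ u < t ∧ x u = some true ∧ numAfter s (wordOf x u) < n ∧
      ∀ a b, a ≤ u → u < b → b ≤ t → walk (wordOf x a) < walk (wordOf x b) := by
  rw [CutFree, (stepsAfter_spec hst).1] at h
  push Not at h
  obtain ⟨c, hc, hpos⟩ := h hn
  obtain ⟨u, hu1, hu2, hu3, hu4, hu5, hu6, -⟩ := exists_cut_slot hst (Nat.pos_of_ne_zero hpos)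
  refine ⟨u, hu1, hu2, hu3, by omega, fun a b ha hub hbt => ?_⟩
  have := walk_le_add_reach (x := x) ha
  have := hu6 b hub hbt
  omega

end LongestChain

end

noncomputable section

namespace LongestChain

/-! ### Slot types of a leader election

Leader sets are listed with the most recent slot first.  The delays `δ (u, h, h')` belong to
messages sent in slot `u + 1`. -/

section Types

variable {H : Type*}

open Classical in
/-- The unique leader of a slot, if there is one and it is honest. -/
def soleLeader (S : Finset (Option H)) : Option H :=
  if h : ∃ a, S = {some a} then some h.choose else none

lemma soleLeader_eq_some {S : Finset (Option H)} {h : H} :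
    soleLeader S = some h ↔ S = {some h} := by
  rw [soleLeader]
  split_ifs with hS
  · have := hS.choose_spec
    constructor
    · intro heq
      rw [this]
      simpa using heq
    · intro heq
      have := heq.symm.trans this
      simpa using this.symm
  · simp only [false_iff]
    exact fun h' => hS ⟨h, h'⟩

/-- The last special slot, with its leader; the slot number is reduced by one. -/
def lastSpecial : List (Finset (Option H)) → List (Option Bool) → Option (ℕ × H)
  | S :: ℓ, some true :: w =>
    match soleLeader S with
    | some h => some (ℓ.length, h)
    | none => lastSpecial ℓ w
  | _ :: ℓ, _ :: w => lastSpecial ℓ w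
  | _, _ => none

/-- The message of the last special slot, if any, reaches `h` before the coming slot. -/
def Heard (δ : ℕ × H × H → ℕ∞) (ℓ : List (Finset (Option H))) (w : List (Option Bool)) (h : H) :
    Prop :=
  ∀ u hv, lastSpecial ℓ w = some (u, hv) → δ (u, hv, h) < ((ℓ.length - u : ℕ) : ℕ∞)

open Classical in
/-- The type of a slot with leaders `S` after slots with leaders `ℓ` and types `w`. -/
def slotType (δ : ℕ × H × H → ℕ∞) (ℓ : List (Finset (Option H))) (w : List (Option Bool))
    (S : Finset (Option H)) : Option Bool :=
  if S = ∅ then none else some (decide (∃ h, S = {some h} ∧ Heard δ ℓ w h))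

/-- The types of the slots with leaders `ℓ`. -/
def slotTypes (δ : ℕ × H × H → ℕ∞) : List (Finset (Option H)) → List (Option Bool)
  | [] => []
  | S :: ℓ => slotType δ ℓ (slotTypes δ ℓ) S :: slotTypes δ ℓ

variable {δ δ' : ℕ × H × H → ℕ∞} {ℓ : List (Finset (Option H))} {w : List (Option Bool)}
  {S : Finset (Option H)} {h : H}

lemma slotTypes_cons_eq {l : Option Bool} :
    slotTypes δ (S :: ℓ) = l :: w ↔ slotType δ ℓ w S = l ∧ slotTypes δ ℓ = w := by
  rw [slotTypes, List.cons.injEq]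
  constructor
  · rintro ⟨h1, rfl⟩; exact ⟨h1, rfl⟩
  · rintro ⟨h1, rfl⟩; exact ⟨h1, rfl⟩

lemma slotType_eq_none : slotType δ ℓ w S = none ↔ S = ∅ := by
  rw [slotType]; split_ifs with h <;> simp [h]

lemma slotType_eq_true :
    slotType δ ℓ w S = some true ↔ ∃ h, S = {some h} ∧ Heard δ ℓ w h := by
  rw [slotType]
  split_ifs with h0
  · simp only [false_iff]
    rintro ⟨h, rfl, -⟩
    exact absurd h0 (Finset.singleton_ne_empty _)
  · simp

lemma slotType_eq_false :
    slotType δ ℓ w S = some false ↔ S ≠ ∅ ∧ ∀ h, S = {some h} → ¬ Heard δ ℓ w h := by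
  rw [slotType]
  split_ifs with h0
  · simp [h0]
  · simp [h0]

lemma lastSpecial_lt {u : ℕ} {hv : H} (h : lastSpecial ℓ w = some (u, hv)) : u < ℓ.length := by
  induction ℓ generalizing w with
  | nil => rcases w with _ | ⟨_ | _ | _, w⟩ <;> simp [lastSpecial] at h
  | cons S ℓ ih =>
    rcases w with _ | ⟨_ | _ | _, w⟩
    · simp [lastSpecial] at h
    · simp only [lastSpecial] at h; have := ih h; simp; omega
    · simp only [lastSpecial] at h; have := ih h; simp; omega
    · simp only [lastSpecial] at h
      rcases hS : soleLeader S with _ | a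
      · rw [hS] at h; have := ih h; simp; omega
      · rw [hS] at h
        simp only [Option.some.injEq, Prod.mk.injEq] at h
        simp; omega

lemma heard_congr (hag : ∀ y : ℕ × H × H, y.1 < ℓ.length → δ y = δ' y) :
    Heard δ ℓ w h ↔ Heard δ' ℓ w h := by
  constructor
  · intro hh u hv hu
    rw [← hag _ (lastSpecial_lt hu)]; exact hh u hv hu
  · intro hh u hv hu
    rw [hag _ (lastSpecial_lt hu)]; exact hh u hv hu

lemma slotType_congr (hag : ∀ y : ℕ × H × H, y.1 < ℓ.length → δ y = δ' y) :
    slotType δ ℓ w S = slotType δ' ℓ w S := by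
  have : (∃ h, S = {some h} ∧ Heard δ ℓ w h) ↔ ∃ h, S = {some h} ∧ Heard δ' ℓ w h :=
    exists_congr fun h => and_congr_right fun _ => heard_congr hag
  rw [slotType, slotType, decide_eq_decide.mpr this]

/-- The types do not depend on the delays of messages sent in the last non-empty slot. -/
lemma slotTypes_congr
    (hag : ∀ y : ℕ × H × H, y.1 + gap (slotTypes δ ℓ) + 1 < ℓ.length → δ y = δ' y) :
    slotTypes δ ℓ = slotTypes δ' ℓ := by
  induction ℓ with
  | nil => rfl
  | cons S ℓ ih =>
    by_cases hS : S = ∅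
    · have e : ∀ δ : ℕ × H × H → ℕ∞, slotTypes δ (S :: ℓ) = none :: slotTypes δ ℓ := fun δ =>
        slotTypes_cons_eq.mpr ⟨slotType_eq_none.mpr hS, rfl⟩
      rw [e, e, ih]
      intro y hy
      apply hag
      rw [e]
      simp only [gap, List.length_cons]
      omega
    · have hg : gap (slotTypes δ (S :: ℓ)) = 0 := by
        rw [slotTypes]
        rcases hx : slotType δ ℓ (slotTypes δ ℓ) S with _ | b
        · exact absurd (slotType_eq_none.mp hx) hS
        · rfl
      rw [hg] at hag
      simp only [List.length_cons, add_zero, Nat.add_lt_add_iff_right] at hag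
      have h1 := ih fun y hy => hag y (by omega)
      rw [slotTypes, slotTypes, ← h1, slotType_congr hag]

/-- The last non-empty slot is special. -/
def EndsSpecial : List (Option Bool) → Prop
  | [] => False
  | none :: w => EndsSpecial w
  | some b :: _ => b = true

lemma EndsSpecial.lastSpecial (hw : EndsSpecial w) (hδ : slotTypes δ ℓ = w) :
    ∃ u hv, lastSpecial ℓ w = some (u, hv) ∧ u + gap w + 1 = ℓ.length := by
  induction ℓ generalizing w with
  | nil => subst hδ; simp [slotTypes, EndsSpecial] at hw
  | cons S ℓ ih =>
    rcases w with _ | ⟨_ | _ | _, w⟩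
    · simp [EndsSpecial] at hw
    · obtain ⟨u, hv, h1, h2⟩ := ih (w := w) hw (slotTypes_cons_eq.mp hδ).2
      exact ⟨u, hv, h1, by simp only [gap, List.length_cons]; omega⟩
    · simp [EndsSpecial] at hw
    · obtain ⟨h, hS, -⟩ := slotType_eq_true.mp (slotTypes_cons_eq.mp hδ).1
      refine ⟨ℓ.length, h, ?_, by simp [gap]⟩
      simp only [LongestChain.lastSpecial, soleLeader_eq_some.mpr hS]

open Classical in
/-- The delay of the message from the last special slot to `h` enters the types through a lower
bound only. -/
lemma slotTypes_eq_iff {u : ℕ} {hv : H} (hu : lastSpecial ℓ w = some (u, hv)) (h : H) :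
    ∃ c : ℕ, c + gap w + 1 ≤ ℓ.length - u ∧ (c = 0 ∨ ∃ S ∈ ℓ, some h ∈ S) ∧
      ∀ δ : ℕ × H × H → ℕ∞, slotTypes δ ℓ = w ↔ (c : ℕ∞) ≤ δ (u, hv, h) ∧
        slotTypes (Function.update δ (u, hv, h) ⊤) ℓ = w := by
  induction ℓ generalizing w with
  | nil => rcases w with _ | ⟨_ | _ | _, w⟩ <;> simp [lastSpecial] at hu
  | cons S ℓ ih =>
    rcases w with _ | ⟨_ | _ | _, w⟩
    · simp [lastSpecial] at hu
    · simp only [lastSpecial] at hu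
      have hlt := lastSpecial_lt hu
      obtain ⟨c, h1, h2, h3⟩ := ih hu
      refine ⟨c, by simp only [gap, List.length_cons]; omega, ?_, fun δ => ?_⟩
      · rcases h2 with h2 | ⟨S', h2, h2'⟩
        · exact Or.inl h2
        · exact Or.inr ⟨S', List.mem_cons_of_mem _ h2, h2'⟩
      · rw [slotTypes_cons_eq, slotTypes_cons_eq, slotType_eq_none, slotType_eq_none, h3]
        tauto
    · simp only [lastSpecial] at hu
      have hlt := lastSpecial_lt hu
      obtain ⟨c, h1, h2, h3⟩ := ih hu
      have hheard : ∀ (δ : ℕ × H × H → ℕ∞) a, Heard δ ℓ w a ↔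
          δ (u, hv, a) < ((ℓ.length - u : ℕ) : ℕ∞) := fun δ a => by
        refine ⟨fun hh => hh u hv hu, fun hh u' hv' hu' => ?_⟩
        rw [hu] at hu'
        simp only [Option.some.injEq, Prod.mk.injEq] at hu'
        rw [← hu'.1, ← hu'.2]; exact hh
      -- A non-special slot led by `h` alone says that the message had not arrived by then. This is
      -- a stronger lower bound than any earlier one, hence the new `c`. Other leaders' failures
      -- concern different delays.
      by_cases hS : S = {some h}
      · refine ⟨ℓ.length - u, by simp only [gap, List.length_cons]; omega,
          Or.inr ⟨S, List.mem_cons_self, by simp [hS]⟩, fun δ => ?_⟩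
        have e : ∀ δ : ℕ × H × H → ℕ∞, slotType δ ℓ w S = some false ↔
            ((ℓ.length - u : ℕ) : ℕ∞) ≤ δ (u, hv, h) := fun δ => by
          rw [slotType_eq_false, hS]
          simp only [ne_eq, Finset.singleton_ne_empty, not_false_eq_true, true_and,
            Finset.singleton_inj, Option.some.injEq, forall_eq', hheard, not_lt]
        rw [slotTypes_cons_eq, slotTypes_cons_eq, e, e, h3, Function.update_self]
        simp only [le_top, true_and]
        constructor
        · tauto
        · rintro ⟨h4, h5⟩
          exact ⟨h4, le_trans (by exact_mod_cast (by omega)) h4, h5⟩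
      · refine ⟨c, by simp only [gap, List.length_cons] at h1 ⊢; omega, ?_, fun δ => ?_⟩
        · rcases h2 with h2 | ⟨S', h2, h2'⟩
          · exact Or.inl h2
          · exact Or.inr ⟨S', List.mem_cons_of_mem _ h2, h2'⟩
        · have e : slotType δ ℓ w S = some false ↔
              slotType (Function.update δ (u, hv, h) ⊤) ℓ w S = some false := by
            rw [slotType_eq_false, slotType_eq_false]
            refine and_congr_right fun _ => forall_congr' fun a => ?_
            refine imp_congr_right fun ha => ?_
            rw [hheard, hheard, Function.update_of_ne]
            rintro heq
            simp only [Prod.mk.injEq, true_and] at heq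
            exact hS (by rw [ha, heq])
          rw [slotTypes_cons_eq, slotTypes_cons_eq, e, h3]
          tauto
    · rcases hS : soleLeader S with _ | a
      · simp only [lastSpecial, hS] at hu
        have hlt := lastSpecial_lt hu
        refine ⟨0, by have := (ih hu).choose_spec.1; simp only [gap, List.length_cons]; omega,
          Or.inl rfl, fun δ => ?_⟩
        -- A slot without a sole honest leader cannot be special, so this word never occurs and the
        -- equivalence is vacuous.
        have hfalse : ∀ δ : ℕ × H × H → ℕ∞, slotTypes δ (S :: ℓ) ≠ some true :: w := fun δ heq => by
          obtain ⟨b, hb, -⟩ := slotType_eq_true.mp (slotTypes_cons_eq.mp heq).1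
          rw [soleLeader_eq_some.mpr hb] at hS
          simp at hS
        simp [hfalse]
      · simp only [lastSpecial, hS, Option.some.injEq, Prod.mk.injEq] at hu
        obtain ⟨rfl, rfl⟩ := hu
        refine ⟨0, by simp [gap], Or.inl rfl, fun δ => ?_⟩
        have hS' : S ≠ ∅ := by
          rw [soleLeader_eq_some.mp hS]; exact Finset.singleton_ne_empty _
        -- The message is sent in this very slot, so the types so far do not involve its delay.
        have hag : ∀ δ' : ℕ × H × H → ℕ∞, (∀ y : ℕ × H × H, y.1 < ℓ.length → δ y = δ' y) →
            slotTypes δ (S :: ℓ) = slotTypes δ' (S :: ℓ) := fun δ' h' =>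
          slotTypes_congr fun y hy => h' y (by simp only [List.length_cons] at hy; omega)
        rw [hag (Function.update δ (ℓ.length, a, h) ⊤) fun y hy => by
          rw [Function.update_of_ne]; rintro rfl; simp at hy]
        simp

/-! ### Observers -/

/-- The number of special slots after slot `s`. -/
def specialsAfter (s : ℕ) : List (Option Bool) → ℕ := runFrom Nat.succ id s fun _ => 0

/-- Whether the special slots after `s` with rank in `(lo, hi]` remain unheard of by `o` until
the next non-empty slot. -/
def Unheard (δ : ℕ × H × H → ℕ∞) (o : H) (s lo hi : ℕ) :
    List (Finset (Option H)) → List (Option Bool) → Prop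
  | S :: ℓ, _ :: w => Unheard δ o s lo hi ℓ w ∧ (S ≠ ∅ → EndsSpecial w → lo < specialsAfter s w →
      specialsAfter s w ≤ hi → ¬ Heard δ ℓ w o)
  | _, _ => True

/-- Whether the observer misses the latest non-empty slot's message is tested only at the next
non-empty slot. The delays of that latest slot are hence still fresh, just as for the types
themselves. -/
lemma unheard_congr {o : H} {s lo hi : ℕ} (hδ : slotTypes δ ℓ = w)
    (hag : ∀ y : ℕ × H × H, y.1 + gap w + 1 < ℓ.length → δ y = δ' y) :
    Unheard δ o s lo hi ℓ w ↔ Unheard δ' o s lo hi ℓ w := by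
  induction ℓ generalizing w with
  | nil => simp [Unheard]
  | cons S ℓ ih =>
    rcases w with _ | ⟨l, w⟩
    · simp [Unheard]
    obtain ⟨hl, hw⟩ := slotTypes_cons_eq.mp hδ
    simp only [Unheard]
    rcases l with _ | b
    · have hS := slotType_eq_none.mp hl
      rw [ih hw fun y hy => hag y (by simp only [gap, List.length_cons]; omega)]
      simp [hS]
    · simp only [gap, List.length_cons, add_zero, Nat.add_lt_add_iff_right] at hag
      rw [ih hw fun y hy => hag y (by omega), heard_congr hag]

end Types

end LongestChain

end

noncomputable section

namespace LongestChain

variable {Ω : Type*} {H : Type*}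

/-! ### Decomposition of events along discrete random variables -/

section Fibers

variable [MeasurableSpace Ω]

/-- The measure of an event, computed along the fibers of a discrete random variable. -/
lemma measure_eq_tsum_fibers {ι : Type*} {R : Set ι} (hR : R.Countable) (P : Measure Ω)
    {Z : Ω → ι} (hZR : ∀ ω, Z ω ∈ R) (hZ : ∀ i, MeasurableSet {ω | Z ω = i}) (B : Set Ω) :
    P B = ∑' i : R, P (B ∩ {ω | Z ω = i}) := by
  have := hR.to_subtype
  calc P B = P.restrict B (⋃ i : R, {ω | Z ω = i}) := by
        rw [show (⋃ i : R, {ω | Z ω = (i : ι)}) = Set.univ from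
          Set.eq_univ_of_forall fun ω => Set.mem_iUnion.mpr ⟨⟨Z ω, hZR ω⟩, rfl⟩,
          Measure.restrict_apply_univ]
    _ = ∑' i : R, P.restrict B {ω | Z ω = i} := by
        refine measure_iUnion (fun i j hij => ?_) fun i => hZ i
        rw [Function.onFun, Set.disjoint_left]
        intro ω h1 h2
        exact hij (Subtype.ext ((show Z ω = i from h1).symm.trans h2))
    _ = _ := tsum_congr fun i => by rw [Measure.restrict_apply (hZ i), Set.inter_comm]

lemma mul_measure_le_of_fibers {ι : Type*} {R : Set ι} (hR : R.Countable) (P : Measure Ω)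
    {Z : Ω → ι} (hZR : ∀ ω, Z ω ∈ R) (hZ : ∀ i, MeasurableSet {ω | Z ω = i}) {A B : Set Ω}
    {c d : ℝ≥0∞} (h : ∀ i, c * P (A ∩ {ω | Z ω = i}) ≤ d * P (B ∩ {ω | Z ω = i})) :
    c * P A ≤ d * P B := by
  rw [measure_eq_tsum_fibers hR P hZR hZ A, measure_eq_tsum_fibers hR P hZR hZ B,
    ← ENNReal.tsum_mul_left, ← ENNReal.tsum_mul_left]
  exact ENNReal.tsum_le_tsum fun i => h i

end Fibers

/-! ### Leader histories -/

/-- The leader sets of the slots up to `t`, the most recent one first. -/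
def leaderHist (L : ℕ → Ω → Finset (Option H)) : ℕ → Ω → List (Finset (Option H))
  | 0, _ => []
  | t + 1, ω => L (t + 1) ω :: leaderHist L t ω

/-- All delays as one random function. -/
def delays (D : ℕ → H → H → Ω → ℕ∞) (ω : Ω) (y : ℕ × H × H) : ℕ∞ := D (y.1 + 1) y.2.1 y.2.2 ω

/-- The types of the slots up to `t`. -/
def typesUpTo (L : ℕ → Ω → Finset (Option H)) (D : ℕ → H → H → Ω → ℕ∞) (t : ℕ) (ω : Ω) :
    List (Option Bool) :=
  slotTypes (delays D ω) (leaderHist L t ω)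

/-- Lists of finite subsets of `K`. -/
def listsIn (K : Set (Option H)) : Set (List (Finset (Option H))) :=
  {ℓ | ∀ S ∈ ℓ, ∀ a ∈ S, a ∈ K}

lemma countable_listsIn {K : Set (Option H)} (hK : K.Countable) : (listsIn K).Countable := by
  classical
  have := hK.to_subtype
  refine (Set.countable_range fun ℓ : List (Finset K) =>
    ℓ.map fun S => S.map (Function.Embedding.subtype _)).mono fun ℓ hℓ => ?_
  refine ⟨ℓ.map fun S => S.subtype (· ∈ K), ?_⟩
  simp only [List.map_map]
  conv_rhs => rw [← List.map_id ℓ]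
  exact List.map_congr_left fun S hS => Finset.subtype_map_of_mem fun a ha => hℓ S hS a ha

section Hist

variable {L : ℕ → Ω → Finset (Option H)} {K : Set (Option H)}

lemma length_leaderHist (t : ℕ) (ω : Ω) : (leaderHist L t ω).length = t := by
  induction t with
  | zero => rfl
  | succ t ih => simp [leaderHist, ih]

lemma leaderHist_mem (hL : ∀ t ω, ∀ a ∈ L (t + 1) ω, a ∈ K) (t : ℕ) (ω : Ω) :
    leaderHist L t ω ∈ listsIn K := by
  induction t with
  | zero => simp [leaderHist, listsIn]
  | succ t ih =>
    intro S hS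
    rw [leaderHist, List.mem_cons] at hS
    rcases hS with rfl | hS
    · exact hL t ω
    · exact ih S hS

/-- All leaders come from a countable set, so equality with a given finite set is a countable
conjunction of membership events. The σ-algebra is left free, in order that independence can be
applied to the one generated by the election. -/
lemma measurableSet_leaderHist_eq (M : MeasurableSpace Ω) (hK : K.Countable)
    (hL : ∀ t ω, ∀ a ∈ L (t + 1) ω, a ∈ K) (t : ℕ)
    (hM : ∀ u < t, ∀ a, MeasurableSet[M] {ω | a ∈ L (u + 1) ω}) (ℓ : List (Finset (Option H))) :
    MeasurableSet[M] {ω | leaderHist L t ω = ℓ} := by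
  induction t generalizing ℓ with
  | zero => simp only [leaderHist]; exact MeasurableSet.const _
  | succ t ih =>
    classical
    rcases ℓ with _ | ⟨S, ℓ⟩
    · simp [leaderHist]
    · have e : {ω | leaderHist L (t + 1) ω = S :: ℓ} =
          {ω | L (t + 1) ω = S} ∩ {ω | leaderHist L t ω = ℓ} := by
        ext ω; simp [leaderHist]
      rw [e]
      refine MeasurableSet.inter ?_ (ih (fun u hu => hM u (by omega)) ℓ)
      by_cases hS : ∀ a ∈ S, a ∈ K
      · have e2 : {ω | L (t + 1) ω = S} =
            ⋂ a ∈ K, if a ∈ S then {ω | a ∈ L (t + 1) ω} else {ω | a ∈ L (t + 1) ω}ᶜ := by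
          ext ω
          simp only [Set.mem_ofPred_eq, Set.mem_iInter]
          constructor
          · rintro rfl a _
            split_ifs with h
            · exact h
            · exact h
          · intro h
            ext a
            by_cases ha : a ∈ K
            · have := h a ha
              split_ifs at this with h2
              · exact ⟨fun _ => h2, fun _ => this⟩
              · exact ⟨fun h3 => absurd h3 this, fun h3 => absurd h3 h2⟩
            · exact ⟨fun h3 => absurd (hL t ω a h3) ha, fun h3 => absurd (hS a h3) ha⟩
        rw [e2]
        refine MeasurableSet.biInter hK fun a _ => ?_
        split_ifs
        · exact hM t (by omega) a
        · exact (hM t (by omega) a).compl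
      · convert @MeasurableSet.empty _ M
        rw [Set.eq_empty_iff_forall_notMem]
        rintro ω rfl
        exact hS (hL t ω)

lemma measurableSet_leaderHist_mem (M : MeasurableSpace Ω) (hK : K.Countable)
    (hL : ∀ t ω, ∀ a ∈ L (t + 1) ω, a ∈ K) (t : ℕ)
    (hM : ∀ u < t, ∀ a, MeasurableSet[M] {ω | a ∈ L (u + 1) ω})
    (A : Set (List (Finset (Option H)))) : MeasurableSet[M] {ω | leaderHist L t ω ∈ A} := by
  have e : {ω | leaderHist L t ω ∈ A} = ⋃ ℓ ∈ A ∩ listsIn K, {ω | leaderHist L t ω = ℓ} := by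
    ext ω
    simp only [Set.mem_ofPred_eq, Set.mem_iUnion, exists_prop, exists_eq_right', Set.mem_inter_iff,
      leaderHist_mem hL t ω, and_true]
  rw [e]
  exact MeasurableSet.biUnion ((countable_listsIn hK).mono Set.inter_subset_right) fun ℓ _ =>
    measurableSet_leaderHist_eq M hK hL t hM ℓ

end Hist

/-! ### Measurability in the delays -/

lemma measurableSet_heard (ℓ : List (Finset (Option H))) (w : List (Option Bool)) (h : H) :
    MeasurableSet {δ : ℕ × H × H → ℕ∞ | Heard δ ℓ w h} := by
  rcases hl : lastSpecial ℓ w with _ | ⟨u, hv⟩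
  · simp [Heard, hl]
  · have e : {δ : ℕ × H × H → ℕ∞ | Heard δ ℓ w h} =
        (fun δ => δ (u, hv, h)) ⁻¹' {d | d < ((ℓ.length - u : ℕ) : ℕ∞)} := by
      ext δ
      simp only [Heard, hl, Option.some.injEq, Prod.mk.injEq, Set.mem_ofPred_eq, Set.mem_preimage]
      constructor
      · intro h'; exact h' u hv ⟨rfl, rfl⟩
      · rintro h' _ _ ⟨rfl, rfl⟩; exact h'
    rw [e]
    exact measurable_pi_apply _ (MeasurableSet.of_discrete)

lemma measurableSet_slotTypes (ℓ : List (Finset (Option H))) (w : List (Option Bool)) :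
    MeasurableSet {δ : ℕ × H × H → ℕ∞ | slotTypes δ ℓ = w} := by
  induction ℓ generalizing w with
  | nil => simp only [slotTypes]; exact MeasurableSet.const _
  | cons S ℓ ih =>
    rcases w with _ | ⟨l, w⟩
    · simp [slotTypes]
    · have e : {δ : ℕ × H × H → ℕ∞ | slotTypes δ (S :: ℓ) = l :: w} =
          {δ | slotType δ ℓ w S = l} ∩ {δ | slotTypes δ ℓ = w} := by
        ext δ; exact slotTypes_cons_eq
      rw [e]
      refine MeasurableSet.inter ?_ (ih w)
      rcases l with _ | _ | _
      · simp only [slotType_eq_none]; exact MeasurableSet.const _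
      · simp only [slotType_eq_false]
        by_cases hS : ∃ h, S = {some h}
        · obtain ⟨h, rfl⟩ := hS
          have e : {δ : ℕ × H × H → ℕ∞ | ({some h} : Finset (Option H)) ≠ ∅ ∧
              ∀ a, ({some h} : Finset (Option H)) = {some a} → ¬ Heard δ ℓ w a} =
              {δ | Heard δ ℓ w h}ᶜ := by
            ext δ; simp
          rw [e]
          exact (measurableSet_heard ℓ w h).compl
        · push Not at hS
          simp only [hS, false_imp_iff, imp_true_iff, and_true]
          exact MeasurableSet.const _
      · simp only [slotType_eq_true]
        by_cases hS : ∃ h, S = {some h}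
        · obtain ⟨h, rfl⟩ := hS
          have e : {δ : ℕ × H × H → ℕ∞ | ∃ a, ({some h} : Finset (Option H)) = {some a} ∧
              Heard δ ℓ w a} = {δ | Heard δ ℓ w h} := by
            ext δ; simp
          rw [e]
          exact measurableSet_heard ℓ w h
        · push Not at hS
          simp [hS]

lemma measurableSet_unheard (o : H) (s lo hi : ℕ) (ℓ : List (Finset (Option H)))
    (w : List (Option Bool)) :
    MeasurableSet {δ : ℕ × H × H → ℕ∞ | Unheard δ o s lo hi ℓ w} := by
  induction ℓ generalizing w with
  | nil => simp [Unheard]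
  | cons S ℓ ih =>
    rcases w with _ | ⟨l, w⟩
    · simp [Unheard]
    · simp only [Unheard, Set.ofPred_and]
      refine MeasurableSet.inter (ih w) ?_
      by_cases h : S ≠ ∅ ∧ EndsSpecial w ∧ lo < specialsAfter s w ∧ specialsAfter s w ≤ hi
      · have e : {δ : ℕ × H × H → ℕ∞ | S ≠ ∅ → EndsSpecial w → lo < specialsAfter s w →
            specialsAfter s w ≤ hi → ¬ Heard δ ℓ w o} = {δ | Heard δ ℓ w o}ᶜ := by
          ext δ
          simp only [Set.mem_ofPred_eq, Set.mem_compl_iff]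
          tauto
        rw [e]
        exact (measurableSet_heard ℓ w o).compl
      · have e : {δ : ℕ × H × H → ℕ∞ | S ≠ ∅ → EndsSpecial w → lo < specialsAfter s w →
            specialsAfter s w ≤ hi → ¬ Heard δ ℓ w o} = Set.univ := by
          ext δ
          simp only [Set.mem_ofPred_eq, Set.mem_univ, iff_true]
          tauto
        rw [e]
        exact MeasurableSet.univ

/-! ### The law of the leaders and the delays -/

/-- What the two leader models have in common: given the past, a slot is non-empty with
probability `f` and has a sole honest leader with probability `f α`, and conditioning the delay of
a message to this leader on a lower bound `c` does no harm. -/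
structure LeaderLaw [MeasurableSpace Ω] (P : Measure Ω) (L : ℕ → Ω → Finset (Option H))
    (ν : Measure ℕ∞) (f α : ℝ)
    (K : Set (Option H)) : Prop where
  countable : K.Countable
  subset : ∀ t ω, ∀ a ∈ L (t + 1) ω, a ∈ K
  meas : ∀ t a, MeasurableSet {ω | a ∈ L (t + 1) ω}
  nonempty : ∀ t ℓ, P ({ω | leaderHist L t ω = ℓ} ∩ {ω | L (t + 1) ω ≠ ∅}) =
    ENNReal.ofReal f * P {ω | leaderHist L t ω = ℓ}
  sole : ∀ t ℓ, P ({ω | leaderHist L t ω = ℓ} ∩ {ω | ∃ h, L (t + 1) ω = {some h}}) =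
    ENNReal.ofReal (f * α) * P {ω | leaderHist L t ω = ℓ}
  survive : ∀ t ω h c m, L (t + 1) ω = {some h} →
    (c = 0 ∨ ∃ S ∈ leaderHist L t ω, some h ∈ S) →
    ν {d | ((c + m : ℕ) : ℕ∞) ≤ d} ≤ ν {d | (c : ℕ∞) ≤ d} * ν {d | (m : ℕ∞) ≤ d}

section Law

variable [MeasurableSpace Ω] {P : Measure Ω} {L : ℕ → Ω → Finset (Option H)} {D : ℕ → H → H → Ω → ℕ∞}
  {ν : Measure ℕ∞} {f α : ℝ} {K : Set (Option H)}

lemma measurable_delays (hD : IIDDelays P D ν) : Measurable (delays D) :=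
  measurable_pi_iff.mpr fun y => hD.measurable y.1 y.2.1 y.2.2

lemma LeaderLaw.measurableSet_hist (hL : LeaderLaw P L ν f α K) (t : ℕ)
    (ℓ : List (Finset (Option H))) : MeasurableSet {ω | leaderHist L t ω = ℓ} :=
  measurableSet_leaderHist_eq _ hL.countable hL.subset t (fun u _ => hL.meas u) ℓ

/-- The history event is measurable with respect to the leader process alone, which is independent
of the delays as a whole. -/
lemma LeaderLaw.measure_hist_delays (hL : LeaderLaw P L ν f α K)
    (hLD : LeadersIndepDelays P L D) (t : ℕ) (A : Set (List (Finset (Option H))))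
    {B : Set (ℕ × H × H → ℕ∞)} (hB : MeasurableSet B) :
    P ({ω | leaderHist L t ω ∈ A} ∩ {ω | delays D ω ∈ B}) =
      P {ω | leaderHist L t ω ∈ A} * P {ω | delays D ω ∈ B} := by
  have hA := measurableSet_leaderHist_mem
    (MeasurableSpace.comap (fun ω (t : ℕ) => L (t + 1) ω) MeasurableSpace.pi) hL.countable hL.subset
    t (fun u _ a => ⟨(fun g => g u) ⁻¹' {S | a ∈ S},
      measurable_pi_apply u (measurableSet_mem_finset a), rfl⟩) A
  obtain ⟨A', hA', hAA'⟩ := hA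
  rw [← hAA']
  exact hLD.measure_inter_preimage_eq_mul _ _ hA' hB

/-- An event that concerns the past is independent of properties of the next leader set. -/
lemma LeaderLaw.measure_past_inter (hL : LeaderLaw P L ν f α K) (hLD : LeadersIndepDelays P L D)
    (t : ℕ) {U : Set (Finset (Option H))} {c : ℝ≥0∞}
    (hU : ∀ ℓ, P ({ω | leaderHist L t ω = ℓ} ∩ {ω | L (t + 1) ω ∈ U}) =
      c * P {ω | leaderHist L t ω = ℓ})
    {B : List (Finset (Option H)) → Set (ℕ × H × H → ℕ∞)} (hB : ∀ ℓ, MeasurableSet (B ℓ)) :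
    P ({ω | delays D ω ∈ B (leaderHist L t ω)} ∩ {ω | L (t + 1) ω ∈ U}) =
      c * P {ω | delays D ω ∈ B (leaderHist L t ω)} := by
  have hR := countable_listsIn hL.countable
  rw [measure_eq_tsum_fibers hR P (leaderHist_mem hL.subset t) (hL.measurableSet_hist t)
    {ω | delays D ω ∈ B (leaderHist L t ω)}, measure_eq_tsum_fibers hR P
    (leaderHist_mem hL.subset t) (hL.measurableSet_hist t), ← ENNReal.tsum_mul_left]
  refine tsum_congr fun ℓ => ?_
  have e1 : {ω | delays D ω ∈ B (leaderHist L t ω)} ∩ {ω | L (t + 1) ω ∈ U} ∩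
      {ω | leaderHist L t ω = ℓ} =
      {ω | leaderHist L (t + 1) ω ∈ {ℓ' | ∃ S ∈ U, ℓ' = S :: ℓ.1}} ∩ {ω | delays D ω ∈ B ℓ} := by
    ext ω
    simp only [Set.mem_inter_iff, Set.mem_ofPred_eq, leaderHist, List.cons.injEq]
    constructor
    · rintro ⟨⟨h1, h2⟩, h3⟩
      exact ⟨⟨_, h2, rfl, h3⟩, by rwa [← h3]⟩
    · rintro ⟨⟨S, h1, rfl, h3⟩, h4⟩
      exact ⟨⟨by rwa [h3], h1⟩, h3⟩
  have e2 : {ω | delays D ω ∈ B (leaderHist L t ω)} ∩ {ω | leaderHist L t ω = ℓ} =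
      {ω | leaderHist L t ω ∈ ({ℓ.1} : Set _)} ∩ {ω | delays D ω ∈ B ℓ} := by
    ext ω
    simp only [Set.mem_inter_iff, Set.mem_ofPred_eq, Set.mem_singleton_iff]
    constructor
    · rintro ⟨h1, h2⟩; exact ⟨h2, by rwa [← h2]⟩
    · rintro ⟨h1, h2⟩; exact ⟨by rwa [h1], h1⟩
  have e3 : {ω | leaderHist L (t + 1) ω ∈ {ℓ' | ∃ S ∈ U, ℓ' = S :: ℓ.1}} =
      {ω | leaderHist L t ω = ℓ} ∩ {ω | L (t + 1) ω ∈ U} := by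
    ext ω
    simp only [Set.mem_inter_iff, Set.mem_ofPred_eq, leaderHist, List.cons.injEq]
    constructor
    · rintro ⟨S, h1, rfl, h3⟩; exact ⟨h3, h1⟩
    · rintro ⟨h1, h2⟩; exact ⟨_, h2, rfl, h1⟩
  rw [e1, e2, hL.measure_hist_delays hLD _ _ (hB ℓ), hL.measure_hist_delays hLD _ _ (hB ℓ), e3,
    hU, mul_assoc]
  rfl

lemma LeaderLaw.empty [IsProbabilityMeasure P] (hL : LeaderLaw P L ν f α K) (hf : 0 ≤ f) (t : ℕ)
    (ℓ : List (Finset (Option H))) :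
    P ({ω | leaderHist L t ω = ℓ} ∩ {ω | L (t + 1) ω ∈ ({∅} : Set (Finset (Option H)))}) =
      ENNReal.ofReal (1 - f) * P {ω | leaderHist L t ω = ℓ} := by
  have hm : MeasurableSet {ω | L (t + 1) ω ≠ ∅} := by
    have := measurableSet_leaderHist_mem _ hL.countable hL.subset (t + 1) (fun u _ => hL.meas u)
      {ℓ | ℓ.head? ≠ some ∅}
    simpa [leaderHist] using this
  have h1 := measure_inter_add_sdiff (μ := P) {ω | leaderHist L t ω = ℓ} hm
  rw [hL.nonempty] at h1
  have e : {ω | leaderHist L t ω = ℓ} \ {ω | L (t + 1) ω ≠ ∅} =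
      {ω | leaderHist L t ω = ℓ} ∩ {ω | L (t + 1) ω ∈ ({∅} : Set (Finset (Option H)))} := by
    ext ω; simp
  rw [e] at h1
  rw [ENNReal.ofReal_sub _ hf, ENNReal.ofReal_one, ENNReal.sub_mul (fun _ _ => by finiteness), one_mul]
  refine ENNReal.eq_sub_of_add_eq (by finiteness) ?_
  rw [add_comm]; exact h1

/-- A single delay is independent of the other ones. -/
lemma measure_update_inter (hD : IIDDelays P D ν) [DecidableEq (ℕ × H × H)] (y : ℕ × H × H)
    (U : Set ℕ∞) {B : Set (ℕ × H × H → ℕ∞)} (hB : MeasurableSet B) :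
    P ({ω | delays D ω y ∈ U} ∩ {ω | Function.update (delays D ω) y ⊤ ∈ B}) =
      ν U * P {ω | Function.update (delays D ω) y ⊤ ∈ B} := by
  have hind := (iIndepFun_iff_iIndep _ _ _).mp hD.indep
  -- Overwriting coordinate `y` by a constant makes the second event depend on the other delays
  -- only.
  have h := indep_iSup_of_disjoint (fun z => (hD.measurable z.1 z.2.1 z.2.2).comap_le) hind
    (S := {y}) (T := {y}ᶜ) disjoint_compl_right
  rw [Indep_iff] at h
  have h1 : MeasurableSet[⨆ z ∈ ({y} : Set (ℕ × H × H)),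
      MeasurableSpace.comap (D (z.1 + 1) z.2.1 z.2.2) inferInstance] {ω | delays D ω y ∈ U} := by
    rw [iSup_singleton]
    exact ⟨U, MeasurableSet.of_discrete, rfl⟩
  have h2 : MeasurableSet[⨆ z ∈ ({y}ᶜ : Set (ℕ × H × H)),
      MeasurableSpace.comap (D (z.1 + 1) z.2.1 z.2.2) inferInstance]
      {ω | Function.update (delays D ω) y ⊤ ∈ B} := by
    refine @measurable_pi_lambda _ _ _ (_) _ (fun ω => Function.update (delays D ω) y ⊤)
      (fun z => ?_) B hB
    by_cases hz : z = y
    · subst hz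
      simp only [Function.update_self]
      exact measurable_const
    · simp only [Function.update_of_ne hz]
      refine Measurable.mono (comap_measurable (D (z.1 + 1) z.2.1 z.2.2)) ?_ le_rfl
      exact le_iSup₂_of_le z hz le_rfl
  rw [h _ _ h1 h2]
  congr 1
  rw [← hD.law y.1 y.2.1 y.2.2, Measure.map_apply (hD.measurable _ _ _) MeasurableSet.of_discrete]
  rfl

end Law

end LongestChain

end

noncomputable section

namespace LongestChain

variable {Ω : Type*} [MeasurableSpace Ω] {H : Type*} {P : Measure Ω}
  {L : ℕ → Ω → Finset (Option H)} {D : ℕ → H → H → Ω → ℕ∞} {ν : Measure ℕ∞}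
  {K : Set (Option H)} {r : Rates}

/-! ### The law of the slot types -/

lemma ofReal_F_add [IsProbabilityMeasure ν] (hF : ∀ g, r.F g = ν.real {d | d < (g : ℕ∞)}) (m : ℕ) :
    ENNReal.ofReal (r.F m) + ν {d | (m : ℕ∞) ≤ d} = 1 := by
  rw [hF, ofReal_measureReal, ← measure_union _ MeasurableSet.of_discrete, ← measure_univ (μ := ν)]
  · congr 1
    ext d
    simp [lt_or_ge]
  · rw [Set.disjoint_left]
    intro d h1 h2
    exact absurd (show (m : ℕ∞) ≤ d from h2) (not_le.mpr h1)

lemma ofReal_one_sub_F [IsProbabilityMeasure ν] (hF : ∀ g, r.F g = ν.real {d | d < (g : ℕ∞)}) (m : ℕ) :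
    ENNReal.ofReal (1 - r.F m) = ν {d | (m : ℕ∞) ≤ d} := by
  have h := ofReal_F_add hF m
  rw [ENNReal.ofReal_sub _ (r.F_nonneg m), ENNReal.ofReal_one, ← h]
  exact ENNReal.add_sub_cancel_left ENNReal.ofReal_ne_top

/-- A delay that is at least `c` is less than `c + m` with the probability that it is less than
`m`, at least. -/
lemma ofReal_F_mul_le [IsProbabilityMeasure ν] (hF : ∀ g, r.F g = ν.real {d | d < (g : ℕ∞)})
    {c m g : ℕ} (hg : c + m ≤ g)
    (h : ν {d | ((c + m : ℕ) : ℕ∞) ≤ d} ≤ ν {d | (c : ℕ∞) ≤ d} * ν {d | (m : ℕ∞) ≤ d}) :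
    ENNReal.ofReal (r.F m) * ν {d | (c : ℕ∞) ≤ d} ≤ ν {d | (c : ℕ∞) ≤ d ∧ d < (g : ℕ∞)} := by
  have h1 : ν {d | (c : ℕ∞) ≤ d} ≤ ν {d | (c : ℕ∞) ≤ d ∧ d < (g : ℕ∞)} +
      ν {d | ((c + m : ℕ) : ℕ∞) ≤ d} := by
    refine (measure_mono fun d hd => ?_).trans (measure_union_le _ _)
    rcases lt_or_ge d ((c + m : ℕ) : ℕ∞) with h2 | h2
    · exact Or.inl ⟨hd, h2.trans_le (by exact_mod_cast hg)⟩
    · exact Or.inr h2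
  have h2 : ENNReal.ofReal (r.F m) * ν {d | (c : ℕ∞) ≤ d} +
      ν {d | (c : ℕ∞) ≤ d} * ν {d | (m : ℕ∞) ≤ d} = ν {d | (c : ℕ∞) ≤ d} := by
    rw [mul_comm (ν _) (ν _), ← add_mul, ofReal_F_add hF, one_mul]
  have h3 : ENNReal.ofReal (r.F m) * ν {d | (c : ℕ∞) ≤ d} +
      ν {d | (c : ℕ∞) ≤ d} * ν {d | (m : ℕ∞) ≤ d} ≤ ν {d | (c : ℕ∞) ≤ d ∧ d < (g : ℕ∞)} +
        ν {d | (c : ℕ∞) ≤ d} * ν {d | (m : ℕ∞) ≤ d} := by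
    rw [h2]
    exact h1.trans (by gcongr)
  exact (ENNReal.add_le_add_iff_right (by finiteness)).mp h3

/-- The probability that the leader of a slot has heard of the last special slot, given the types
of the past slots. -/
lemma measure_heard_ge [IsProbabilityMeasure ν] (hD : IIDDelays P D ν)
    (hF : ∀ g, r.F g = ν.real {d | d < (g : ℕ∞)})
    {ℓ : List (Finset (Option H))} {w : List (Option Bool)} {h : H} (hw : w.length = ℓ.length)
    (hsurv : ∀ c m : ℕ, (c = 0 ∨ ∃ S ∈ ℓ, some h ∈ S) →
      ν {d | ((c + m : ℕ) : ℕ∞) ≤ d} ≤ ν {d | (c : ℕ∞) ≤ d} * ν {d | (m : ℕ∞) ≤ d}) :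
    ENNReal.ofReal (if gap w = w.length then 1 else r.F (gap w + 1)) *
        P {ω | delays D ω ∈ {δ | slotTypes δ ℓ = w}} ≤
      P {ω | delays D ω ∈ {δ | slotTypes δ ℓ = w ∧ Heard δ ℓ w h}} := by
  classical
  rcases hl : lastSpecial ℓ w with _ | ⟨u, hv⟩
  · have e : {ω | delays D ω ∈ {δ | slotTypes δ ℓ = w ∧ Heard δ ℓ w h}} =
        {ω | delays D ω ∈ {δ | slotTypes δ ℓ = w}} := by
      ext ω; simp [Heard, hl]
    rw [e]
    refine mul_le_of_le_one_left zero_le ?_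
    rw [← ENNReal.ofReal_one]
    apply ENNReal.ofReal_le_ofReal
    split_ifs
    · exact le_rfl
    · exact r.F_le _
  -- The past reveals of this delay only that it is at least `c`, and at least `gap w + 1` slots
  -- have elapsed beyond the waiting time `c`. The survival inequality says that a delay of age `c`
  -- is no worse than a new one.
  · obtain ⟨c, h1, h2, h3⟩ := slotTypes_eq_iff hl h
    rw [if_neg (by omega)]
    have e1 : {ω | delays D ω ∈ {δ | slotTypes δ ℓ = w}} =
        {ω | delays D ω (u, hv, h) ∈ {d | (c : ℕ∞) ≤ d}} ∩
          {ω | Function.update (delays D ω) (u, hv, h) ⊤ ∈ {δ | slotTypes δ ℓ = w}} := by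
      ext ω
      exact h3 (delays D ω)
    have e2 : {ω | delays D ω ∈ {δ | slotTypes δ ℓ = w ∧ Heard δ ℓ w h}} =
        {ω | delays D ω (u, hv, h) ∈ {d | (c : ℕ∞) ≤ d ∧ d < ((ℓ.length - u : ℕ) : ℕ∞)}} ∩
          {ω | Function.update (delays D ω) (u, hv, h) ⊤ ∈ {δ | slotTypes δ ℓ = w}} := by
      ext ω
      simp only [Set.mem_ofPred_eq, Set.mem_inter_iff]
      rw [h3 (delays D ω)]
      have : Heard (delays D ω) ℓ w h ↔ delays D ω (u, hv, h) < ((ℓ.length - u : ℕ) : ℕ∞) := by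
        refine ⟨fun hh => hh u hv hl, fun hh u' hv' hu' => ?_⟩
        rw [hl] at hu'
        simp only [Option.some.injEq, Prod.mk.injEq] at hu'
        rw [← hu'.1, ← hu'.2]; exact hh
      rw [this]
      tauto
    rw [e1, e2, measure_update_inter hD _ _ (measurableSet_slotTypes ℓ w),
      measure_update_inter hD _ _ (measurableSet_slotTypes ℓ w), ← mul_assoc]
    gcongr
    exact ofReal_F_mul_le hF (by omega) (hsurv c _ h2)

/-- The type of slot `t + 1`. -/
def typeAt (L : ℕ → Ω → Finset (Option H)) (D : ℕ → H → H → Ω → ℕ∞) (t : ℕ) (ω : Ω) :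
    Option Bool :=
  slotType (delays D ω) (leaderHist L t ω) (typesUpTo L D t ω) (L (t + 1) ω)

lemma LeaderLaw.measurableSet_past (hL : LeaderLaw P L ν r.f r.α K) (hD : IIDDelays P D ν) (t : ℕ)
    {B : List (Finset (Option H)) → Set (ℕ × H × H → ℕ∞)} (hB : ∀ ℓ, MeasurableSet (B ℓ)) :
    MeasurableSet {ω | delays D ω ∈ B (leaderHist L t ω)} := by
  have e : {ω | delays D ω ∈ B (leaderHist L t ω)} =
      ⋃ ℓ ∈ listsIn K, {ω | leaderHist L t ω = ℓ} ∩ delays D ⁻¹' B ℓ := by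
    ext ω
    simp only [Set.mem_ofPred_eq, Set.mem_iUnion, Set.mem_inter_iff, Set.mem_preimage, exists_prop]
    constructor
    · intro h; exact ⟨_, leaderHist_mem hL.subset t ω, rfl, h⟩
    · rintro ⟨ℓ, -, rfl, h⟩; exact h
  rw [e]
  exact MeasurableSet.biUnion (countable_listsIn hL.countable) fun ℓ _ =>
    (hL.measurableSet_hist t ℓ).inter (measurable_delays hD (hB ℓ))

/-- Emptiness and sole honest leadership of the next slot are independent of the past types; given
the sole leader, its chance to have heard is bounded by `measure_heard_ge`, history by history. -/
theorem LeaderLaw.wordLaw [IsProbabilityMeasure P] [IsProbabilityMeasure ν]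
    (hL : LeaderLaw P L ν r.f r.α K) (hD : IIDDelays P D ν)
    (hLD : LeadersIndepDelays P L D) (hF : ∀ g, r.F g = ν.real {d | d < (g : ℕ∞)}) :
    WordLaw P (typeAt L D) (typesUpTo L D) r where
  zero _ := rfl
  succ _ _ := rfl
  meas t w := hL.measurableSet_past hD t fun ℓ => measurableSet_slotTypes ℓ w
  empty t w := by
    refine Eq.trans ?_ (hL.measure_past_inter hLD t (hL.empty r.f_pos.le t)
      (B := fun ℓ => {δ | slotTypes δ ℓ = w}) fun ℓ => measurableSet_slotTypes ℓ w)
    congr 1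
    ext ω
    simp only [Set.mem_ofPred_eq, Set.mem_inter_iff, Set.mem_singleton_iff, typesUpTo, leaderHist]
    rw [slotTypes_cons_eq, slotType_eq_none, and_comm]
  special t w hw := by
    set F' : ℝ := if gap w = w.length then 1 else r.F (gap w + 1) with hF'
    have ha : r.f * r.a w = F' * (r.f * r.α) := by
      rw [Rates.a, hF']; split_ifs <;> ring
    have hF0 : 0 ≤ F' := by
      rw [hF']; split_ifs
      · exact zero_le_one
      · exact r.F_nonneg _
    have hA := hL.measure_past_inter hLD t (U := {S | ∃ h, S = {some h}}) (hL.sole t)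
      (B := fun ℓ => {δ | slotTypes δ ℓ = w}) fun ℓ => measurableSet_slotTypes ℓ w
    rw [ha, ENNReal.ofReal_mul hF0, mul_assoc]
    change ENNReal.ofReal F' * (ENNReal.ofReal (r.f * r.α) *
      P {ω | delays D ω ∈ {δ | slotTypes δ (leaderHist L t ω) = w}}) ≤ _
    rw [← hA, ← one_mul (P {ω | typesUpTo L D (t + 1) ω = some true :: w})]
    refine mul_measure_le_of_fibers (countable_listsIn hL.countable) P
      (leaderHist_mem hL.subset (t + 1)) (hL.measurableSet_hist (t + 1)) fun ℓ' => ?_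
    rw [one_mul]
    -- Nonempty fibers supply an actual outcome `ω₀`, at which the survival hypothesis about the
    -- leader `h` and its earlier leaderships can be invoked.
    rcases ({ω | delays D ω ∈ {δ | slotTypes δ (leaderHist L t ω) = w}} ∩
        {ω | L (t + 1) ω ∈ {S | ∃ h, S = {some h}}} ∩
        {ω | leaderHist L (t + 1) ω = ℓ'}).eq_empty_or_nonempty with he | ⟨ω₀, ⟨-, h, hh⟩, rfl⟩
    · rw [he, measure_empty, mul_zero]; exact zero_le
    set ℓ := leaderHist L t ω₀ with hℓ
    have hcons : leaderHist L (t + 1) ω₀ = {some h} :: ℓ := by rw [leaderHist, hh]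
    rw [hcons]
    have e1 : {ω | delays D ω ∈ {δ | slotTypes δ (leaderHist L t ω) = w}} ∩
        {ω | L (t + 1) ω ∈ {S | ∃ h, S = {some h}}} ∩
        {ω | leaderHist L (t + 1) ω = {some h} :: ℓ} =
        {ω | leaderHist L (t + 1) ω ∈ ({{some h} :: ℓ} : Set (List (Finset (Option H))))} ∩
          {ω | delays D ω ∈ {δ | slotTypes δ ℓ = w}} := by
      ext ω
      simp only [Set.mem_inter_iff, Set.mem_ofPred_eq, Set.mem_singleton_iff, leaderHist,
        List.cons.injEq]
      constructor
      · rintro ⟨⟨h1, h2⟩, h3, h4⟩; exact ⟨⟨h3, h4⟩, by rwa [← h4]⟩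
      · rintro ⟨⟨h1, h2⟩, h3⟩; exact ⟨⟨by rwa [h2], h, h1⟩, h1, h2⟩
    have e2 : {ω | typesUpTo L D (t + 1) ω = some true :: w} ∩
        {ω | leaderHist L (t + 1) ω = {some h} :: ℓ} =
        {ω | leaderHist L (t + 1) ω ∈ ({{some h} :: ℓ} : Set (List (Finset (Option H))))} ∩
          {ω | delays D ω ∈ {δ | slotTypes δ ℓ = w ∧ Heard δ ℓ w h}} := by
      ext ω
      simp only [Set.mem_inter_iff, Set.mem_ofPred_eq, Set.mem_singleton_iff, typesUpTo]
      rw [and_comm]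
      refine and_congr_right fun h1 => ?_
      rw [h1, slotTypes_cons_eq, slotType_eq_true, and_comm]
      simp
    rw [e1, e2, hL.measure_hist_delays hLD _ _ (measurableSet_slotTypes ℓ w),
      hL.measure_hist_delays hLD _ _ (B := {δ | slotTypes δ ℓ = w ∧ Heard δ ℓ w h})
        ((measurableSet_slotTypes ℓ w).inter (measurableSet_heard ℓ w h)), mul_left_comm]
    refine mul_le_mul_right ?_ _
    exact measure_heard_ge hD hF (by rw [hw, hℓ, length_leaderHist]) fun c m hc =>
      hL.survive t ω₀ h c m hh hc

/-! ### Special slots that an observer has not heard of -/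

/-- The event that the observer `o` is still unaware of the special slots in question. -/
def unheardEvent (L : ℕ → Ω → Finset (Option H)) (D : ℕ → H → H → Ω → ℕ∞) (o : H) (s lo hi t : ℕ) :
    Set Ω :=
  {ω | Unheard (delays D ω) o s lo hi (leaderHist L t ω) (typesUpTo L D t ω)}

/-- The probability that a special slot is heard of after the next non-empty slot. -/
lemma LeaderLaw.measure_unheard_le [IsProbabilityMeasure ν]
    (hL : LeaderLaw P L ν r.f r.α K) (hD : IIDDelays P D ν)
    (hLD : LeadersIndepDelays P L D) (hF : ∀ g, r.F g = ν.real {d | d < (g : ℕ∞)})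
    (o : H) (s lo hi t : ℕ) {w : List (Option Bool)} (hw : EndsSpecial w) :
    P ({ω | delays D ω ∈ {δ | slotTypes δ (leaderHist L t ω) = w ∧
        Unheard δ o s lo hi (leaderHist L t ω) w ∧ ¬ Heard δ (leaderHist L t ω) w o}} ∩
        {ω | L (t + 1) ω ∈ {S | S ≠ ∅}}) ≤
      ENNReal.ofReal (r.f * (1 - r.F (gap w + 1))) *
        P {ω | delays D ω ∈ {δ | slotTypes δ (leaderHist L t ω) = w ∧
          Unheard δ o s lo hi (leaderHist L t ω) w}} := by
  classical
  rw [hL.measure_past_inter hLD t (hL.nonempty t)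
    (B := fun ℓ => {δ | slotTypes δ ℓ = w ∧ Unheard δ o s lo hi ℓ w ∧ ¬ Heard δ ℓ w o}) fun ℓ =>
    (measurableSet_slotTypes ℓ w).inter ((measurableSet_unheard o s lo hi ℓ w).inter
      (measurableSet_heard ℓ w o).compl), ENNReal.ofReal_mul r.f_pos.le, mul_assoc]
  gcongr
  rw [← one_mul (P _)]
  refine mul_measure_le_of_fibers (countable_listsIn hL.countable) P
    (leaderHist_mem hL.subset t) (hL.measurableSet_hist t) fun ℓ => ?_
  rw [one_mul]
  have e : ∀ B : List (Finset (Option H)) → Set (ℕ × H × H → ℕ∞),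
      {ω | delays D ω ∈ B (leaderHist L t ω)} ∩ {ω | leaderHist L t ω = ℓ} =
      {ω | leaderHist L t ω ∈ ({ℓ} : Set _)} ∩ {ω | delays D ω ∈ B ℓ} := fun B => by
    ext ω
    simp only [Set.mem_inter_iff, Set.mem_ofPred_eq, Set.mem_singleton_iff]
    constructor
    · rintro ⟨h1, h2⟩; exact ⟨h2, by rwa [← h2]⟩
    · rintro ⟨h1, h2⟩; exact ⟨by rwa [h1], h1⟩
  have hm : MeasurableSet {δ : ℕ × H × H → ℕ∞ | slotTypes δ ℓ = w ∧ Unheard δ o s lo hi ℓ w} :=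
    (measurableSet_slotTypes ℓ w).inter (measurableSet_unheard o s lo hi ℓ w)
  rw [e (fun ℓ => {δ | slotTypes δ ℓ = w ∧ Unheard δ o s lo hi ℓ w ∧ ¬ Heard δ ℓ w o}),
    e (fun ℓ => {δ | slotTypes δ ℓ = w ∧ Unheard δ o s lo hi ℓ w}),
    hL.measure_hist_delays hLD _ _ hm,
    hL.measure_hist_delays hLD _ _
      (B := {δ | slotTypes δ ℓ = w ∧ Unheard δ o s lo hi ℓ w ∧ ¬ Heard δ ℓ w o})
      ((measurableSet_slotTypes ℓ w).inter ((measurableSet_unheard o s lo hi ℓ w).inter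
        (measurableSet_heard ℓ w o).compl)),
    mul_left_comm]
  refine mul_le_mul_right ?_ _
  by_cases hne : ∃ δ : ℕ × H × H → ℕ∞, slotTypes δ ℓ = w
  swap
  · push Not at hne
    simp [hne]
  obtain ⟨δ₀, hδ₀⟩ := hne
  obtain ⟨u, hv, hu1, hu2⟩ := hw.lastSpecial hδ₀
  -- The last non-empty slot is the special one in question. Neither the types nor the earlier tests
  -- depend on the delay of its message to `o`, so this delay may be overwritten.
  have hup : ∀ δ : ℕ × H × H → ℕ∞, (slotTypes δ ℓ = w ∧ Unheard δ o s lo hi ℓ w) ↔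
      (slotTypes (Function.update δ (u, hv, o) ⊤) ℓ = w ∧
        Unheard (Function.update δ (u, hv, o) ⊤) o s lo hi ℓ w) := fun δ => by
    have hag : ∀ y : ℕ × H × H, y.1 + gap w + 1 < ℓ.length →
        δ y = Function.update δ (u, hv, o) ⊤ y := fun y hy => by
      rw [Function.update_of_ne]
      rintro rfl
      simp only at hy
      omega
    constructor
    · rintro ⟨h1, h2⟩
      have h3 : slotTypes δ ℓ = slotTypes (Function.update δ (u, hv, o) ⊤) ℓ :=
        slotTypes_congr (by rwa [h1])
      exact ⟨h3 ▸ h1, (unheard_congr h1 hag).mp h2⟩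
    · rintro ⟨h1, h2⟩
      have hag' := fun y hy => (hag y hy).symm
      have h3 : slotTypes (Function.update δ (u, hv, o) ⊤) ℓ = slotTypes δ ℓ :=
        slotTypes_congr (by rwa [h1])
      exact ⟨h3 ▸ h1, (unheard_congr h1 hag').mp h2⟩
  have hheard : ∀ δ : ℕ × H × H → ℕ∞, ¬ Heard δ ℓ w o ↔
      δ (u, hv, o) ∈ {d | ((gap w + 1 : ℕ) : ℕ∞) ≤ d} := fun δ => by
    rw [Set.mem_ofPred_eq, ← not_lt, not_iff_not, show gap w + 1 = ℓ.length - u by omega]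
    refine ⟨fun hh => hh u hv hu1, fun hh u' hv' hu' => ?_⟩
    rw [hu1] at hu'
    simp only [Option.some.injEq, Prod.mk.injEq] at hu'
    rw [← hu'.1, ← hu'.2]; exact hh
  have e1 : {ω | delays D ω ∈ {δ | slotTypes δ ℓ = w ∧ Unheard δ o s lo hi ℓ w}} =
      {ω | Function.update (delays D ω) (u, hv, o) ⊤ ∈
        {δ | slotTypes δ ℓ = w ∧ Unheard δ o s lo hi ℓ w}} := by
    ext ω; exact hup _
  have e2 : {ω | delays D ω ∈ {δ | slotTypes δ ℓ = w ∧ Unheard δ o s lo hi ℓ w ∧ ¬ Heard δ ℓ w o}} =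
      {ω | delays D ω (u, hv, o) ∈ {d | ((gap w + 1 : ℕ) : ℕ∞) ≤ d}} ∩
      {ω | Function.update (delays D ω) (u, hv, o) ⊤ ∈
        {δ | slotTypes δ ℓ = w ∧ Unheard δ o s lo hi ℓ w}} := by
    rw [← e1]
    ext ω
    simp only [Set.mem_ofPred_eq, Set.mem_inter_iff, hheard]
    tauto
  rw [e2, e1, measure_update_inter hD _ _ hm, ofReal_one_sub_F hF]

open Classical in
/-- The potential for an unaware observer. -/
def unheardPotential (r : Rates) (s lo hi : ℕ) (w : List (Option Bool)) : ℝ≥0∞ :=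
  if EndsSpecial w ∧ lo < specialsAfter s w ∧ specialsAfter s w ≤ hi then
    ENNReal.ofReal (1 - r.φ (gap w)) * 2⁻¹ ^ (hi - specialsAfter s w)
  else 2⁻¹ ^ (hi - max (specialsAfter s w) lo)

lemma specialsAfter_le_cons (s : ℕ) (l : Option Bool) (w : List (Option Bool)) :
    specialsAfter s w ≤ specialsAfter s (l :: w) := by
  rcases Nat.lt_or_ge w.length s with h | h
  · rw [specialsAfter, runFrom_of_length_le _ _ _ _ h.le]; exact Nat.zero_le _
  · rcases l with _ | _ | _
    · rw [specialsAfter, runFrom_none _ _ _ _ h]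
    · rw [specialsAfter, runFrom_false _ _ _ _ h]; exact le_rfl
    · rw [specialsAfter, runFrom_true _ _ _ _ h]; exact Nat.le_succ _

lemma specialsAfter_cons_of_ne (s : ℕ) {l : Option Bool} (hl : l ≠ some true)
    (w : List (Option Bool)) : specialsAfter s (l :: w) = specialsAfter s w := by
  rcases Nat.lt_or_ge w.length s with h | h
  · rw [specialsAfter, runFrom_of_length_le _ _ _ _ h.le,
      runFrom_of_length_le _ _ _ _ (by simpa using h)]
  · rcases l with _ | _ | _
    · rw [specialsAfter, runFrom_none _ _ _ _ h]
    · rw [specialsAfter, runFrom_false _ _ _ _ h]; rfl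
    · exact absurd rfl hl

lemma specialsAfter_cons_true (s : ℕ) (w : List (Option Bool)) :
    specialsAfter s (some true :: w) = specialsAfter s w ∨
      specialsAfter s (some true :: w) = specialsAfter s w + 1 := by
  rcases Nat.lt_or_ge w.length s with h | h
  · left
    rw [specialsAfter, runFrom_of_length_le _ _ _ _ h.le,
      runFrom_of_length_le _ _ _ _ (by simpa using h)]
  · right
    rw [specialsAfter, runFrom_true _ _ _ _ h]

/-- A new special slot of relevant rank halves what remains to be paid, and its own pending factor
`1 - φ 0 ≤ 1 / 2` makes up for this. Any other slot leaves the potential as it is or falls outside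
the range of ranks. -/
lemma unheardPotential_cons_some_le (hφ : 1 - r.φ 0 ≤ 1 / 2) (s lo hi : ℕ) (b : Bool)
    (w : List (Option Bool)) : unheardPotential r s lo hi (some b :: w) ≤
      2⁻¹ ^ (hi - max (specialsAfter s w) lo) := by
  have hhalf : ENNReal.ofReal (1 - r.φ 0) ≤ 2⁻¹ := by
    refine (ENNReal.ofReal_le_ofReal hφ).trans ?_
    rw [one_div, ENNReal.ofReal_inv_of_pos two_pos, ENNReal.ofReal_ofNat]
  have hle : (2⁻¹ : ℝ≥0∞) ≤ 1 := by simp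
  rcases b with _ | _
  · rw [unheardPotential, if_neg (by simp [EndsSpecial]), specialsAfter_cons_of_ne s (by simp)]
  · rw [unheardPotential]
    split_ifs with h
    · rcases specialsAfter_cons_true s w with h1 | h1
      · rw [h1] at h ⊢
        simp only [gap]
        calc _ ≤ 2⁻¹ * (2⁻¹ : ℝ≥0∞) ^ (hi - specialsAfter s w) := by gcongr
          _ ≤ (2⁻¹ : ℝ≥0∞) ^ (hi - specialsAfter s w) := mul_le_of_le_one_left zero_le hle
          _ ≤ _ := by rw [max_eq_left (by omega)]
      · rw [h1] at h ⊢
        simp only [gap]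
        calc _ ≤ 2⁻¹ * (2⁻¹ : ℝ≥0∞) ^ (hi - (specialsAfter s w + 1)) := by gcongr
          _ = (2⁻¹ : ℝ≥0∞) ^ (hi - (specialsAfter s w + 1) + 1) := by rw [pow_succ']
          _ ≤ _ := by
            rw [max_eq_left (by omega), show hi - (specialsAfter s w + 1) + 1 =
              hi - specialsAfter s w by omega]
    · rcases Nat.lt_or_ge (specialsAfter s (some true :: w)) (lo + 1) with h2 | h2
      · rw [max_eq_right (by omega), max_eq_right
          ((specialsAfter_le_cons s (some true) w).trans (by omega))]
      · have h3 : hi < specialsAfter s (some true :: w) := by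
          by_contra h3
          exact h ⟨rfl, by omega, by omega⟩
        have h4 : hi ≤ max (specialsAfter s w) lo := by
          rcases specialsAfter_cons_true s w with h1 | h1 <;> omega
        rw [Nat.sub_eq_zero_of_le h4, Nat.sub_eq_zero_of_le (by omega)]

/-- The potential for an unaware observer decreases on average. -/
lemma LeaderLaw.lintegral_unheardPotential_le [IsProbabilityMeasure P] [IsProbabilityMeasure ν]
    (hL : LeaderLaw P L ν r.f r.α K) (hD : IIDDelays P D ν) (hLD : LeadersIndepDelays P L D)
    (hF : ∀ g, r.F g = ν.real {d | d < (g : ℕ∞)}) (hφ : 1 - r.φ 0 ≤ 1 / 2) (o : H)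
    (s lo hi t : ℕ) :
    ∫⁻ ω, unheardPotential r s lo hi (typesUpTo L D (t + 1) ω)
        ∂(P.restrict (unheardEvent L D o s lo hi (t + 1))) ≤
      ∫⁻ ω, unheardPotential r s lo hi (typesUpTo L D t ω)
        ∂(P.restrict (unheardEvent L D o s lo hi t)) := by
  have hW := hL.wordLaw hD hLD hF
  set Q := P.restrict (unheardEvent L D o s lo hi (t + 1)) with hQ
  have hset : ∀ (l : Option Bool) w, {ω | (typesUpTo L D t ω, typeAt L D t ω) = (w, l)} =
      {ω | typesUpTo L D (t + 1) ω = l :: w} := by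
    intro l w; ext ω; simp [hW.succ, and_comm]
  have h1 : ∫⁻ ω, unheardPotential r s lo hi (typesUpTo L D (t + 1) ω) ∂Q =
      ∑' i : List (Option Bool) × Option Bool, unheardPotential r s lo hi (i.2 :: i.1) *
        Q {ω | typesUpTo L D (t + 1) ω = i.2 :: i.1} := by
    rw [← tsum_congr fun i : List (Option Bool) × Option Bool => by rw [← hset i.2 i.1],
      ← lintegral_eq_tsum_fibers Q (fun ω => (typesUpTo L D t ω, typeAt L D t ω)) (fun i => by
        rw [hset]; exact hW.meas _ _) (fun i => unheardPotential r s lo hi (i.2 :: i.1))]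
    simp only [hW.succ]
  rw [h1, ENNReal.tsum_prod', lintegral_eq_tsum_fibers _ _ (hW.meas t)]
  refine ENNReal.tsum_le_tsum fun w => ?_
  rw [tsum_fintype, Fintype.sum_option, Fintype.sum_bool, Measure.restrict_apply (hW.meas t w)]
  have hA : {ω | typesUpTo L D t ω = w} ∩ unheardEvent L D o s lo hi t =
      {ω | delays D ω ∈ {δ | slotTypes δ (leaderHist L t ω) = w ∧
        Unheard δ o s lo hi (leaderHist L t ω) w}} := by
    ext ω
    simp only [Set.mem_inter_iff, Set.mem_ofPred_eq, unheardEvent, typesUpTo]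
    exact and_congr_right fun h => by rw [h]
  set A := {ω | typesUpTo L D t ω = w} ∩ unheardEvent L D o s lo hi t
  have hsub : ∀ ω l, typesUpTo L D (t + 1) ω = l :: w → ω ∈ unheardEvent L D o s lo hi (t + 1) →
      slotType (delays D ω) (leaderHist L t ω) w (L (t + 1) ω) = l ∧ ω ∈ A ∧
        (L (t + 1) ω ≠ ∅ → EndsSpecial w → lo < specialsAfter s w → specialsAfter s w ≤ hi →
          ¬ Heard (delays D ω) (leaderHist L t ω) w o) := by
    intro ω l h2 h3
    obtain ⟨h4, h5⟩ := slotTypes_cons_eq.mp h2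
    rw [unheardEvent, Set.mem_ofPred_eq, h2] at h3
    refine ⟨h4, ⟨h5, ?_⟩, h3.2⟩
    rw [unheardEvent, Set.mem_ofPred_eq, typesUpTo, h5]
    exact h3.1
  have hdisj : Disjoint {ω | typesUpTo L D (t + 1) ω = some true :: w}
      {ω | typesUpTo L D (t + 1) ω = some false :: w} := by
    rw [Set.disjoint_left]
    intro ω h2 h3
    rw [Set.mem_ofPred_eq] at h2 h3
    rw [h2] at h3
    simp at h3
  -- In the first case a relevant message is pending, and the next non-empty slot tests it. In the
  -- second nothing is tested, and every step is harmless by itself.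
  by_cases hrel : EndsSpecial w ∧ lo < specialsAfter s w ∧ specialsAfter s w ≤ hi
  · set c := specialsAfter s w
    have hV : unheardPotential r s lo hi w = ENNReal.ofReal (1 - r.φ (gap w)) * 2⁻¹ ^ (hi - c) := by
      rw [unheardPotential, if_pos hrel]
    have hVn : unheardPotential r s lo hi (none :: w) =
        ENNReal.ofReal (1 - r.φ (gap w + 1)) * 2⁻¹ ^ (hi - c) := by
      rw [unheardPotential, specialsAfter_cons_of_ne s (by simp)]
      exact if_pos hrel
    have hVs : ∀ b, unheardPotential r s lo hi (some b :: w) ≤ 2⁻¹ ^ (hi - c) := fun b => by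
      have := unheardPotential_cons_some_le hφ s lo hi b w
      rwa [max_eq_left (by omega)] at this
    have hm0 : Q {ω | typesUpTo L D (t + 1) ω = none :: w} ≤ ENNReal.ofReal (1 - r.f) * P A := by
      have := hL.measure_past_inter hLD t (hL.empty r.f_pos.le t) (B := fun ℓ =>
        {δ | slotTypes δ ℓ = w ∧ Unheard δ o s lo hi ℓ w}) fun ℓ =>
        (measurableSet_slotTypes ℓ w).inter (measurableSet_unheard o s lo hi ℓ w)
      rw [hA, ← this, hQ, Measure.restrict_apply (hW.meas _ _), ← hA]
      refine measure_mono ?_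
      rintro ω ⟨h2, h3⟩
      obtain ⟨h4, h5, -⟩ := hsub ω _ h2 h3
      exact ⟨h5, slotType_eq_none.mp h4⟩
    -- Special and non-special outcomes are bounded together, since the type of the slot may itself
    -- depend on the tested delay when the observer leads the slot.
    have hm12 : Q {ω | typesUpTo L D (t + 1) ω = some true :: w} +
        Q {ω | typesUpTo L D (t + 1) ω = some false :: w} ≤
        ENNReal.ofReal (r.f * (1 - r.F (gap w + 1))) * P A := by
      rw [← measure_union hdisj (hW.meas _ _), hQ,
        Measure.restrict_apply ((hW.meas _ _).union (hW.meas _ _)), hA]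
      refine (measure_mono ?_).trans (hL.measure_unheard_le hD hLD hF o s lo hi t hrel.1)
      rintro ω ⟨h2, h3⟩
      obtain ⟨b, h2⟩ : ∃ b, typesUpTo L D (t + 1) ω = some b :: w := by
        rcases h2 with h2 | h2
        · exact ⟨_, h2⟩
        · exact ⟨_, h2⟩
      obtain ⟨h4, h5, h6⟩ := hsub ω _ h2 h3
      have hne : L (t + 1) ω ≠ ∅ := fun h7 => by
        rw [slotType_eq_none.mpr h7] at h4; simp at h4
      rw [hA] at h5
      exact ⟨⟨h5.1, h5.2, h6 hne hrel.1 hrel.2.1 hrel.2.2⟩, hne⟩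
    rw [hV, hVn]
    have hφ1 := r.φ_le_one (gap w + 1)
    have hF1 := r.F_le (gap w + 1)
    have hf0 := r.f_pos.le
    have hf1 := r.f_le
    calc _ ≤ ENNReal.ofReal (1 - r.φ (gap w + 1)) * 2⁻¹ ^ (hi - c) *
          (ENNReal.ofReal (1 - r.f) * P A) + (2⁻¹ ^ (hi - c) *
            Q {ω | typesUpTo L D (t + 1) ω = some true :: w} +
          2⁻¹ ^ (hi - c) * Q {ω | typesUpTo L D (t + 1) ω = some false :: w}) := by
          gcongr <;> exact hVs _
      _ ≤ ENNReal.ofReal (1 - r.φ (gap w + 1)) * 2⁻¹ ^ (hi - c) *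
          (ENNReal.ofReal (1 - r.f) * P A) +
          2⁻¹ ^ (hi - c) * (ENNReal.ofReal (r.f * (1 - r.F (gap w + 1))) * P A) := by
          rw [← mul_add]; gcongr
      _ = (ENNReal.ofReal (1 - r.φ (gap w + 1)) * ENNReal.ofReal (1 - r.f) +
          ENNReal.ofReal (r.f * (1 - r.F (gap w + 1)))) * 2⁻¹ ^ (hi - c) * P A := by ring
      _ = _ := by
          rw [← ENNReal.ofReal_mul (by linarith), ← ENNReal.ofReal_add
            (mul_nonneg (by linarith) (by linarith)) (mul_nonneg hf0 (by linarith)), r.φ_succ (gap w)]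
          congr 3
          ring
  · have hV : unheardPotential r s lo hi w = 2⁻¹ ^ (hi - max (specialsAfter s w) lo) := by
      rw [unheardPotential, if_neg hrel]
    have hVn : unheardPotential r s lo hi (none :: w) ≤ unheardPotential r s lo hi w := by
      rw [hV, unheardPotential, specialsAfter_cons_of_ne s (by simp)]
      exact (if_neg hrel).le
    have hVs : ∀ b, unheardPotential r s lo hi (some b :: w) ≤ unheardPotential r s lo hi w :=
      fun b => by rw [hV]; exact unheardPotential_cons_some_le hφ s lo hi b w
    calc _ ≤ unheardPotential r s lo hi w * Q {ω | typesUpTo L D (t + 1) ω = none :: w} +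
          (unheardPotential r s lo hi w * Q {ω | typesUpTo L D (t + 1) ω = some true :: w} +
          unheardPotential r s lo hi w * Q {ω | typesUpTo L D (t + 1) ω = some false :: w}) := by
          gcongr
          · exact hVs _
          · exact hVs _
      _ = unheardPotential r s lo hi w * Q ({ω | typesUpTo L D (t + 1) ω = none :: w} ∪
          ({ω | typesUpTo L D (t + 1) ω = some true :: w} ∪
          {ω | typesUpTo L D (t + 1) ω = some false :: w})) := by
          rw [measure_union _ ((hW.meas _ _).union (hW.meas _ _)),
            measure_union hdisj (hW.meas _ _), mul_add, mul_add]
          rw [Set.disjoint_left]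
          rintro ω h2 (h3 | h3) <;> rw [Set.mem_ofPred_eq] at h2 h3 <;> rw [h2] at h3 <;>
            simp at h3
      _ ≤ _ := by
          refine mul_le_mul_right ?_ _
          rw [hQ, Measure.restrict_apply
            ((hW.meas _ _).union ((hW.meas _ _).union (hW.meas _ _)))]
          refine measure_mono ?_
          rintro ω ⟨h2, h3⟩
          rcases h2 with h2 | h2 | h2 <;> exact (hsub ω _ h2 h3).2.1

/-- An observer is unlikely to be unaware of many consecutive special slots. -/
theorem LeaderLaw.measure_unaware_le [IsProbabilityMeasure P] [IsProbabilityMeasure ν]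
    (hL : LeaderLaw P L ν r.f r.α K) (hD : IIDDelays P D ν) (hLD : LeadersIndepDelays P L D)
    (hF : ∀ g, r.F g = ν.real {d | d < (g : ℕ∞)}) (hφ : 1 - r.φ 0 ≤ 1 / 2) (o : H)
    (s lo hi : ℕ) :
    P {ω | ∃ t, ω ∈ unheardEvent L D o s lo hi t ∧ hi < specialsAfter s (typesUpTo L D t ω)} ≤
      2⁻¹ ^ (hi - lo) := by
  have hW := hL.wordLaw hD hLD hF
  have hM : ∀ t, ∫⁻ ω, unheardPotential r s lo hi (typesUpTo L D t ω)
      ∂(P.restrict (unheardEvent L D o s lo hi t)) ≤ 2⁻¹ ^ (hi - lo) := by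
    intro t
    induction t with
    | zero =>
      have e : ∀ ω, unheardPotential r s lo hi (typesUpTo L D 0 ω) = 2⁻¹ ^ (hi - lo) := fun ω => by
        rw [typesUpTo, leaderHist, slotTypes, unheardPotential, if_neg (by simp [EndsSpecial]),
          specialsAfter, runFrom, Nat.zero_max]
      rw [lintegral_congr e, lintegral_const]
      exact mul_le_of_le_one_right zero_le
        ((Measure.restrict_apply_univ _).trans_le prob_le_one)
    | succ t ih => exact (hL.lintegral_unheardPotential_le hD hLD hF hφ o s lo hi t).trans ih
  -- Once the rank exceeds `hi`, later slots impose no further condition, so these events increase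
  -- with `t`.
  have hmono : Monotone fun t => {ω | ω ∈ unheardEvent L D o s lo hi t ∧
      hi < specialsAfter s (typesUpTo L D t ω)} := by
    refine monotone_nat_of_le_succ fun t ω hω => ?_
    refine ⟨⟨hω.1, fun _ _ _ h2 => absurd hω.2 (not_lt.mpr h2)⟩, hω.2.trans_le ?_⟩
    exact specialsAfter_le_cons s _ _
  have hU : {ω | ∃ t, ω ∈ unheardEvent L D o s lo hi t ∧
      hi < specialsAfter s (typesUpTo L D t ω)} = ⋃ t, {ω | ω ∈ unheardEvent L D o s lo hi t ∧
      hi < specialsAfter s (typesUpTo L D t ω)} := by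
    ext ω; simp
  rw [hU, hmono.measure_iUnion]
  refine iSup_le fun t => le_trans ?_ (hM t)
  have hm : MeasurableSet {ω | hi < specialsAfter s (typesUpTo L D t ω)} :=
    hW.measurable_comp t (specialsAfter s) (measurableSet_Ioi (a := hi))
  calc P {ω | ω ∈ unheardEvent L D o s lo hi t ∧ hi < specialsAfter s (typesUpTo L D t ω)}
      = P.restrict (unheardEvent L D o s lo hi t)
          {ω | hi < specialsAfter s (typesUpTo L D t ω)} := by
        rw [Measure.restrict_apply hm, Set.inter_comm]
        rfl
    _ = ∫⁻ ω, Set.indicator {ω | hi < specialsAfter s (typesUpTo L D t ω)} 1 ω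
          ∂(P.restrict (unheardEvent L D o s lo hi t)) := (lintegral_indicator_one hm).symm
    _ ≤ _ := by
        refine lintegral_mono fun ω => ?_
        by_cases h : ω ∈ {ω | hi < specialsAfter s (typesUpTo L D t ω)}
        · rw [Set.indicator_of_mem h, unheardPotential]
          rw [Set.mem_ofPred_eq] at h
          rw [if_neg (by omega), Nat.sub_eq_zero_of_le (by omega), pow_zero]
          exact le_rfl
        · rw [Set.indicator_of_notMem h]; exact zero_le

end LongestChain

end

noncomputable section

namespace LongestChain

variable {Ω : Type*} {H : Type*}

/-! ### Delays with monotone failure rate -/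

/-- A delay with non-decreasing failure rate is new better than used. -/
lemma survival_add_le {ν : Measure ℕ∞} [IsProbabilityMeasure ν] (hν : Monotone (failureRate ν))
    (c m : ℕ) : ν {d | ((c + m : ℕ) : ℕ∞) ≤ d} ≤ ν {d | (c : ℕ∞) ≤ d} * ν {d | (m : ℕ∞) ≤ d} := by
  have hsplit : ∀ n : ℕ, ν.real {d | (n : ℕ∞) ≤ d} =
      ν.real {(n : ℕ∞)} + ν.real {d | ((n + 1 : ℕ) : ℕ∞) ≤ d} := by
    intro n
    rw [← measureReal_union _ MeasurableSet.of_discrete]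
    · congr 1
      ext d
      simp only [Set.mem_ofPred_eq, Set.singleton_union, Set.mem_insert_iff]
      rw [le_iff_eq_or_lt, Nat.cast_add, Nat.cast_one,
        ← ENat.add_one_le_iff (ENat.natCast_ne_top n), eq_comm]
    · rw [Set.disjoint_singleton_left, Set.mem_ofPred_eq, not_le]
      exact_mod_cast Nat.lt_succ_self n
  have hle1 : ∀ n, failureRate ν n ≤ 1 := by
    intro n
    rw [failureRate]
    split_ifs with h
    · exact le_rfl
    · have h1 := measureReal_nonneg (μ := ν) (s := {d | ((n + 1 : ℕ) : ℕ∞) ≤ d})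
      have h2 := hsplit n
      exact div_le_one_of_le₀ (by linarith) measureReal_nonneg
  have hstep : ∀ n : ℕ, ν.real {d | ((n + 1 : ℕ) : ℕ∞) ≤ d} =
      ν.real {d | (n : ℕ∞) ≤ d} * (1 - failureRate ν n) := by
    intro n
    have h := hsplit n
    rw [failureRate]
    split_ifs with h0
    · have h1 : ν.real {d | (n : ℕ∞) ≤ d} = 0 := by rw [measureReal_def, h0]; rfl
      have h2 := measureReal_nonneg (μ := ν) (s := {(n : ℕ∞)})
      have h3 := measureReal_nonneg (μ := ν) (s := {d | ((n + 1 : ℕ) : ℕ∞) ≤ d})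
      rw [h1, zero_mul]
      linarith
    · have h1 : ν.real {d | (n : ℕ∞) ≤ d} ≠ 0 := by
        rwa [measureReal_def, ne_eq, ENNReal.toReal_eq_zero_iff, or_iff_left (measure_ne_top _ _)]
      rw [mul_sub, mul_one, mul_div_cancel₀ _ h1]
      linarith
  -- The survival function is the product of the factors `1 - failureRate ν n`. Shifting the indices
  -- by `c` only increases the failure rates and thus decreases the product.
  have hreal : ν.real {d | ((c + m : ℕ) : ℕ∞) ≤ d} ≤
      ν.real {d | (c : ℕ∞) ≤ d} * ν.real {d | (m : ℕ∞) ≤ d} := by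
    induction m with
    | zero => simp
    | succ m ih =>
      rw [← add_assoc, hstep, hstep m, ← mul_assoc]
      have h1 := hle1 (c + m)
      have h2 := hν (Nat.le_add_left m c)
      have h3 := hle1 m
      have h4 : 0 ≤ ν.real {d | (c : ℕ∞) ≤ d} * ν.real {d | (m : ℕ∞) ≤ d} := by positivity
      calc _ ≤ ν.real {d | (c : ℕ∞) ≤ d} * ν.real {d | (m : ℕ∞) ≤ d} * (1 - failureRate ν (c + m)) :=
            mul_le_mul_of_nonneg_right ih (by linarith)
        _ ≤ _ := mul_le_mul_of_nonneg_left (by linarith) h4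
  have h := ENNReal.ofReal_le_ofReal hreal
  rwa [ENNReal.ofReal_mul measureReal_nonneg, ofReal_measureReal, ofReal_measureReal,
    ofReal_measureReal] at h

/-! ### The two leader models -/

lemma honestCount_eq_one_iff {S : Finset (Option H)} :
    honestCount S = 1 ∧ none ∉ S ↔ ∃ h, S = {some h} := by
  constructor
  · rintro ⟨h1, h2⟩
    obtain ⟨h, hh⟩ := Finset.card_eq_one.mp h1
    refine ⟨h, ?_⟩
    ext a
    rcases a with _ | a
    · simp [h2]
    · rw [← Finset.mem_eraseNone, hh]; simp
  · rintro ⟨h, rfl⟩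
    refine ⟨?_, by simp⟩
    have : Finset.eraseNone ({some h} : Finset (Option H)) = {h} := by
      ext a; simp [Finset.mem_eraseNone]
    rw [honestCount, this, Finset.card_singleton]

lemma ne_empty_iff_leaderTuple {S : Finset (Option H)} :
    S ≠ ∅ ↔ 0 < (leaderTuple S).1 ∨ (leaderTuple S).2 := by
  simp only [leaderTuple, honestCount, Finset.card_pos]
  constructor
  · intro h
    obtain ⟨a, ha⟩ := Finset.nonempty_iff_ne_empty.mpr h
    rcases a with _ | a
    · exact Or.inr ha
    · exact Or.inl ⟨a, Finset.mem_eraseNone.mpr ha⟩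
  · rintro (⟨a, ha⟩ | h)
    · exact Finset.ne_empty_of_mem (Finset.mem_eraseNone.mp ha)
    · exact Finset.ne_empty_of_mem h

section Models

variable [MeasurableSpace Ω] {P : Measure Ω} {L : ℕ → Ω → Finset (Option H)} {ν : Measure ℕ∞}

/-- Common to both models: `τ t` carries the type of slot `t + 1`, and leader identities are
determined by types up to that slot. Non-emptiness and sole honest leadership depend on `τ t` alone,
so they are independent of the whole history. -/
lemma LeaderLaw.of_iIndep {τ : ℕ → MeasurableSpace Ω} (hτ : ∀ t, τ t ≤ ‹MeasurableSpace Ω›)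
    (hind : iIndep τ P) {K : Set (Option H)} (hK : K.Countable)
    (hsub : ∀ t ω, ∀ a ∈ L (t + 1) ω, a ∈ K)
    (hmem : ∀ t a, MeasurableSet[⨆ v ∈ {v | v ≤ t}, τ v] {ω | a ∈ L (t + 1) ω})
    (hne : ∀ t, MeasurableSet[τ t] {ω | L (t + 1) ω ≠ ∅})
    (hsole : ∀ t, MeasurableSet[τ t] {ω | ∃ h, L (t + 1) ω = {some h}})
    {f α : ℝ} (hPne : ∀ t, P {ω | L (t + 1) ω ≠ ∅} = ENNReal.ofReal f)
    (hPsole : ∀ t, P {ω | ∃ h, L (t + 1) ω = {some h}} = ENNReal.ofReal (f * α))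
    (hsurv : ∀ t ω h c m, L (t + 1) ω = {some h} →
      (c = 0 ∨ ∃ S ∈ leaderHist L t ω, some h ∈ S) →
      ν {d | ((c + m : ℕ) : ℕ∞) ≤ d} ≤ ν {d | (c : ℕ∞) ≤ d} * ν {d | (m : ℕ∞) ≤ d}) :
    LeaderLaw P L ν f α K := by
  have hprod : ∀ t ℓ B, MeasurableSet[τ t] B → P ({ω | leaderHist L t ω = ℓ} ∩ B) =
      P B * P {ω | leaderHist L t ω = ℓ} := by
    intro t ℓ B hB
    have h := indep_iSup_of_disjoint hτ hind (S := {v | v < t}) (T := {t})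
      (Set.disjoint_singleton_right.mpr (by simp))
    rw [Indep_iff] at h
    rw [h _ _ _ _, mul_comm]
    · refine measurableSet_leaderHist_eq _ hK hsub t (fun u hu a => ?_) ℓ
      refine (?_ : (⨆ v ∈ {v | v ≤ u}, τ v) ≤ ⨆ v ∈ {v | v < t}, τ v) _ (hmem u a)
      exact biSup_mono fun v hv => lt_of_le_of_lt hv hu
    · rw [iSup_singleton]; exact hB
  refine ⟨hK, hsub, fun t a => ?_, fun t ℓ => ?_, fun t ℓ => ?_, hsurv⟩
  · exact iSup₂_le (fun v _ => hτ v) _ (hmem t a)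
  · rw [hprod t ℓ _ (hne t), hPne]
  · rw [hprod t ℓ _ (hsole t), hPsole]

/-- A party may lead repeatedly, so the message delay to it may have been conditioned by earlier
failures; the monotone failure rate is what provides the survival inequality. -/
lemma IIDLeaders.leaderLaw [IsProbabilityMeasure ν] (hL : IIDLeaders P L)
    (hν : Monotone (failureRate ν)) {f α : ℝ}
    (hf : P {ω | L 1 ω ≠ ∅} = ENNReal.ofReal f)
    (hα : P {ω | ∃ h, L 1 ω = {some h}} = ENNReal.ofReal (f * α)) :
    ∃ K, LeaderLaw P L ν f α K := by
  set K : Set (Option H) := ⋃ t, ⋃ S ∈ Set.range (L (t + 1)), (S : Set (Option H)) with hKdef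
  have hK : K.Countable := Set.countable_iUnion fun t =>
    (hL.countable_range t).biUnion fun S _ => S.countable_toSet
  have hsub : ∀ t ω, ∀ a ∈ L (t + 1) ω, a ∈ K := fun t ω a ha =>
    Set.mem_iUnion.mpr ⟨t, Set.mem_biUnion ⟨ω, rfl⟩ ha⟩
  have hmeasne : MeasurableSet {S : Finset (Option H) | ∃ a ∈ K, a ∈ S} := by
    have : {S : Finset (Option H) | ∃ a ∈ K, a ∈ S} = ⋃ a ∈ K, {S | a ∈ S} := by ext; simp
    rw [this]
    exact MeasurableSet.biUnion hK fun a _ => measurableSet_mem_finset a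
  have hmeassole : MeasurableSet {S : Finset (Option H) |
      ∃ a ∈ K, (a ≠ none ∧ a ∈ S) ∧ ∀ b ∈ K, b ≠ a → b ∉ S} := by
    have : {S : Finset (Option H) | ∃ a ∈ K, (a ≠ none ∧ a ∈ S) ∧ ∀ b ∈ K, b ≠ a → b ∉ S} =
        ⋃ a ∈ K, (({S | a ≠ none} ∩ {S | a ∈ S}) ∩ ⋂ b ∈ K, {S | b ≠ a → b ∉ S}) := by
      ext S
      simp only [Set.mem_ofPred_eq, Set.mem_iUnion, Set.mem_inter_iff, Set.mem_iInter, exists_prop]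
    rw [this]
    refine MeasurableSet.biUnion hK fun a _ => ((MeasurableSet.const _).inter
      (measurableSet_mem_finset a)).inter (MeasurableSet.biInter hK fun b _ => ?_)
    by_cases hb : b = a
    · simp [hb]
    · simp only [ne_eq, hb, not_false_eq_true, true_imp_iff]
      exact measurableSet_notMem_finset b
  have ene : ∀ t, {ω | L (t + 1) ω ≠ ∅} = L (t + 1) ⁻¹' {S | ∃ a ∈ K, a ∈ S} := fun t => by
    ext ω
    simp only [Set.mem_ofPred_eq, Set.mem_preimage]
    constructor
    · intro h
      obtain ⟨a, ha⟩ := Finset.nonempty_iff_ne_empty.mpr h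
      exact ⟨a, hsub t ω a ha, ha⟩
    · rintro ⟨a, -, ha⟩; exact Finset.ne_empty_of_mem ha
  have esole : ∀ t, {ω | ∃ h, L (t + 1) ω = {some h}} = L (t + 1) ⁻¹' {S |
      ∃ a ∈ K, (a ≠ none ∧ a ∈ S) ∧ ∀ b ∈ K, b ≠ a → b ∉ S} := fun t => by
    ext ω
    simp only [Set.mem_ofPred_eq, Set.mem_preimage]
    constructor
    · rintro ⟨h, hh⟩
      have hmem : some h ∈ L (t + 1) ω := by rw [hh]; simp
      refine ⟨some h, hsub t ω _ hmem, ⟨by simp, hmem⟩, fun b _ hb => ?_⟩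
      rw [hh]; simpa using hb
    · rintro ⟨a, -, ⟨ha, haS⟩, hb⟩
      obtain ⟨h, rfl⟩ := Option.ne_none_iff_exists'.mp ha
      refine ⟨h, ?_⟩
      ext b
      rw [Finset.mem_singleton]
      refine ⟨fun h1 => ?_, fun h1 => h1 ▸ haS⟩
      by_contra h2
      exact hb b (hsub t ω b h1) h2 h1
  have hid : ∀ t U, MeasurableSet U → P (L (t + 1) ⁻¹' U) = P (L 1 ⁻¹' U) := fun t U hU => by
    rw [← Measure.map_apply (hL.measurable t) hU, hL.ident t,
      Measure.map_apply (hL.measurable 0) hU]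
  refine ⟨K, LeaderLaw.of_iIndep (τ := fun t => MeasurableSpace.comap (L (t + 1)) inferInstance)
    (fun t => (hL.measurable t).comap_le) hL.indep.iIndep hK hsub (fun t a => ?_) (fun t => ?_)
    (fun t => ?_) (fun t => ?_) (fun t => ?_) fun _ _ _ c m _ _ => survival_add_le hν c m⟩
  · have : MeasurableSet[MeasurableSpace.comap (L (t + 1)) inferInstance] {ω | a ∈ L (t + 1) ω} :=
      ⟨{S | a ∈ S}, measurableSet_mem_finset a, rfl⟩
    exact (le_iSup₂_of_le (f := fun v (_ : v ∈ {v | v ≤ t}) =>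
      MeasurableSpace.comap (L (v + 1)) inferInstance) t (le_refl t) le_rfl) _ this
  · rw [ene]; exact ⟨_, hmeasne, rfl⟩
  · rw [esole]; exact ⟨_, hmeassole, rfl⟩
  · rw [ene, hid t _ hmeasne, ← ene 0]; exact hf
  · rw [esole, hid t _ hmeassole, ← esole 0]; exact hα

/-- A new leader has never led before, so only `c = 0` arises and the survival inequality is trivial
for any delay law. The identities are recovered from the partial sums of the honest counts. -/
lemma OneTimeLeaders.leaderLaw [IsProbabilityMeasure ν] {m : ℕ ↪ H}
    (hL : OneTimeLeaders P m L) {f α : ℝ}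
    (hf : P {ω | L 1 ω ≠ ∅} = ENNReal.ofReal f)
    (hα : P {ω | ∃ h, L 1 ω = {some h}} = ENNReal.ofReal (f * α)) :
    ∃ K, LeaderLaw P L ν f α K := by
  set K : Set (Option H) := insert none (Set.range fun n => some (m n))
  have hK : K.Countable := (Set.countable_range _).insert _
  have hsub : ∀ t ω, ∀ a ∈ L (t + 1) ω, a ∈ K := fun t ω a ha => by
    rcases a with _ | a
    · exact Set.mem_insert _ _
    · obtain ⟨n, hn, -⟩ := (hL.leaders t ω a).mp ha
      exact Set.mem_insert_of_mem _ ⟨n, congrArg some hn⟩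
  let τ : ℕ → MeasurableSpace Ω := fun t =>
    MeasurableSpace.comap (fun ω => leaderTuple (L (t + 1) ω)) inferInstance
  have ene : ∀ t, {ω | L (t + 1) ω ≠ ∅} = (fun ω => leaderTuple (L (t + 1) ω)) ⁻¹'
      {y | 0 < y.1 ∨ y.2} := fun t => by
    ext ω; exact ne_empty_iff_leaderTuple
  have esole : ∀ t, {ω | ∃ h, L (t + 1) ω = {some h}} =
      (fun ω => leaderTuple (L (t + 1) ω)) ⁻¹' {y | y.1 = 1 ∧ ¬ y.2} := fun t => by
    ext ω; exact honestCount_eq_one_iff.symm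
  have hid : ∀ t U, P ((fun ω => leaderTuple (L (t + 1) ω)) ⁻¹' U) =
      P ((fun ω => leaderTuple (L 1 ω)) ⁻¹' U) := fun t U => by
    rw [← Measure.map_apply (hL.measurable t) MeasurableSet.of_discrete, hL.ident t,
      Measure.map_apply (hL.measurable 0) MeasurableSet.of_discrete]
  refine ⟨K, LeaderLaw.of_iIndep (τ := τ)
    (fun t => (hL.measurable t).comap_le) hL.indep.iIndep hK hsub (fun t a => ?_) (fun t => ?_)
    (fun t => ?_) (fun t => ?_) (fun t => ?_) fun t ω h c n hh hc => ?_⟩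
  · have hτ : ∀ v ≤ t, ∀ U : Set (ℕ × Prop), MeasurableSet[⨆ v ∈ {v | v ≤ t}, τ v]
        ((fun ω => leaderTuple (L (v + 1) ω)) ⁻¹' U) := fun v hv U =>
      (le_iSup₂_of_le (f := fun v (_ : v ∈ {v | v ≤ t}) => τ v) v hv le_rfl) _
        ⟨U, MeasurableSet.of_discrete, rfl⟩
    rcases a with _ | a
    · exact hτ t le_rfl {y | y.2}
    · have hsum : ∀ s ≤ t + 1, Measurable[⨆ v ∈ {v | v ≤ t}, τ v] fun ω =>
          ∑ u ∈ Finset.range s, honestCount (L (u + 1) ω) := fun s hs => by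
        refine @Finset.measurable_fun_sum _ _ _ _ _ _ (⨆ v ∈ {v | v ≤ t}, τ v) _ _ fun u hu => ?_
        intro U _
        exact hτ u (by have := Finset.mem_range.mp hu; omega) {y | y.1 ∈ U}
      have e : {ω | some a ∈ L (t + 1) ω} = ⋃ n ∈ {n | m n = a},
          ((fun ω => ∑ u ∈ Finset.range t, honestCount (L (u + 1) ω)) ⁻¹' {y | y ≤ n}) ∩
          ((fun ω => ∑ u ∈ Finset.range (t + 1), honestCount (L (u + 1) ω)) ⁻¹' {y | n < y}) := by
        ext ω
        simp only [Set.mem_ofPred_eq, hL.leaders, Set.mem_iUnion, Set.mem_inter_iff,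
          Set.mem_preimage, exists_prop]
      rw [e]
      exact MeasurableSet.biUnion (Set.to_countable _) fun n _ =>
        (hsum t (by omega) MeasurableSet.of_discrete).inter
          (hsum (t + 1) le_rfl MeasurableSet.of_discrete)
  · rw [ene]; exact ⟨_, MeasurableSet.of_discrete, rfl⟩
  · rw [esole]; exact ⟨_, MeasurableSet.of_discrete, rfl⟩
  · rw [ene, hid t, ← ene 0]; exact hf
  · rw [esole, hid t, ← esole 0]; exact hα
  · have hfresh : ∀ t', t' ≤ t → ∀ S ∈ leaderHist L t' ω, some h ∉ S := by
      intro t' ht'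
      induction t' with
      | zero => simp [leaderHist]
      | succ t' ih =>
        intro S hS
        rw [leaderHist, List.mem_cons] at hS
        rcases hS with rfl | hS
        · intro h1
          have h2 : some h ∈ L (t + 1) ω := by rw [hh]; simp
          obtain ⟨n, hn, -, hn2⟩ := (hL.leaders t' ω h).mp h1
          obtain ⟨n', hn', hn1', -⟩ := (hL.leaders t ω h).mp h2
          obtain rfl := m.injective (hn.trans hn'.symm)
          have : ∑ u ∈ Finset.range (t' + 1), honestCount (L (u + 1) ω) ≤
              ∑ u ∈ Finset.range t, honestCount (L (u + 1) ω) :=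
            Finset.sum_le_sum_of_subset (Finset.range_mono ht')
          omega
        · exact ih (by omega) S hS
    rcases hc with rfl | ⟨S, hS, hS'⟩
    · have : {d : ℕ∞ | ((0 : ℕ) : ℕ∞) ≤ d} = Set.univ := by ext; simp
      rw [this, measure_univ, one_mul, zero_add]
    · exact absurd hS' (hfresh t le_rfl S hS)

/-- The parameters of a protocol with honest majority. -/
lemma exists_rates [IsProbabilityMeasure P] [IsProbabilityMeasure ν]
    (hmodel : (IIDLeaders P L ∧ Monotone (failureRate ν)) ∨
      ∃ m : ℕ ↪ H, OneTimeLeaders P m L) {ε : ℝ} (hmaj : HonestMajority P L ν ε) :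
    ∃ (r : Rates) (K : Set (Option H)), LeaderLaw P L ν r.f r.α K ∧ r.f = miningRate P L ∧
      (∀ g, r.F g = ν.real {d | d < (g : ℕ∞)}) ∧ r.p = (1 + ε) / 2 := by
  obtain ⟨hε, hp⟩ := hmaj
  have hf0 : 0 ≤ (miningRate P L : ℝ) := (miningRate P L).2.1
  have hf1 : (miningRate P L : ℝ) ≤ 1 := (miningRate P L).2.2
  have hfP : P {ω | (L 1 ω).Nonempty} = ENNReal.ofReal (miningRate P L : ℝ) :=
    (ofReal_measureReal (measure_ne_top _ _)).symm
  have hne : {ω | (L 1 ω).Nonempty} = {ω | L 1 ω ≠ ∅} := by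
    ext ω; exact Finset.nonempty_iff_ne_empty
  -- If `f` vanished, the conditional measure would be zero and so would `α`, contradicting `p > 1 /
  -- 2`.
  have hfpos : 0 < (miningRate P L : ℝ) := by
    refine lt_of_le_of_ne hf0 fun h => ?_
    have h1 : ProbabilityTheory.cond P {ω | (L 1 ω).Nonempty} = 0 := by
      rw [cond_eq_zero]
      right
      rw [hfP, ← h, ENNReal.ofReal_zero]
    rw [uniqueHonestProb, h1] at hp
    simp at hp
    linarith
  have hsole : {ω | honestCount (L 1 ω) = 1 ∧ none ∉ L 1 ω} = {ω | ∃ h, L 1 ω = {some h}} := by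
    ext ω; exact honestCount_eq_one_iff
  have hα0 : 0 ≤ uniqueHonestProb P L := measureReal_nonneg
  have hα1 : uniqueHonestProb P L ≤ 1 := by
    have : IsProbabilityMeasure (ProbabilityTheory.cond P {ω | (L 1 ω).Nonempty}) :=
      cond_isProbabilityMeasure (by rw [hfP]; simpa using hfpos)
    exact measureReal_le_one
  have hαP : MeasurableSet {ω | L 1 ω ≠ ∅} → P {ω | ∃ h, L 1 ω = {some h}} =
      ENNReal.ofReal ((miningRate P L : ℝ) * uniqueHonestProb P L) := fun hm => by
    rw [uniqueHonestProb, hsole, hne, ENNReal.ofReal_mul hf0, ofReal_measureReal, cond_apply hm,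
      ← hfP, hne, ← mul_assoc, ENNReal.mul_inv_cancel _ (measure_ne_top _ _), one_mul]
    · congr 1
      ext ω
      simp only [Set.mem_ofPred_eq, Set.mem_inter_iff, iff_and_self]
      rintro ⟨h, hh⟩
      rw [hh]
      exact Finset.singleton_ne_empty _
    · rw [← hne, hfP]; simpa using hfpos
  let r : Rates :=
    { f := miningRate P L
      α := uniqueHonestProb P L
      F := fun g => ν.real {d | d < (g : ℕ∞)}
      f_pos := hfpos
      f_le := hf1
      α_nonneg := hα0
      α_le := hα1
      F_mono := fun g g' h => measureReal_mono fun d hd =>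
        lt_of_lt_of_le (show d < (g : ℕ∞) from hd) (by exact_mod_cast h)
      F_nonneg := fun _ => measureReal_nonneg
      F_le := fun _ => measureReal_le_one }
  have hr : r.p = (1 + ε) / 2 := by
    rw [← hp, Rates.p]
    congr 1
    have hf' : (miningRate P L) ≠ 0 := fun h => by rw [h] at hfpos; simp at hfpos
    have h1 : ENNReal.ofReal (r.φ 0) = (ν.prod (geometricMeasure (miningRate P L)))
        {x : ℕ∞ × ℕ | x.1 < ((x.2 + 1 : ℕ) : ℕ∞)} := by
      rw [Measure.prod_apply_symm MeasurableSet.of_discrete, lintegral_countable', Rates.φ,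
        ENNReal.ofReal_tsum_of_nonneg (fun m => mul_nonneg (r.weight_nonneg m) (r.F_nonneg _))
          (r.summable_φ 0)]
      refine tsum_congr fun n => ?_
      rw [geometricMeasure_singleton hf', ENNReal.ofReal_mul (r.weight_nonneg n), mul_comm]
      congr 1
      · change ENNReal.ofReal (ν.real _) = _
        rw [ofReal_measureReal, zero_add, add_comm 1 n]
        rfl
      · rw [mul_comm r.f]
    rw [probDelayLtGeom, measureReal_def, ← h1, ENNReal.toReal_ofReal (r.φ_nonneg 0)]
  have hf' : P {ω | L 1 ω ≠ ∅} = ENNReal.ofReal r.f := by rw [← hne]; exact hfP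
  rcases hmodel with ⟨hL, hν⟩ | ⟨m, hL⟩
  · have hm : MeasurableSet {ω | L 1 ω ≠ ∅} := by
      have e : {ω | L 1 ω ≠ ∅} = L 1 ⁻¹' ⋃ a ∈ ⋃ S ∈ Set.range (L 1), (S : Set (Option H)),
          {S | a ∈ S} := by
        ext ω
        simp only [Set.mem_ofPred_eq, ← Finset.nonempty_iff_ne_empty, Set.mem_preimage,
          Set.mem_iUnion, Set.mem_range, Finset.mem_coe, exists_prop]
        exact ⟨fun ⟨a, ha⟩ => ⟨a, ⟨_, ⟨ω, rfl⟩, ha⟩, ha⟩, fun ⟨a, _, ha⟩ => ⟨a, ha⟩⟩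
      rw [e]
      exact hL.measurable 0 (MeasurableSet.biUnion
        ((hL.countable_range 0).biUnion fun S _ => S.countable_toSet)
        fun a _ => measurableSet_mem_finset a)
    obtain ⟨K, hK⟩ := hL.leaderLaw hν (f := r.f) (α := r.α) hf' (hαP hm)
    exact ⟨r, K, hK, rfl, fun _ => rfl, hr⟩
  · have hm : MeasurableSet {ω | L 1 ω ≠ ∅} := by
      have e : {ω | L 1 ω ≠ ∅} = (fun ω => leaderTuple (L 1 ω)) ⁻¹' {y | 0 < y.1 ∨ y.2} := by
        ext ω; exact ne_empty_iff_leaderTuple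
      rw [e]
      exact hL.measurable 0 MeasurableSet.of_discrete
    obtain ⟨K, hK⟩ := hL.leaderLaw (ν := ν) (f := r.f) (α := r.α) hf' (hαP hm)
    exact ⟨r, K, hK, rfl, fun _ => rfl, hr⟩

end Models

end LongestChain

end

noncomputable section

namespace LongestChain

variable {Ω H Payload : Type*} {L : ℕ → Ω → Finset (Option H)} {D : ℕ → H → H → Ω → ℕ∞} {ω : Ω}

/-! ### Special slots of an execution -/

open Classical in
/-- The leader of a slot if the slot is special. -/
def specialLeader (L : ℕ → Ω → Finset (Option H)) (D : ℕ → H → H → Ω → ℕ∞) (ω : Ω) : ℕ → Option H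
  | 0 => none
  | t + 1 => if typeAt L D t ω = some true then soleLeader (L (t + 1) ω) else none

lemma typesUpTo_succ (t : ℕ) : typesUpTo L D (t + 1) ω = typeAt L D t ω :: typesUpTo L D t ω := rfl

lemma typesUpTo_eq_wordOf (t : ℕ) : typesUpTo L D t ω = wordOf (fun t => typeAt L D t ω) t := by
  induction t with
  | zero => rfl
  | succ t ih => rw [typesUpTo_succ, ih]; rfl

lemma exists_of_typeAt_eq_true {t : ℕ} (h : typeAt L D t ω = some true) :
    ∃ a, specialLeader L D ω (t + 1) = some a ∧ L (t + 1) ω = {some a} ∧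
      Heard (delays D ω) (leaderHist L t ω) (typesUpTo L D t ω) a := by
  obtain ⟨a, ha, hh⟩ := slotType_eq_true.mp h
  exact ⟨a, by rw [specialLeader, if_pos h, soleLeader_eq_some.mpr ha], ha, hh⟩

lemma specialLeader_eq_none {t : ℕ} (h : typeAt L D t ω ≠ some true) :
    specialLeader L D ω (t + 1) = none := by
  rw [specialLeader, if_neg h]

lemma typeAt_of_specialLeader {t : ℕ} {a : H} (h : specialLeader L D ω (t + 1) = some a) :
    typeAt L D t ω = some true := by
  by_contra h'
  rw [specialLeader_eq_none h'] at h
  simp at h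

lemma lastSpecial_eq (t : ℕ) : lastSpecial (leaderHist L t ω) (typesUpTo L D t ω) =
    (specialLeader L D ω (lastUpTo (fun t => (specialLeader L D ω t).isSome) t)).map
      fun h => (lastUpTo (fun t => (specialLeader L D ω t).isSome) t - 1, h) := by
  induction t with
  | zero => rfl
  | succ t ih =>
    rw [typesUpTo_succ, leaderHist, lastUpTo]
    by_cases hx : typeAt L D t ω = some true
    · obtain ⟨a, ha, hS, -⟩ := exists_of_typeAt_eq_true hx
      rw [if_pos (by rw [ha]; rfl), ha, hx]
      simp only [lastSpecial, soleLeader_eq_some.mpr hS, length_leaderHist, Option.map_some,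
        Nat.add_sub_cancel]
    · rw [if_neg (by rw [specialLeader_eq_none hx]; simp), ← ih]
      rcases hx' : typeAt L D t ω with _ | _ | _
      · rfl
      · rfl
      · exact absurd hx' hx

lemma exists_delay_of_heard {t : ℕ} {o hv : H}
    (hh : Heard (delays D ω) (leaderHist L t ω) (typesUpTo L D t ω) o)
    (hv' : specialLeader L D ω (lastUpTo (fun t => (specialLeader L D ω t).isSome) t) = some hv) :
    ∃ d : ℕ, D (lastUpTo (fun t => (specialLeader L D ω t).isSome) t) hv o ω = d ∧
      lastUpTo (fun t => (specialLeader L D ω t).isSome) t + d ≤ t := by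
  have h1 := hh _ _ (by rw [lastSpecial_eq, hv']; rfl)
  set v := lastUpTo (fun t => (specialLeader L D ω t).isSome) t
  have hv0 : v ≠ 0 := fun h => by rw [h] at hv'; simp [specialLeader] at hv'
  have hvt : v ≤ t := lastUpTo_le _ t
  rw [length_leaderHist, delays] at h1
  simp only [Nat.sub_add_cancel (Nat.one_le_iff_ne_zero.mpr hv0)] at h1
  obtain ⟨d, hd⟩ := ENat.ne_top_iff_exists.mp (ne_top_of_lt h1)
  rw [← hd] at h1
  have h2 : d < t - (v - 1) := by exact_mod_cast h1
  exact ⟨d, hd.symm, by omega⟩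

lemma isSpecial (L : ℕ → Ω → Finset (Option H)) (D : ℕ → H → H → Ω → ℕ∞) (ω : Ω) :
    IsSpecial (fun t => L t ω) (fun t h h' => D t h h' ω) (specialLeader L D ω) where
  zero := rfl
  leader t h ht := by
    rcases t with _ | t
    · simp [specialLeader] at ht
    · obtain ⟨a, ha, hS, -⟩ := exists_of_typeAt_eq_true (typeAt_of_specialLeader ht)
      rw [ht] at ha
      simp only [Option.some.injEq] at ha
      rw [ha]; exact hS
  heard t h hv ht hv' := by
    obtain ⟨a, ha, -, hh⟩ := exists_of_typeAt_eq_true (typeAt_of_specialLeader ht)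
    rw [ht] at ha
    simp only [Option.some.injEq] at ha
    subst ha
    exact exists_delay_of_heard hh hv'

/-- This translates between the counts of the deterministic part and the walk of the probabilistic
part. -/
lemma walk_typesUpTo (t : ℕ) : walk (typesUpTo L D t ω) =
    (numSpecial (specialLeader L D ω) t : ℤ) -
      numOther (fun t => L t ω) (specialLeader L D ω) t := by
  induction t with
  | zero => rfl
  | succ t ih =>
    rw [numSpecial, numOther, countUpTo, countUpTo, typesUpTo_succ]
    rw [numSpecial, numOther] at ih
    rcases hx : typeAt L D t ω with _ | _ | _
    · have h1 := specialLeader_eq_none (L := L) (D := D) (ω := ω) (t := t) (by rw [hx]; simp)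
      have h2 : L (t + 1) ω = ∅ := slotType_eq_none.mp hx
      simp [walk, h1, h2, ih]
    · have h1 := specialLeader_eq_none (L := L) (D := D) (ω := ω) (t := t) (by rw [hx]; simp)
      have h2 : (L (t + 1) ω).Nonempty :=
        Finset.nonempty_iff_ne_empty.mpr (slotType_eq_false.mp hx).1
      simp only [walk, h1, h2, ih, Option.isSome_none, Bool.false_eq_true, if_false, and_self,
        if_true]
      push_cast
      ring
    · obtain ⟨a, ha, hS, -⟩ := exists_of_typeAt_eq_true hx
      simp only [walk, ha, ih, Option.isSome_some, if_true, reduceCtorEq, and_false, if_false]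
      push_cast
      ring

lemma specialsAfter_typesUpTo {s t : ℕ} (hst : s ≤ t) :
    specialsAfter s (typesUpTo L D t ω) + numSpecial (specialLeader L D ω) s =
      numSpecial (specialLeader L D ω) t := by
  induction t, hst using Nat.le_induction with
  | base =>
    rw [typesUpTo_eq_wordOf, specialsAfter, runFrom_wordOf_of_le le_rfl, zero_add]
  | succ t hst ih =>
    simp only [numSpecial] at ih ⊢
    rw [countUpTo, ← ih]
    by_cases hx : typeAt L D t ω = some true
    · obtain ⟨a, ha, -, -⟩ := exists_of_typeAt_eq_true hx
      rw [typesUpTo_eq_wordOf, typesUpTo_eq_wordOf, specialsAfter, runFrom_wordOf_true hst hx,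
        if_pos (by rw [ha]; rfl)]
      omega
    · rw [typesUpTo_succ, specialsAfter_cons_of_ne s hx, specialLeader_eq_none hx]
      simp

lemma specialsAfter_le_numAfter (s : ℕ) (w : List (Option Bool)) :
    specialsAfter s w ≤ WordLaw.numAfter s w := by
  induction w with
  | nil => simp [specialsAfter, WordLaw.numAfter, runFrom]
  | cons l w ih =>
    simp only [specialsAfter, WordLaw.numAfter, runFrom] at ih ⊢
    split_ifs with h
    · exact le_rfl
    · rcases l with _ | _ | _
      · exact ih
      · exact Nat.le_succ_of_le ih
      · exact Nat.succ_le_succ ih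

/-! ### Observers of an execution -/

/-- A party that does not stay unaware of all special slots with rank in `(lo, hi]` adopts a chain
as long as that of one of them. -/
lemma exists_heard {E : Transcript H Payload}
    (hE : IsExecution (fun t => L t ω) (fun t h h' => D t h h' ω) E) {o : H} {s lo hi i : ℕ}
    (h : ω ∉ unheardEvent L D o s lo hi i) :
    ∃ v ≤ i, (specialLeader L D ω v).isSome ∧
      lo + numSpecial (specialLeader L D ω) s < numSpecial (specialLeader L D ω) v ∧
      specialHeight E (specialLeader L D ω) v ≤ (E.chain i o).height := by
  rw [unheardEvent, Set.mem_ofPred_eq] at h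
  induction i with
  | zero => exact absurd trivial h
  | succ i ih =>
    rw [typesUpTo_succ, leaderHist, Unheard, not_and_or] at h
    rcases h with h | h
    · obtain ⟨v, h1, h2, h3, h4⟩ := ih h
      exact ⟨v, by omega, h2, h3, h4.trans (hE.height_mono o (Nat.le_succ i))⟩
    · push Not at h
      obtain ⟨-, hw, hlo, -, hh⟩ := h
      obtain ⟨u, hv, hu, -⟩ := hw.lastSpecial (ℓ := leaderHist L i ω) (δ := delays D ω) rfl
      have hst : s ≤ i := by
        by_contra hst
        rw [specialsAfter, runFrom_of_length_le] at hlo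
        · omega
        · rw [typesUpTo_eq_wordOf, length_wordOf]; omega
      rw [lastSpecial_eq, Option.map_eq_some_iff] at hu
      obtain ⟨hv', hv1, -⟩ := hu
      obtain ⟨d, hd, hdi⟩ := exists_delay_of_heard hh hv1
      have hc := countUpTo_lastUpTo (fun t => ((specialLeader L D ω t).isSome : Prop)) i
      have hvi := lastUpTo_le (fun t => ((specialLeader L D ω t).isSome : Prop)) i
      set v := lastUpTo (fun t => ((specialLeader L D ω t).isSome : Prop)) i
      refine ⟨v, by omega, by rw [hv1]; rfl, ?_, ?_⟩
      · have := specialsAfter_typesUpTo (L := L) (D := D) (ω := ω) hst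
        rw [numSpecial] at this ⊢
        omega
      · have hsp := isSpecial L D ω
        have hL := hsp.leader v hv' hv1
        have := hE.height_le_of_delivered (h' := o) (i := i + 1) (hsp.pos hv1)
          (show some hv' ∈ L v ω by rw [hL]; simp) hd (by omega)
        rw [specialHeight, hv1]
        exact this

/-- The event that an observer is unaware of the last special slots, at least `g j` in number,
before the last one of some slot with index `j ≥ n`. -/
def lateEvent (L : ℕ → Ω → Finset (Option H)) (D : ℕ → H → H → Ω → ℕ∞) (o : H) (s n : ℕ)
    (g : ℕ → ℕ) : Set Ω :=
  {ω | ∃ i, n ≤ WordLaw.numAfter s (typesUpTo L D i ω) ∧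
    g (WordLaw.numAfter s (typesUpTo L D i ω)) < specialsAfter s (typesUpTo L D i ω) ∧
    ω ∈ unheardEvent L D o s (specialsAfter s (typesUpTo L D i ω) - 1 -
      g (WordLaw.numAfter s (typesUpTo L D i ω))) (specialsAfter s (typesUpTo L D i ω) - 1) i}

/-- If a party holds a chain shorter than those of all special slots but the last ones, then it
is late. -/
lemma mem_lateEvent {E : Transcript H Payload}
    (hE : IsExecution (fun t => L t ω) (fun t h h' => D t h h' ω) E) {o : H} {s n i : ℕ}
    {g : ℕ → ℕ} (hsi : s ≤ i) (hn : n ≤ WordLaw.numAfter s (typesUpTo L D i ω))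
    (hs : numSpecial (specialLeader L D ω) s + g (WordLaw.numAfter s (typesUpTo L D i ω)) <
      numSpecial (specialLeader L D ω) i)
    (hv : ∀ v ≤ i, (specialLeader L D ω v).isSome →
      specialHeight E (specialLeader L D ω) v ≤ (E.chain i o).height →
      numSpecial (specialLeader L D ω) v + g (WordLaw.numAfter s (typesUpTo L D i ω)) <
        numSpecial (specialLeader L D ω) i) :
    ω ∈ lateEvent L D o s n g := by
  have hL := specialsAfter_typesUpTo (L := L) (D := D) (ω := ω) hsi
  refine ⟨i, hn, by omega, ?_⟩
  by_contra hun
  obtain ⟨v, h1, h2, h3, h4⟩ := exists_heard hE hun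
  have := hv v h1 h2 h4
  omega

lemma Unheard.mono {δ : ℕ × H × H → ℕ∞} {o : H} {s lo lo' hi : ℕ} (hlo : lo ≤ lo') :
    ∀ {ℓ : List (Finset (Option H))} {w : List (Option Bool)}, Unheard δ o s lo hi ℓ w →
      Unheard δ o s lo' hi ℓ w
  | [], _, _ => by simp [Unheard]
  | _ :: _, [], _ => by simp [Unheard]
  | _ :: _, _ :: _, h => ⟨Unheard.mono hlo h.1, fun h1 h2 h3 h4 => h.2 h1 h2 (by omega) h4⟩

/-- The union bound runs over the rank `l` just below the last special slot instead of over time,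
which costs one term per rank. The index of a slot is at least its number of special slots and at
least `n`, whence the argument `max n (l + 1)`. -/
lemma LeaderLaw.measure_lateEvent_le [MeasurableSpace Ω] {P : Measure Ω} [IsProbabilityMeasure P]
    {ν : Measure ℕ∞} [IsProbabilityMeasure ν] {r : Rates} {K : Set (Option H)}
    (hL : LeaderLaw P L ν r.f r.α K) (hD : IIDDelays P D ν) (hLD : LeadersIndepDelays P L D)
    (hF : ∀ g, r.F g = ν.real {d | d < (g : ℕ∞)}) (hφ : 1 - r.φ 0 ≤ 1 / 2) (o : H) (s n : ℕ)
    {g : ℕ → ℕ} (hg : Monotone g) :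
    P (lateEvent L D o s n g) ≤ ∑' l : ℕ, 2⁻¹ ^ g (max n (l + 1)) := by
  refine le_trans (measure_mono fun ω hω => ?_) ((measure_iUnion_le fun l : ℕ => {ω | (∃ i,
    ω ∈ unheardEvent L D o s (l - g (max n (l + 1))) l i ∧
    l < specialsAfter s (typesUpTo L D i ω)) ∧ g (max n (l + 1)) ≤ l}).trans ?_)
  · obtain ⟨i, hn, hgi, hun⟩ := hω
    have hle := specialsAfter_le_numAfter s (typesUpTo L D i ω)
    set j := WordLaw.numAfter s (typesUpTo L D i ω)
    set l := specialsAfter s (typesUpTo L D i ω)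
    have hgl : g (max n (l - 1 + 1)) ≤ g j := hg (by omega)
    exact Set.mem_iUnion.mpr ⟨l - 1, ⟨i, Unheard.mono (by omega) hun, by omega⟩, by omega⟩
  · refine ENNReal.tsum_le_tsum fun l => ?_
    by_cases h : g (max n (l + 1)) ≤ l
    · refine (measure_mono fun ω hω => hω.1).trans
        ((hL.measure_unaware_le hD hLD hF hφ o s (l - g (max n (l + 1))) l).trans ?_)
      rw [show l - (l - g (max n (l + 1))) = g (max n (l + 1)) by omega]
    · simp [h]

end LongestChain

end

noncomputable section

namespace LongestChain

variable {Ω H Payload : Type*} {L : ℕ → Ω → Finset (Option H)} {D : ℕ → H → H → Ω → ℕ∞} {ω : Ω}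

open WordLaw (numAfter climbState)

/-! ### Deterministic consequences of a typical leader election -/

/-- The event that from index `n` on the walk fails to exceed its values up to index `m` at the
given rate. -/
def slowEvent (L : ℕ → Ω → Finset (Option H)) (D : ℕ → H → H → Ω → ℕ∞) (s m n : ℕ) (ρ : ℝ) : Set Ω :=
  {ω | ∃ t, s ≤ t ∧ m ≤ (climbState m s (typesUpTo L D t ω)).1 ∧
    n ≤ (climbState m s (typesUpTo L D t ω)).1 ∧
    0 ≤ ((climbState m s (typesUpTo L D t ω)).2.1 : ℝ) - (climbState m s (typesUpTo L D t ω)).2.2 +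
      ρ * ((climbState m s (typesUpTo L D t ω)).1 - m)}

/-- The event that the first `n` steps after slot `s` contain no cut. -/
def cutFreeEvent (L : ℕ → Ω → Finset (Option H)) (D : ℕ → H → H → Ω → ℕ∞) (s n : ℕ) : Set Ω :=
  {ω | ∃ t, s ≤ t ∧ CutFree n (stepsAfter s (typesUpTo L D t ω))}

lemma numAfter_typesUpTo_mono (s : ℕ) : Monotone fun t => numAfter s (typesUpTo L D t ω) := by
  simp only [typesUpTo_eq_wordOf]
  exact numAfter_mono

lemma numAfter_typesUpTo_self (s : ℕ) : numAfter s (typesUpTo L D s ω) = 0 := by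
  rw [typesUpTo_eq_wordOf, numAfter_of_le le_rfl]

/-- The climb automaton's inequality holds for all values up to index `m` simultaneously, including
those before slot `s`, thanks to the reach at `s`. -/
lemma lt_climb_of_notMem_slowEvent {s m n a t : ℕ} {ρ : ℝ} (hmn : m ≤ n)
    (hω : ω ∉ slowEvent L D s m n ρ) (hst : s ≤ t) (hn : n ≤ numAfter s (typesUpTo L D t ω))
    (hat : a ≤ t) (ha : numAfter s (typesUpTo L D a ω) ≤ m) :
    ρ * (numAfter s (typesUpTo L D t ω) - m) +
        numSpecial (specialLeader L D ω) a + numOther (fun t => L t ω) (specialLeader L D ω) t <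
      numSpecial (specialLeader L D ω) t + numOther (fun t => L t ω) (specialLeader L D ω) a := by
  have hspec := climbState_spec (x := fun t => typeAt L D t ω) m hst
  simp only [← typesUpTo_eq_wordOf] at hspec
  obtain ⟨h1, -, h3⟩ := hspec
  have h4 := h3 a hat ha
  rw [walk_typesUpTo, walk_typesUpTo] at h4
  have h5 : ¬ (0 : ℝ) ≤ ((climbState m s (typesUpTo L D t ω)).2.1 : ℝ) -
      (climbState m s (typesUpTo L D t ω)).2.2 +
      ρ * ((climbState m s (typesUpTo L D t ω)).1 - m) := fun h =>
    hω ⟨t, hst, by omega, by omega, h⟩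
  rw [h1] at h5
  have h6 : (numSpecial (specialLeader L D ω) a : ℝ) -
      numOther (fun t => L t ω) (specialLeader L D ω) a ≤ numSpecial (specialLeader L D ω) t -
      numOther (fun t => L t ω) (specialLeader L D ω) t +
      (climbState m s (typesUpTo L D t ω)).2.1 - (climbState m s (typesUpTo L D t ω)).2.2 := by
    exact_mod_cast h4
  linarith

/-- The window of a chain without many special blocks ends at a value of the walk that has
already been attained, unless the party holding the chain is late. -/
lemma exists_window_or_late {E : Transcript H Payload}
    (hE : IsExecution (fun t => L t ω) (fun t h h' => D t h h' ω) E) {o : H} {s c e i m n : ℕ}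
    {ρ q : ℝ} {g : ℕ → ℕ} (hsc : s ≤ c) (hci : c ≤ i)
    (hcm : numAfter s (typesUpTo L D c ω) ≤ m) (hmn : m ≤ n)
    (hn : n ≤ numAfter s (typesUpTo L D i ω)) (hω : ω ∉ slowEvent L D s m n ρ)
    (hg : g (numAfter s (typesUpTo L D i ω)) ≤ ρ * (numAfter s (typesUpTo L D i ω) - m) - q)
    (hq : (specialOn (specialLeader L D ω) c e (E.chain i o) : ℝ) ≤ q) :
    ω ∈ lateEvent L D o s n g ∨ ∃ a ≤ c, ∃ b, e ≤ b ∧ b ≤ i ∧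
      numSpecial (specialLeader L D ω) b + numOther (fun t => L t ω) (specialLeader L D ω) a ≤
        numSpecial (specialLeader L D ω) a + numOther (fun t => L t ω) (specialLeader L D ω) b +
          specialOn (specialLeader L D ω) c e (E.chain i o) := by
  refine or_iff_not_imp_right.mpr fun hno => ?_
  have hclimb : ∀ a ≤ c, _ := fun a hac => lt_climb_of_notMem_slowEvent hmn hω (hsc.trans hci) hn
    (hac.trans hci) ((numAfter_typesUpTo_mono s hac).trans hcm)
  refine mem_lateEvent hE (hsc.trans hci) hn ?_ fun v hvi hv hheard => ?_
  · have h1 := hclimb s hsc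
    have h2 : (0 : ℝ) ≤ specialOn (specialLeader L D ω) c e (E.chain i o) := Nat.cast_nonneg _
    have h3 : (numOther (fun t => L t ω) (specialLeader L D ω) s : ℝ) ≤
        numOther (fun t => L t ω) (specialLeader L D ω) i := by
      exact_mod_cast countUpTo_mono _ (hsc.trans hci)
    have : (numSpecial (specialLeader L D ω) s : ℝ) + g (numAfter s (typesUpTo L D i ω)) <
        numSpecial (specialLeader L D ω) i := by linarith
    exact_mod_cast this
  -- Without a bad stretch, the chain being as high as the block of `v` bounds the special slots up
  -- to `v`. The climb up to `i` then leaves more than `g` special slots after `v`.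
  · obtain ⟨a, hac, ⟨b, hb⟩ | h⟩ := chain_window hE (isSpecial L D ω) (e := e) hci o hvi (Or.inr hv)
      hheard
    · exact absurd ⟨a, hac, b, hb⟩ hno
    · have h1 := hclimb a hac
      have h2 : (numSpecial (specialLeader L D ω) v : ℝ) +
          numOther (fun t => L t ω) (specialLeader L D ω) a ≤
          numSpecial (specialLeader L D ω) a + numOther (fun t => L t ω) (specialLeader L D ω) i +
          specialOn (specialLeader L D ω) c e (E.chain i o) := by exact_mod_cast h
      have : (numSpecial (specialLeader L D ω) v : ℝ) + g (numAfter s (typesUpTo L D i ω)) <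
        numSpecial (specialLeader L D ω) i := by linarith
      exact_mod_cast this

/-- Settlement holds if there is an early cut, the walk climbs, and no party is late. -/
lemma settlement_of_notMem {E : Transcript H Payload}
    (hE : IsExecution (fun t => L t ω) (fun t h h' => D t h h' ω) E) {I : Set H} {s k m n : ℕ}
    {ρ : ℝ} {g : ℕ → ℕ} (hmn : m ≤ n) (hn : n ≤ numAfter s (typesUpTo L D (s + k) ω))
    (hg : ∀ j, n ≤ j → (g j : ℝ) ≤ ρ * (j - m)) (hslow : ω ∉ slowEvent L D s m n ρ)
    (hcut : ω ∉ cutFreeEvent L D s m) (hlate : ∀ o ∈ I, ω ∉ lateEvent L D o s n g) :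
    Settlement E s k I := by
  intro h₁ hh₁ h₂ hh₂ i₁ i₂ hi₁ hi₂
  have hmono := numAfter_typesUpTo_mono (L := L) (D := D) (ω := ω) s
  have hn2 : m ≤ numAfter s (wordOf (fun t => typeAt L D t ω) i₂) := by
    rw [← typesUpTo_eq_wordOf]
    exact hmn.trans (hn.trans (hmono (hi₁.trans hi₂)))
  -- The cut is taken with respect to the later time `i₂`, so that it separates the walk at both
  -- times; its slot is `u + 1`.
  obtain ⟨u, hsu, hu2, hxu, hum, hcutu⟩ := exists_cut (by omega) hn2 fun h =>
    hcut ⟨i₂, by omega, by rwa [typesUpTo_eq_wordOf]⟩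
  simp only [← typesUpTo_eq_wordOf] at hum hcutu
  obtain ⟨a, ha, -, -⟩ := exists_of_typeAt_eq_true hxu
  have hmem : ∀ o ∈ I, ∀ i, s + k ≤ i → i ≤ i₂ →
      (E.chain i o).portion 1 s = (E.honestBlock (u + 1) a).portion 1 s := by
    intro o ho i hi hi'
    have htree := hE.chain_mem_tree i o
    refine portion_eq_of_mem (b := E.honestBlock (u + 1) a) hE i s (Nat.lt_succ_of_le hsu) _ htree ?_
    by_contra hnot
    have hz := specialOn_eq_zero hE (isSpecial L D ω) ha htree hnot
    rw [Nat.add_sub_cancel] at hz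
    -- Fewer than `m` non-empty slots precede the cut, while at least `n ≥ m` have occurred by time
    -- `i`, so the cut comes first.
    have hni := hn.trans (hmono hi)
    have hui : u ≤ i := by
      by_contra hlt
      exact absurd (hni.trans (hmono (show i ≤ u by omega))) (by simp only; omega)
    rcases exists_window_or_late hE (o := o) (e := u + 1) (q := 0) hsu hui hum.le hmn hni hslow
      (by rw [sub_zero]; exact hg _ hni) (by rw [hz, Nat.cast_zero]) with h | ⟨b, hb, c, hc, hci, h⟩
    · exact hlate o ho h
    · have := hcutu b c hb (by omega) (by omega)
      rw [walk_typesUpTo, walk_typesUpTo] at this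
      omega
  rw [hmem h₁ hh₁ i₁ hi₁ hi₂, hmem h₂ hh₂ i₂ (hi₁.trans hi₂) le_rfl]

/-- Intensive chain quality holds if the walk climbs and no party is late. -/
lemma intensiveChainQuality_of_notMem {E : Transcript H Payload}
    (hE : IsExecution (fun t => L t ω) (fun t h h' => D t h h' ω) E) {I : Set H} {s k n : ℕ}
    {f μ ρ : ℝ} {g : ℕ → ℕ} (hn : n ≤ numAfter s (typesUpTo L D (s + k) ω))
    (hg : ∀ j, n ≤ j → (g j : ℝ) ≤ ρ * j - k * f * μ) (hslow : ω ∉ slowEvent L D s 0 n ρ)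
    (hlate : ∀ o ∈ I, ω ∉ lateEvent L D o s n g) :
    IntensiveChainQuality E f μ s k I := by
  intro h hh i hi
  have hmono := numAfter_typesUpTo_mono (L := L) (D := D) (ω := ω) s
  by_contra hle
  rw [not_lt] at hle
  have hq : (specialOn (specialLeader L D ω) s (s + k) (E.chain i h) : ℝ) ≤ k * f * μ :=
    le_trans (by exact_mod_cast specialOn_le_countP hE (isSpecial L D ω) (hE.chain_mem_tree i h)) hle
  have hni := hn.trans (hmono hi)
  have h0 := numAfter_typesUpTo_self (L := L) (D := D) (ω := ω) s
  rcases exists_window_or_late hE (o := h) (e := s + k) le_rfl (by omega) h0.le (Nat.zero_le n)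
    hni hslow (by simpa using hg _ hni) hq with h' | ⟨a, ha, b, hb, hbi, h'⟩
  · exact hlate h hh h'
  -- A bad stretch would bound the climb from `a ≤ s` to `b ≥ s + k` by `k * f * μ`, but the climb
  -- exceeds this already at index `n`.
  · have hnb := hn.trans (hmono hb)
    have h1 := lt_climb_of_notMem_slowEvent (Nat.zero_le n) hslow (by omega) hnb
      (show a ≤ b by omega) ((hmono ha).trans h0.le)
    have h2 := hg _ hnb
    have h3 : (0 : ℝ) ≤ g (numAfter s (typesUpTo L D b ω)) := Nat.cast_nonneg _
    have h4 : (numSpecial (specialLeader L D ω) b : ℝ) +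
        numOther (fun t => L t ω) (specialLeader L D ω) a ≤
        numSpecial (specialLeader L D ω) a + numOther (fun t => L t ω) (specialLeader L D ω) b +
        specialOn (specialLeader L D ω) s (s + k) (E.chain i h) := by exact_mod_cast h'
    simp only [Nat.cast_zero, sub_zero] at h1
    linarith

/-! ### Bounds for late parties -/

lemma measure_biUnion_le_encard_mul [MeasurableSpace Ω] {P : Measure Ω} {I : Set H} {A : H → Set Ω}
    {c : ℝ≥0∞} (hc : c ≠ 0) (hA : ∀ o ∈ I, P (A o) ≤ c) :
    P (⋃ o ∈ I, A o) ≤ (I.encard : ℝ≥0∞) * c := by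
  rcases I.finite_or_infinite with hI | hI
  · have e : (⋃ o ∈ I, A o) = ⋃ o ∈ hI.toFinset, A o := by simp
    rw [e, hI.encard_eq_coe_toFinset_card]
    refine (measure_biUnion_finset_le _ _).trans ((Finset.sum_le_card_nsmul _ _ c fun o ho =>
      hA o (hI.mem_toFinset.mp ho)).trans ?_)
    rw [nsmul_eq_mul]
    simp
  · rw [hI.encard_eq, ENat.toENNReal_top, ENNReal.top_mul hc]
    exact le_top

/-- Ranks below `n` contribute equal terms, `n` in number, and later ranks a geometric series of
ratio `x`. -/
lemma tsum_late_le {A B x : ℝ} (hAx : (1 / 2 : ℝ) ^ A ≤ x) (hx : x < 1) (n : ℕ) :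
    ∑' l : ℕ, (2⁻¹ : ℝ≥0∞) ^ ⌊A * (max n (l + 1) : ℕ) - B⌋₊ ≤
      ENNReal.ofReal (2 / (1 - x) * ((1 / 2 : ℝ) ^ (A * n - B) * (n * (1 - x) + 1))) := by
  have hx0 : 0 < x := lt_of_lt_of_le (by positivity) hAx
  set f : ℕ → ℝ := fun l => x ^ (max n (l + 1) - n)
  have hf : HasSum f (x * (1 - x)⁻¹ + ∑ l ∈ Finset.range n, f l) := by
    rw [← hasSum_nat_add_iff n]
    have e : (fun l => f (l + n)) = fun l => x * x ^ l := by
      ext l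
      simp only [f]
      rw [← pow_succ', show max n (l + n + 1) - n = l + 1 by omega]
    rw [e]
    exact (hasSum_geometric_of_lt_one hx0.le hx).mul_left x
  have hsum : ∑ l ∈ Finset.range n, f l = n := by
    rw [Finset.sum_congr rfl (g := fun _ => (1 : ℝ))]
    · simp
    · intro l hl
      have := Finset.mem_range.mp hl
      simp only [f]
      rw [show max n (l + 1) - n = 0 by omega, pow_zero]
  have hterm : ∀ l : ℕ, (2⁻¹ : ℝ≥0∞) ^ ⌊A * (max n (l + 1) : ℕ) - B⌋₊ ≤
      ENNReal.ofReal (2 * (1 / 2 : ℝ) ^ (A * n - B) * f l) := by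
    intro l
    set j := max n (l + 1)
    have hj : (j : ℝ) = n + (j - n : ℕ) := by
      rw [← Nat.cast_add, Nat.add_sub_cancel' (le_max_left _ _)]
    have e : (2⁻¹ : ℝ≥0∞) ^ ⌊A * j - B⌋₊ = ENNReal.ofReal ((1 / 2 : ℝ) ^ (⌊A * j - B⌋₊ : ℝ)) := by
      rw [Real.rpow_natCast, ENNReal.ofReal_pow (by norm_num), one_div,
        ENNReal.ofReal_inv_of_pos two_pos, ENNReal.ofReal_ofNat]
    rw [e]
    apply ENNReal.ofReal_le_ofReal
    -- Rounding down costs a factor `2`.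
    have h1 : A * j - B - 1 ≤ ⌊A * j - B⌋₊ := by linarith [Nat.lt_floor_add_one (A * j - B)]
    calc (1 / 2 : ℝ) ^ (⌊A * j - B⌋₊ : ℝ) ≤ (1 / 2 : ℝ) ^ (A * j - B - 1) :=
          Real.rpow_le_rpow_of_exponent_ge (by norm_num) (by norm_num) h1
      _ = 2 * (1 / 2 : ℝ) ^ (A * n - B) * ((1 / 2 : ℝ) ^ A) ^ (j - n) := by
          rw [← Real.rpow_natCast, ← Real.rpow_mul (by norm_num), mul_assoc,
            ← Real.rpow_add (by norm_num), Real.rpow_sub_one (by norm_num), hj]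
          ring_nf
      _ ≤ _ := mul_le_mul_of_nonneg_left (pow_le_pow_left₀ (by positivity) hAx _) (by positivity)
  refine (ENNReal.tsum_le_tsum hterm).trans ?_
  rw [← ENNReal.ofReal_tsum_of_nonneg (fun l => by positivity) (hf.summable.mul_left _), tsum_mul_left,
    hf.tsum_eq, hsum]
  apply ENNReal.ofReal_le_ofReal
  have h1 : 0 < 1 - x := by linarith
  have e : 2 * (1 / 2 : ℝ) ^ (A * n - B) * (x * (1 - x)⁻¹ + n) =
      2 / (1 - x) * ((1 / 2 : ℝ) ^ (A * n - B) * (n * (1 - x) + x)) := by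
    field_simp
    ring
  rw [e]
  gcongr

lemma half_rpow (y : ℝ) : (1 / 2 : ℝ) ^ y = Real.exp (-(Real.log 2 * y)) := by
  rw [Real.rpow_def_of_pos (by norm_num), one_div, Real.log_inv, neg_mul]

end LongestChain

end

noncomputable section

namespace LongestChain

/-! ### Numerical estimates -/

section Numerics

variable {X ε μ : ℝ}

lemma one_sub_half_rpow_le (y : ℝ) : 1 - (1 / 2 : ℝ) ^ y ≤ Real.log 2 * y := by
  rw [half_rpow]
  linarith [Real.one_sub_le_exp_neg (Real.log 2 * y)]

lemma half_rpow_lt_one {y : ℝ} (hy : 0 < y) : (1 / 2 : ℝ) ^ y < 1 :=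
  Real.rpow_lt_one (by norm_num) (by norm_num) hy

lemma four_thirds_le_exp : (4 / 3 : ℝ) ≤ Real.exp (29 / 100) := by
  have := Real.sum_le_exp_of_nonneg (x := 29 / 100) (by norm_num) 4
  norm_num [Finset.sum_range_succ, Nat.factorial] at this
  linarith

lemma one_le_three_mul_exp {z : ℝ} (hz : z ≤ 34) : 1 ≤ 3 * Real.exp (-(z / 32)) := by
  have h1 : Real.exp (-(34 / 32)) ≤ Real.exp (-(z / 32)) := Real.exp_le_exp.mpr (by linarith)
  have h2 : Real.exp (34 / 32) ≤ 3 := by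
    have h3 : Real.exp (34 / 32) = Real.exp 1 * Real.exp (1 / 16) := by
      rw [← Real.exp_add]; norm_num
    have h4 : Real.exp (1 / 16) ≤ 16 / 15 := by
      have := Real.one_sub_le_exp_neg (1 / 16)
      rw [Real.exp_neg] at this
      rw [← inv_inv (Real.exp (1 / 16)), inv_le_comm₀ (by positivity) (by norm_num)]
      linarith
    rw [h3]
    have := Real.exp_one_lt_d9
    nlinarith [Real.exp_pos (1 / 16)]
  have h5 : Real.exp (34 / 32) * Real.exp (-(34 / 32)) = 1 := by rw [← Real.exp_add]; norm_num
  nlinarith [Real.exp_pos (-(34 / 32))]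

lemma one_le_four_mul_exp {z : ℝ} (hz : z ≤ 66) : 1 ≤ 4 * Real.exp (-(z / 48)) := by
  have h1 : Real.exp (-(66 / 48)) ≤ Real.exp (-(z / 48)) := Real.exp_le_exp.mpr (by linarith)
  have h2 : Real.exp (66 / 48) ≤ 4 := by
    rw [← Real.le_log_iff_exp_le (by norm_num), show (4 : ℝ) = 2 ^ (2 : ℕ) by norm_num, Real.log_pow]
    have := Real.log_two_gt_d9
    push_cast
    linarith
  have h5 : Real.exp (66 / 48) * Real.exp (-(66 / 48)) = 1 := by rw [← Real.exp_add]; norm_num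
  nlinarith [Real.exp_pos (-(66 / 48))]

/-- The `Xε² / 24` trials are tuned so that `reachRatio ε` to this power is at most `exp (-(X * ε ^
3 / 12))`. The remaining three errors each fit under `exp (-(X * ε ^ 2 / 32))`, with rounding and
factors `4 / 3` absorbed by `34 ≤ X * ε ^ 2`. -/
lemma settlement_typical_bound (h0 : 0 < ε) (h1 : ε ≤ 1) (hz : 34 ≤ X * ε ^ 2) :
    Real.exp (-(X * (1 / 4) ^ 2 / 2)) +
      (reachRatio ε ^ ⌈X * ε ^ 2 / 24⌉₊ +
        4 / 3 * (Real.exp (-(5 * ε ^ 2 / 18)) ^ ⌊X / 4⌋₊ * (4 / 3) ^ ⌈X * ε ^ 2 / 24⌉₊)) +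
      4 / 3 * Real.exp (-((ε / 2) ^ 2 / 2 * (⌈3 * X / 4⌉₊ - ⌊X / 4⌋₊))) ≤
    Real.exp (-(X * ε ^ 3 / 12)) + 3 * Real.exp (-(X * ε ^ 2 / 32)) := by
  have hε2 : ε ^ 2 ≤ 1 := by nlinarith
  have hX : 34 ≤ X := by
    have : 0 < X := by
      by_contra h
      nlinarith [sq_nonneg ε]
    nlinarith
  set z := X * ε ^ 2
  have hm1 : z / 24 ≤ ⌈z / 24⌉₊ := Nat.le_ceil _
  have hm2 : (⌈z / 24⌉₊ : ℝ) < z / 24 + 1 := Nat.ceil_lt_add_one (by positivity)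
  have hn1 : (⌊X / 4⌋₊ : ℝ) ≤ X / 4 := Nat.floor_le (by positivity)
  have hn2 : X / 4 - 1 ≤ ⌊X / 4⌋₊ := by linarith [Nat.lt_floor_add_one (X / 4)]
  have hn : 3 * X / 4 ≤ ⌈3 * X / 4⌉₊ := Nat.le_ceil _
  have hzX : z ≤ X := by nlinarith
  have hshort : Real.exp (-(X * (1 / 4) ^ 2 / 2)) ≤ Real.exp (-(z / 32)) :=
    Real.exp_le_exp.mpr (by linarith)
  have hreach : reachRatio ε ^ ⌈z / 24⌉₊ ≤ Real.exp (-(X * ε ^ 3 / 12)) := by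
    calc _ ≤ Real.exp (-(2 * ε)) ^ ⌈z / 24⌉₊ :=
          pow_le_pow_left₀ (reachRatio_nonneg h0 h1) (reachRatio_le_exp h0 h1) _
      _ = Real.exp (⌈z / 24⌉₊ * -(2 * ε)) := (Real.exp_nat_mul _ _).symm
      _ ≤ _ := by
          apply Real.exp_le_exp.mpr
          have : X * ε ^ 3 / 12 = z / 24 * (2 * ε) := by ring
          rw [this]
          nlinarith
  have hcut : 4 / 3 * (Real.exp (-(5 * ε ^ 2 / 18)) ^ ⌊X / 4⌋₊ * (4 / 3) ^ ⌈z / 24⌉₊) ≤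
      Real.exp (-(z / 32)) := by
    calc _ ≤ Real.exp (29 / 100) * (Real.exp (-(5 * ε ^ 2 / 18)) ^ ⌊X / 4⌋₊ *
          Real.exp (29 / 100) ^ ⌈z / 24⌉₊) := by
          have := four_thirds_le_exp
          gcongr
      _ = Real.exp (29 / 100 + (⌊X / 4⌋₊ * (-(5 * ε ^ 2 / 18)) + ⌈z / 24⌉₊ * (29 / 100))) := by
          rw [Real.exp_add, Real.exp_add, Real.exp_nat_mul, Real.exp_nat_mul]
      _ ≤ _ := by
          apply Real.exp_le_exp.mpr
          have h3 : (X / 4 - 1) * (5 * ε ^ 2 / 18) ≤ ⌊X / 4⌋₊ * (5 * ε ^ 2 / 18) := by gcongr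
          have h4 : (X / 4 - 1) * (5 * ε ^ 2 / 18) = 5 / 72 * z - 5 * ε ^ 2 / 18 := by ring
          linarith
  have hclimb : 4 / 3 * Real.exp (-((ε / 2) ^ 2 / 2 * (⌈3 * X / 4⌉₊ - ⌊X / 4⌋₊))) ≤
      Real.exp (-(z / 32)) := by
    calc _ ≤ Real.exp (29 / 100) * Real.exp (-((ε / 2) ^ 2 / 2 * (X / 2))) := by
          have := four_thirds_le_exp
          gcongr
          linarith
      _ = Real.exp (29 / 100 + -((ε / 2) ^ 2 / 2 * (X / 2))) := (Real.exp_add _ _).symm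
      _ ≤ _ := by
          apply Real.exp_le_exp.mpr
          have : (ε / 2) ^ 2 / 2 * (X / 2) = z / 16 := by ring
          linarith
  linarith

lemma settlement_late_bound (h0 : 0 < ε) (h1 : ε ≤ 1) (hz : 34 ≤ X * ε ^ 2) :
    (1 / 2 : ℝ) ^ (ε / 2 * ⌈3 * X / 4⌉₊ - ε / 2 * ⌊X / 4⌋₊) *
      (⌈3 * X / 4⌉₊ * (1 - (1 / 2 : ℝ) ^ (ε / 2)) + 1) ≤ Real.exp (-(X * ε / 16)) := by
  have hXε : 34 ≤ X * ε := by nlinarith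
  have hX : 0 < X := by nlinarith
  set n : ℝ := (⌈3 * X / 4⌉₊ : ℝ)
  have hn : 3 * X / 4 ≤ n := Nat.le_ceil _
  have hm : (⌊X / 4⌋₊ : ℝ) ≤ n / 3 := (Nat.floor_le (by positivity)).trans (by linarith)
  have hl1 := Real.log_two_gt_d9
  set y := n * (Real.log 2 * (ε / 2))
  have hy : 1 / 4 * (X * ε) ≤ y := by
    have h2 : 3 * X / 4 * (0.69 * (ε / 2)) ≤ y := by
      apply mul_le_mul hn _ (by positivity) (by linarith)
      gcongr
      linarith
    nlinarith
  have ha : n * (1 - (1 / 2 : ℝ) ^ (ε / 2)) + 1 ≤ Real.exp (2 / 5 * y) := by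
    have h2 : n * (1 - (1 / 2 : ℝ) ^ (ε / 2)) ≤ y :=
      mul_le_mul_of_nonneg_left (one_sub_half_rpow_le _) (by linarith)
    have h3 := Real.quadratic_le_exp_of_nonneg (x := 2 / 5 * y) (by linarith)
    -- The quadratic term wins because `y ≥ 34 / 4 > 15 / 2`. The exponents then combine to `2 / 3 -
    -- 2 / 5 = 4 / 15`, and `y ≥ X * ε / 4` gives `1 / 15 ≥ 1 / 16`.
    nlinarith
  rw [half_rpow]
  calc _ ≤ Real.exp (-(2 / 3 * y)) * Real.exp (2 / 5 * y) := by
        refine mul_le_mul (Real.exp_le_exp.mpr ?_) ha ?_ (Real.exp_pos _).le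
        · have : Real.log 2 * (ε / 2) * ⌊X / 4⌋₊ ≤ Real.log 2 * (ε / 2) * (n / 3) := by gcongr
          simp only [y]
          linarith
        · have := half_rpow_lt_one (half_pos h0)
          have : 0 ≤ n * (1 - (1 / 2 : ℝ) ^ (ε / 2)) := mul_nonneg (by linarith) (by linarith)
          linarith
    _ = Real.exp (-(4 / 15 * y)) := by rw [← Real.exp_add]; ring_nf
    _ ≤ _ := Real.exp_le_exp.mpr (by linarith)

lemma quality_typical_bound (h0 : 0 < ε) (h1 : ε ≤ 1) (hμ : 0 < μ) (hμε : μ < ε) (hX : 0 ≤ X) :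
    Real.exp (-(X * ((ε - μ) / (4 * ε)) ^ 2 / 2)) + 4 / 3 * Real.exp (-(((ε - μ) / 3) ^ 2 / 2 *
      (⌈(1 - (ε - μ) / (4 * ε)) * X⌉₊ - (0 : ℕ)))) ≤
    4 * Real.exp (-(X * (ε - μ) ^ 2 / 48)) := by
  set d := ε - μ
  have hd : 0 < d := by simp only [d]; linarith
  have hdε : d / (4 * ε) ≤ 1 / 4 := by
    rw [div_le_div_iff₀ (by positivity) (by norm_num)]; simp only [d]; linarith
  have hdε' : d / 4 ≤ d / (4 * ε) := by
    apply div_le_div_of_nonneg_left hd.le (by positivity); linarith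
  have hXd : 0 ≤ X * d ^ 2 := by positivity
  have e1 : Real.exp (-(X * (d / (4 * ε)) ^ 2 / 2)) ≤ Real.exp (-(X * d ^ 2 / 48)) := by
    apply Real.exp_le_exp.mpr
    have : X * (d / 4) ^ 2 ≤ X * (d / (4 * ε)) ^ 2 := by gcongr
    nlinarith
  have e2 : Real.exp (-((d / 3) ^ 2 / 2 * (⌈(1 - d / (4 * ε)) * X⌉₊ - (0 : ℕ)))) ≤
      Real.exp (-(X * d ^ 2 / 48)) := by
    apply Real.exp_le_exp.mpr
    have h2 : 3 / 4 * X ≤ ⌈(1 - d / (4 * ε)) * X⌉₊ :=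
      le_trans (by nlinarith) (Nat.le_ceil _)
    have h3 : (d / 3) ^ 2 / 2 * (3 / 4 * X) ≤ (d / 3) ^ 2 / 2 * ⌈(1 - d / (4 * ε)) * X⌉₊ := by
      gcongr
    rw [Nat.cast_zero, sub_zero]
    nlinarith
  linarith [Real.exp_pos (-(X * d ^ 2 / 48))]

/-- Of the margin `ε - μ`, a third is spent on the climb and a quarter on the shortage of non-empty
slots; `1 - 1 / 3 - 1 / 4 = 5 / 12` is left. -/
lemma quality_rate_bound (h0 : 0 < ε) (hμ : 0 < μ) (hμε : μ < ε) (hX : 0 ≤ X) :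
    5 / 12 * (X * (ε - μ)) ≤
      (ε - (ε - μ) / 3) * ⌈(1 - (ε - μ) / (4 * ε)) * X⌉₊ - X * μ := by
  have h2 : (1 - (ε - μ) / (4 * ε)) * X ≤ ⌈(1 - (ε - μ) / (4 * ε)) * X⌉₊ := Nat.le_ceil _
  have h3 : (ε - (ε - μ) / 3) * ((1 - (ε - μ) / (4 * ε)) * X) ≤
      (ε - (ε - μ) / 3) * ⌈(1 - (ε - μ) / (4 * ε)) * X⌉₊ :=
    mul_le_mul_of_nonneg_left h2 (by linarith)
  have h4 : (ε - (ε - μ) / 3) * ((1 - (ε - μ) / (4 * ε)) * X) =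
      X * (ε - (ε - μ) / 3 - (ε - μ) / 4 + (ε - μ) ^ 2 / (12 * ε)) := by
    field_simp
    ring
  have h5 : X * (ε - (ε - μ) / 3 - (ε - μ) / 4) ≤
      X * (ε - (ε - μ) / 3 - (ε - μ) / 4 + (ε - μ) ^ 2 / (12 * ε)) :=
    mul_le_mul_of_nonneg_left (le_add_of_nonneg_right (by positivity)) hX
  linarith

/-- The rate `5 / 12 * log 2 > 143 / 500` pays `4 / 25` for the polynomial factor and keeps `126 /
1000 ≥ 1 / 8`. -/
lemma quality_late_bound (h0 : 0 < ε) (h1 : ε ≤ 1) (hμ : 0 < μ) (hμε : μ < ε)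
    (hz : 66 ≤ X * (ε - μ) ^ 2) :
    (1 / 2 : ℝ) ^ ((ε - (ε - μ) / 3) * ⌈(1 - (ε - μ) / (4 * ε)) * X⌉₊ - X * μ) *
      (⌈(1 - (ε - μ) / (4 * ε)) * X⌉₊ * (1 - (1 / 2 : ℝ) ^ (ε / 2)) + 1) ≤
    Real.exp (-(X * (ε - μ) / 8)) := by
  have hX : 0 < X := by
    by_contra hX
    nlinarith [sq_nonneg (ε - μ)]
  have hrate := quality_rate_bound h0 hμ hμε hX.le
  set d := ε - μ
  have hd : 0 < d := by simp only [d]; linarith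
  have hd1 : d ≤ 1 := by simp only [d]; linarith
  have hl1 := Real.log_two_gt_d9
  have hl2 := Real.log_two_lt_d9
  have hn1 : (⌈(1 - d / (4 * ε)) * X⌉₊ : ℝ) ≤ X + 1 := by
    have h2 : (⌈(1 - d / (4 * ε)) * X⌉₊ : ℝ) ≤ ⌈X⌉₊ := by
      have : (1 - d / (4 * ε)) * X ≤ X := by
        have : 0 ≤ d / (4 * ε) := by positivity
        nlinarith
      exact_mod_cast Nat.ceil_mono this
    exact h2.trans (Nat.ceil_lt_add_one hX.le).le
  set n : ℝ := (⌈(1 - d / (4 * ε)) * X⌉₊ : ℝ)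
  have hn0 : 0 ≤ n := Nat.cast_nonneg _
  set w := X * d
  have hw : 66 ≤ w := by
    have : X * d ^ 2 = w * d := by ring
    nlinarith
  have hXw : 66 * X ≤ w ^ 2 := by
    have : w ^ 2 = X * (X * d ^ 2) := by ring
    nlinarith
  have ha : n * (1 - (1 / 2 : ℝ) ^ (ε / 2)) + 1 ≤ Real.exp (4 / 25 * w) := by
    have h2 : 1 - (1 / 2 : ℝ) ^ (ε / 2) ≤ 7 / 20 :=
      (one_sub_half_rpow_le _).trans (by nlinarith)
    have h3 : n * (1 - (1 / 2 : ℝ) ^ (ε / 2)) ≤ (X + 1) * (7 / 20) :=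
      (mul_le_mul_of_nonneg_left h2 hn0).trans (by linarith)
    have h4 := Real.quadratic_le_exp_of_nonneg (x := 4 / 25 * w) (by linarith)
    nlinarith
  rw [half_rpow]
  calc _ ≤ Real.exp (-(143 / 500 * w)) * Real.exp (4 / 25 * w) := by
        refine mul_le_mul (Real.exp_le_exp.mpr ?_) ha ?_ (Real.exp_pos _).le
        · have : Real.log 2 * (5 / 12 * w) ≤ Real.log 2 * ((ε - d / 3) * n - X * μ) := by gcongr
          nlinarith
        · have := half_rpow_lt_one (half_pos h0)
          have : 0 ≤ n * (1 - (1 / 2 : ℝ) ^ (ε / 2)) := mul_nonneg hn0 (by linarith)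
          linarith
    _ = Real.exp (-(126 / 1000 * w)) := by rw [← Real.exp_add]; ring_nf
    _ ≤ _ := Real.exp_le_exp.mpr (by linarith)

end Numerics

end LongestChain

end

noncomputable section

namespace LongestChain

/-! ### Security of the protocol -/

section Security

variable {Ω H Payload : Type*} [MeasurableSpace Ω] {P : Measure Ω} {ν : Measure ℕ∞}
  {L : ℕ → Ω → Finset (Option H)} {D : ℕ → H → H → Ω → ℕ∞} {r : Rates} {K : Set (Option H)}
  {ε : ℝ} {E : Ω → Transcript H Payload}

lemma Rates.one_sub_φ_le (h0 : 0 < ε) (hp : r.p = (1 + ε) / 2) : 1 - r.φ 0 ≤ 1 / 2 := by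
  have : r.p ≤ r.φ 0 := mul_le_of_le_one_left (r.φ_nonneg 0) r.α_le
  linarith

/-- The security bound for properties that hold unless few slots are non-empty, some rare event
occurs, or some party is late. -/
lemma LeaderLaw.measure_le_of_late [IsProbabilityMeasure P] [IsProbabilityMeasure ν]
    (hL : LeaderLaw P L ν r.f r.α K)
    (hD : IIDDelays P D ν) (hLD : LeadersIndepDelays P L D)
    (hF : ∀ g, r.F g = ν.real {d | d < (g : ℕ∞)}) (h0 : 0 < ε) (hp : r.p = (1 + ε) / 2) {I : Set H}
    {s k : ℕ} {δ A B b T Q : ℝ} (hδ : 0 ≤ δ) (hA : ε / 2 ≤ A) {S V : Set Ω}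
    (hS : P S ≤ ENNReal.ofReal b) (hb : 0 ≤ b) (hQ : 0 < Q)
    (hV : ∀ ω ∈ V, ω ∉ S → ⌈(1 - δ) * (k * r.f)⌉₊ ≤ WordLaw.numAfter s (typesUpTo L D (s + k) ω) →
      ∃ o ∈ I, ω ∈ lateEvent L D o s ⌈(1 - δ) * (k * r.f)⌉₊ fun j => ⌊A * j - B⌋₊)
    (hT : Real.exp (-(k * r.f * δ ^ 2 / 2)) + b ≤ T)
    (hlate : (1 / 2 : ℝ) ^ (A * ⌈(1 - δ) * (k * r.f)⌉₊ - B) *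
      (⌈(1 - δ) * (k * r.f)⌉₊ * (1 - (1 / 2 : ℝ) ^ (ε / 2)) + 1) ≤ Q) :
    P V ≤ ENNReal.ofReal T +
      (I.encard : ℝ≥0∞) * ENNReal.ofReal (2 / (1 - (1 / 2 : ℝ) ^ (ε / 2)) * Q) := by
  have hx := half_rpow_lt_one (half_pos h0)
  have hx' : 0 < 2 / (1 - (1 / 2 : ℝ) ^ (ε / 2)) := div_pos two_pos (by linarith)
  set n := ⌈(1 - δ) * (k * r.f)⌉₊
  set g : ℕ → ℕ := fun j => ⌊A * j - B⌋₊
  have hg : Monotone g := fun i j hij => Nat.floor_mono (by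
    have : (i : ℝ) ≤ j := by exact_mod_cast hij
    have : 0 ≤ A := by linarith
    gcongr)
  have hW := hL.wordLaw hD hLD hF
  have hcov : V ⊆ ({ω | (WordLaw.numAfter s (typesUpTo L D (s + k) ω) : ℝ) <
      (1 - δ) * (k * r.f)} ∪ S) ∪ ⋃ o ∈ I, lateEvent L D o s n g := by
    intro ω hω
    by_contra hnot
    simp only [Set.mem_union, not_or, Set.mem_ofPred_eq, not_lt] at hnot
    obtain ⟨o, ho, hlate⟩ := hV ω hω hnot.1.2 (Nat.ceil_le.mpr hnot.1.1)
    exact hnot.2 (Set.mem_biUnion ho hlate)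
  refine (measure_mono hcov).trans ((measure_union_le _ _).trans (add_le_add ?_ ?_))
  · refine (measure_union_le _ _).trans ((add_le_add (hW.measure_numAfter_lt_le s k hδ) hS).trans ?_)
    rw [← ENNReal.ofReal_add (Real.exp_pos _).le hb]
    exact ENNReal.ofReal_le_ofReal hT
  · refine measure_biUnion_le_encard_mul ?_ fun o _ => ?_
    · simpa using mul_pos hx' hQ
    · refine (hL.measure_lateEvent_le hD hLD hF (Rates.one_sub_φ_le h0 hp) o s n hg).trans
        ((tsum_late_le ?_ hx n).trans (ENNReal.ofReal_le_ofReal ?_))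
      · exact Real.rpow_le_rpow_of_exponent_ge (by norm_num) (by norm_num) hA
      · exact mul_le_mul_of_nonneg_left hlate hx'.le

lemma measure_le_of_one_le [IsProbabilityMeasure P] {V : Set Ω} {T : ℝ} {c : ℝ≥0∞} (hT : 1 ≤ T) :
    P V ≤ ENNReal.ofReal T + c := by
  refine prob_le_one.trans (le_add_right ?_)
  rw [← ENNReal.ofReal_one]
  exact ENNReal.ofReal_le_ofReal hT

theorem LeaderLaw.measure_not_settlement_le [IsProbabilityMeasure P] [IsProbabilityMeasure ν]
    (hL : LeaderLaw P L ν r.f r.α K) (hD : IIDDelays P D ν) (hLD : LeadersIndepDelays P L D)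
    (hF : ∀ g, r.F g = ν.real {d | d < (g : ℕ∞)}) (h0 : 0 < ε) (hp : r.p = (1 + ε) / 2)
    (hE : ∀ ω, IsExecution (fun t => L t ω) (fun t h h' => D t h h' ω) (E ω)) (I : Set H)
    (s k : ℕ) :
    P {ω | ¬ Settlement (E ω) s k I} ≤
      ENNReal.ofReal (Real.exp (-(k * r.f * ε ^ 3 / 12)) + 3 * Real.exp (-(k * r.f * ε ^ 2 / 32))) +
      (I.encard : ℝ≥0∞) * ENNReal.ofReal
        (2 / (1 - (1 / 2 : ℝ) ^ (ε / 2)) * Real.exp (-(k * r.f * ε / 16))) := by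
  have h1 : ε ≤ 1 := by have := r.p_le_one; linarith
  have hW := hL.wordLaw hD hLD hF
  -- Below this threshold the claimed bound is at least `1`.
  rcases lt_or_ge (k * r.f * ε ^ 2) 34 with hz | hz
  · exact measure_le_of_one_le ((one_le_three_mul_exp hz.le).trans
      (le_add_of_nonneg_left (Real.exp_pos _).le))
  have hX : 34 ≤ k * r.f := by
    have : 0 ≤ k * r.f := mul_nonneg (Nat.cast_nonneg _) r.f_pos.le
    have : ε ^ 2 ≤ 1 := by nlinarith
    nlinarith
  have htyp := settlement_typical_bound h0 h1 hz
  have hlate := settlement_late_bound h0 h1 hz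
  rw [show 3 * (k * r.f) / 4 = (1 - 1 / 4) * (k * r.f) by ring] at htyp hlate
  -- Of the expected `k * f` non-empty slots, a quarter may be missing, a quarter is searched for a
  -- cut with up to `l` trials, and the remaining half lets the walk climb beyond the cut.
  set n := ⌈(1 - 1 / 4) * (k * r.f)⌉₊
  set m := ⌊k * r.f / 4⌋₊
  set l := ⌈k * r.f * ε ^ 2 / 24⌉₊
  have hmn : m ≤ n := Nat.floor_le_of_le
    (le_trans (by linarith) (Nat.le_ceil ((1 - 1 / 4) * (k * r.f))))
  have hm : 0 < m := Nat.floor_pos.mpr (by linarith)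
  have hl : 0 < l := Nat.ceil_pos.mpr (by linarith)
  have hratio := reachRatio_nonneg h0 h1
  have hS : P (cutFreeEvent L D s m ∪ slowEvent L D s m n (ε - ε / 2)) ≤ ENNReal.ofReal _ :=
    (measure_union_le _ _).trans ((add_le_add (hW.measure_cutFree_le h0 h1 hp s hl hm)
      (hW.measure_climb_le h0 h1 hp (half_pos h0) le_rfl hmn s)).trans
      (ENNReal.ofReal_add (by positivity) (by positivity)).ge)
  refine hL.measure_le_of_late hD hLD hF h0 hp (s := s) (δ := 1 / 4) (A := ε / 2) (B := ε / 2 * m)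
    (by norm_num) le_rfl hS (by positivity) (Real.exp_pos _) (fun ω hω hS hnum => ?_)
    (by rw [← add_assoc]; exact htyp) hlate
  by_contra hno
  push Not at hno
  rw [Set.mem_union, not_or] at hS
  refine hω (settlement_of_notMem (hE ω) hmn hnum (fun j hj => ?_) hS.2 hS.1 hno)
  have hmj : (m : ℝ) ≤ j := by exact_mod_cast hmn.trans hj
  refine (Nat.floor_le ?_).trans (by linarith)
  rw [← mul_sub]
  exact mul_nonneg (half_pos h0).le (by linarith)

theorem LeaderLaw.measure_not_intensiveChainQuality_le [IsProbabilityMeasure P]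
    [IsProbabilityMeasure ν] (hL : LeaderLaw P L ν r.f r.α K) (hD : IIDDelays P D ν)
    (hLD : LeadersIndepDelays P L D) (hF : ∀ g, r.F g = ν.real {d | d < (g : ℕ∞)}) (h0 : 0 < ε)
    (hp : r.p = (1 + ε) / 2)
    (hE : ∀ ω, IsExecution (fun t => L t ω) (fun t h h' => D t h h' ω) (E ω)) (I : Set H)
    (s k : ℕ) {μ : ℝ} (hμ : 0 < μ) (hμε : μ < ε) :
    P {ω | ¬ IntensiveChainQuality (E ω) r.f μ s k I} ≤
      ENNReal.ofReal (4 * Real.exp (-(k * r.f * (ε - μ) ^ 2 / 48))) +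
      (I.encard : ℝ≥0∞) * ENNReal.ofReal
        (2 / (1 - (1 / 2 : ℝ) ^ (ε / 2)) * Real.exp (-(k * r.f * (ε - μ) / 8))) := by
  have h1 : ε ≤ 1 := by have := r.p_le_one; linarith
  have hW := hL.wordLaw hD hLD hF
  have hX : 0 ≤ k * r.f := mul_nonneg (Nat.cast_nonneg _) r.f_pos.le
  rcases lt_or_ge (k * r.f * (ε - μ) ^ 2) 66 with hz | hz
  · exact measure_le_of_one_le (one_le_four_mul_exp hz.le)
  have hd : 0 < ε - μ := by linarith
  have hrate := quality_rate_bound h0 hμ hμε hX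
  -- A third of the margin `ε - μ` is the loss in the climbing rate, and the shortage `δ` is scaled
  -- by `1 / ε` so that it costs a quarter of the margin at rate `ε`. No cut is needed, so the climb
  -- is compared with index `0`.
  refine hL.measure_le_of_late hD hLD hF h0 hp (s := s) (δ := (ε - μ) / (4 * ε)) (A := ε - (ε - μ) / 3)
    (B := k * r.f * μ) (by positivity) (by linarith)
    (hW.measure_climb_le h0 h1 hp (θ := (ε - μ) / 3) (by positivity) (by linarith) (Nat.zero_le _) s)
    (by positivity) (Real.exp_pos _) (fun ω hω hS hnum => ?_)
    (quality_typical_bound h0 h1 hμ hμε hX) (quality_late_bound h0 h1 hμ hμε hz)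
  by_contra hno
  push Not at hno
  refine hω (intensiveChainQuality_of_notMem (hE ω) hnum (fun j hj => Nat.floor_le ?_) hS hno)
  have hj' : (⌈(1 - (ε - μ) / (4 * ε)) * (k * r.f)⌉₊ : ℝ) ≤ j := by exact_mod_cast hj
  have h2 : (ε - (ε - μ) / 3) * ⌈(1 - (ε - μ) / (4 * ε)) * (k * r.f)⌉₊ ≤ (ε - (ε - μ) / 3) * j :=
    mul_le_mul_of_nonneg_left hj' (by linarith)
  have h3 : 0 ≤ 5 / 12 * (k * r.f * (ε - μ)) := by positivity
  linarith

end Security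

end LongestChain

end

theorem theorem1 {Ω H Payload : Type*} [MeasurableSpace Ω]
    (P : MeasureTheory.Measure Ω) [MeasureTheory.IsProbabilityMeasure P]
    (L : ℕ → Ω → Finset (Option H)) (D : ℕ → H → H → Ω → ℕ∞)
    (ν : MeasureTheory.Measure ℕ∞) [MeasureTheory.IsProbabilityMeasure ν]
    (hD : LongestChain.IIDDelays P D ν) (hLD : LongestChain.LeadersIndepDelays P L D)
    (hmodel : (LongestChain.IIDLeaders P L ∧ Monotone (LongestChain.failureRate ν)) ∨
      ∃ m : ℕ ↪ H, LongestChain.OneTimeLeaders P m L)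
    (ε : ℝ) (hmaj : LongestChain.HonestMajority P L ν ε)
    (f : ℝ) (hf : f = LongestChain.miningRate P L)
    (E : Ω → LongestChain.Transcript H Payload)
    (hE : ∀ ω, LongestChain.IsExecution (fun t => L t ω) (fun t h h' => D t h h' ω) (E ω))
    (I : Set H) (s k : ℕ) :
    P {ω | ¬ LongestChain.Settlement (E ω) s k I} ≤
        ENNReal.ofReal
          (Real.exp (-(k * f * ε ^ 3 / 12)) + 3 * Real.exp (-(k * f * ε ^ 2 / 32))) +
        (I.encard : ENNReal) * ENNReal.ofReal
          (2 / (1 - (1 / 2 : ℝ) ^ (ε / 2)) * Real.exp (-(k * f * ε / 16))) ∧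
    ∀ μ : ℝ, 0 < μ → μ < ε →
      P {ω | ¬ LongestChain.IntensiveChainQuality (E ω) f μ s k I} ≤
        ENNReal.ofReal (4 * Real.exp (-(k * f * (ε - μ) ^ 2 / 48))) +
        (I.encard : ENNReal) * ENNReal.ofReal
          (2 / (1 - (1 / 2 : ℝ) ^ (ε / 2)) * Real.exp (-(k * f * (ε - μ) / 8))) := by
  obtain ⟨r, K, hL, hrf, hF, hp⟩ := LongestChain.exists_rates hmodel hmaj
  rw [← hrf] at hf
  subst hf
  exact ⟨hL.measure_not_settlement_le hD hLD hF hmaj.1 hp hE I s k, fun μ hμ hμε =>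
    hL.measure_not_intensiveChainQuality_le hD hLD hF hmaj.1 hp hE I s k hμ hμε⟩
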